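/- Let $\kappa'\in(4,8)$, $\gamma=4/\sqrt{\kappa'}$ and $a<b$ real. Let $\alpha>0$ and let $Z=(L,R):\mathbb R\to\mathbb R^2$ be a two-sided correlated planar Brownian motion with $Z_0=0$ (continuous paths, independent increments, centred Gaussian increments, the increment over $[s,t]$ having the law of $Z_{t-s}$) such that $$\operatorname{Var}L_t=\operatorname{Var}R_t=\alpha|t|,\qquad \operatorname{Cov}(L_t,R_t)=-\alpha\cos\!\left(\frac{\pi\gamma^2}{4}\right)|t|,\qquad t\in\mathbb R.$$ A time $t\in\mathbb R$ is a $\pi/2$-cone time for $Z$ if there is $t'<t$ with $L_s\ge L_t$ and $R_s\ge R_t$ for all $s\in[t',t]$; if $v_Z(t)$ denotes the infimum of all such $t'$, then $[v_Z(t),t]$ is the corresponding $\pi/2$-cone interval. Let $\mathcal A$ be the set of $t\in[a,b]$ which are not contained in any $\pi/2$-cone interval for $Z$ that is itself contained in $[a,b]$, and for $\epsilon>0$ let $N_\epsilon$ be the minimal number of closed intervals of length $\epsilon$ needed to cover $\mathcal A$. Then $N_\epsilon$ is a random variable (up to a null set), and there is a constant $C>0$ depending only on $\kappa'$, $a$ and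 $b$ such that $$\mathbb E[N_\epsilon]\le C\,\epsilon^{-\kappa'/8}\qquad\text{for all }\epsilon\in(0,1).$$ -/

import Mathlib

open MeasureTheory ProbabilityTheory

noncomputable section

/-- The covariance matrix at time one: both coordinates have variance `α`, and their covariance
is `-α cos(π γ² / 4)`. -/
def covMat (α γ : ℝ) : Matrix (Fin 2) (Fin 2) ℝ :=
  !![α, -α * Real.cos (Real.pi * γ ^ 2 / 4);
     -α * Real.cos (Real.pi * γ ^ 2 / 4), α]

/-- `Z = (L, R)` is a two-sided correlated planar Brownian motion started from `0` with covariance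
matrix `S` at time one: the increments over disjoint time intervals of `ℝ` are independent, the
increment over `[s, t]` is a centred Gaussian vector with covariance matrix `(t - s) S`, and almost
every path is continuous. -/
structure IsCorrelatedBM {Ω : Type*} [MeasurableSpace Ω] (S : Matrix (Fin 2) (Fin 2) ℝ)
    (Z : ℝ → Ω → EuclideanSpace ℝ (Fin 2)) (P : Measure Ω) : Prop where
  zero : ∀ᵐ ω ∂P, Z 0 ω = 0
  indep : HasIndepIncrements Z P
  law : ∀ s t : ℝ, s ≤ t →
    HasLaw (fun ω ↦ Z t ω - Z s ω) (multivariateGaussian 0 ((t - s) • S)) P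
  cont : ∀ᵐ ω ∂P, Continuous fun t ↦ Z t ω

/-- The times `t' < t` such that both coordinates of `z` are at least their value at time `t`
throughout `[t', t]`. The time `t` is a `π/2`-cone time for `z` when this set is nonempty. -/
def coneStarts (z : ℝ → EuclideanSpace ℝ (Fin 2)) (t : ℝ) : Set ℝ :=
  {t' | t' < t ∧ ∀ s ∈ Set.Icc t' t, ∀ i, z t i ≤ z s i}

/-- `t` is a `π/2`-cone time for `z`. -/
def IsConeTime (z : ℝ → EuclideanSpace ℝ (Fin 2)) (t : ℝ) : Prop :=
  (coneStarts z t).Nonempty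

/-- `[v, t]` is a `π/2`-cone interval for `z`: `t` is a `π/2`-cone time and `v` is the cone
entrance time, the infimum of `coneStarts z t` (if this set is unbounded below, the infimum is
`-∞` and there is no compact cone interval ending at `t`). -/
def IsConeInterval (z : ℝ → EuclideanSpace ℝ (Fin 2)) (v t : ℝ) : Prop :=
  IsConeTime z t ∧ IsGLB (coneStarts z t) v

/-- The set of times in `[a, b]` which are not contained in any `π/2`-cone interval for `z` that is
itself contained in `[a, b]`. -/
def ancestorFree (z : ℝ → EuclideanSpace ℝ (Fin 2)) (a b : ℝ) : Set ℝ :=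
  {t | t ∈ Set.Icc a b ∧
    ¬ ∃ v s : ℝ, IsConeInterval z v s ∧ Set.Icc v s ⊆ Set.Icc a b ∧ t ∈ Set.Icc v s}

/-- The minimal number of closed intervals of length `ε` needed to cover `A`. -/
def intervalCoverNumber (ε : ℝ) (A : Set ℝ) : ℕ∞ :=
  ⨅ (F : Finset ℝ) (_ : A ⊆ ⋃ x ∈ F, Set.Icc x (x + ε)), (F.card : ℕ∞)

end

/-! Put `al = 2 - κ'/4`, which lies in `(0, 1)`, so that `κ'/8 = 1 - al/2`. Dividing the coordinates
by `√α` changes no cone time, so `α` disappears from all constants. Cut `[a, b]` into `M ≈ (b -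
a)/ε` bins. It suffices to bound, for each bin `[t, t + ε]`, the probability that it contains an
ancestor-free time.

Reflect `L` and `R` at their running infima since `t`. If the reflected pair is at the corner at a
time `S ≥ t + ε`, then `t` is a cone start for `S`, so the cone interval ending at `S` contains the
bin. If the bin contains an ancestor-free time and `S ≤ b`, that interval must reach back before
`a`, which forces `L S ≤ L u` for every `u ∈ [a, t]` (`IsPlanarBM.mem_lowVisits`). Hence either the
corner is avoided for a long time, or `L` is below its past minimum over `[a, t]` at each visit.

Avoiding the corner: `conePoint` maps the quadrant to a cone of opening `4π/κ'`, where the free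
motion is a multiple of standard planar Brownian motion and `Re (w ^ al)` is positive, harmonic, and
has zero derivative in the two directions of reflection. It is therefore a supermartingale before
the first visit to the corner, and comparing its values at the two ends gives probability of order
`2 ^ (-n * al/2)` for no visit during `[t + r, t + 2 ^ n * r]`
(`IsPlanarBM.measureReal_noVisit_le`). Stochastic calculus is replaced by Taylor expansion along a
grid whose mesh tends to `0`.

Undercutting the past: the depth of the past minimum is independent of the future and is at most `y`
with probability at most `100 * y / √(t - a)` (`IsPlanarBM.measure_pastDepth_le`). Splitting by the
dyadic scale of the first visit bounds the probability for a bin by a multiple of `2 ^ (-J * al/2) +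
√(r / (t - a)) * 2 ^ (J * (1 - al)/2)` (`IsPlanarBM.measureReal_lowVisits_le`). For the `k`-th bin
take `r = ε` and `2 ^ J ≈ M - 1 - k`; the sum over `k` has order `M ^ (1 - al/2)`.

The cover number exceeds `n` iff there are `n + 1` ancestor-free times with gaps larger than `ε`.
This event is the projection of a jointly measurable set, so the measurable projection theorem gives
null measurability. -/

/-! ### Capacitability of analytic sets and the measurable projection theorem. -/

section Projection

open Set Filter Topology

/-- An analytic set is inner regular for a finite measure with respect to compact sets. -/
theorem MeasureTheory.AnalyticSet.exists_isCompact_le {X : Type*} [TopologicalSpace X] [T2Space X]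
    [MeasurableSpace X] [OpensMeasurableSpace X] (μ : Measure X) [IsFiniteMeasure μ] {s : Set X}
    (hs : AnalyticSet s) {c : ENNReal} (hc : c < μ s) :
    ∃ K ⊆ s, IsCompact K ∧ c ≤ μ K := by
  rw [AnalyticSet] at hs
  rcases hs with rfl | ⟨f, hf, rfl⟩
  · simp at hc
  -- Coordinates are bounded one at a time, each bound being so large that the image keeps measure
  -- above `c`. The images need not be measurable: continuity from below holds for the outer measure
  -- along any increasing sequence.
  let S : (ℕ → ℕ) → ℕ → Set (ℕ → ℕ) := fun n k => {x | ∀ i < k, x i ≤ n i}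
  have step : ∀ k (n : {n : ℕ → ℕ // c < μ (f '' S n k)}),
      ∃ v : ℕ, c < μ (f '' S (Function.update n.1 k v) (k + 1)) := by
    rintro k ⟨n, hn⟩
    have hU : f '' S n k = ⋃ v : ℕ, f '' S (Function.update n k v) (k + 1) := by
      rw [← image_iUnion]
      congr 1
      ext x
      simp only [S, mem_ofPred_eq, mem_iUnion]
      constructor
      · intro h
        refine ⟨x k, fun i hi => ?_⟩
        rcases Nat.lt_succ_iff_lt_or_eq.1 hi with h' | rfl
        · rw [Function.update_of_ne h'.ne]; exact h i h'
        · simp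
      · rintro ⟨v, hv⟩ i hi
        have := hv i (by omega)
        rwa [Function.update_of_ne hi.ne] at this
    have hmono : Monotone fun v : ℕ => f '' S (Function.update n k v) (k + 1) := by
      intro v w hvw
      refine image_mono fun x hx i hi => ?_
      refine (hx i hi).trans ?_
      by_cases h : i = k
      · subst h; simpa using hvw
      · simp [Function.update_of_ne h]
    have hn' : c < μ (f '' S n k) := hn
    rw [hU, hmono.measure_iUnion] at hn'
    exact lt_iSup_iff.1 hn'
  have h0 : c < μ (f '' S 0 0) := by simpa [S, image_univ] using hc
  let a : (k : ℕ) → {n : ℕ → ℕ // c < μ (f '' S n k)} := fun k =>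
    Nat.rec ⟨0, h0⟩ (fun k n => ⟨Function.update n.1 k (step k n).choose, (step k n).choose_spec⟩) k
  have ha : ∀ k, (a (k + 1)).1 = Function.update (a k).1 k (step k (a k)).choose := fun k => rfl
  have ha' : ∀ i d, (a (i + 1 + d)).1 i = (a (i + 1)).1 i := by
    intro i d
    induction d with
    | zero => rfl
    | succ d ih =>
      rw [← add_assoc, ha, Function.update_of_ne (by omega), ih]
  let n : ℕ → ℕ := fun i => (a (i + 1)).1 i
  have hSn : ∀ k, S n k = S (a k).1 k := by
    intro k
    ext x
    refine forall_congr' fun i => forall_congr' fun hi => ?_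
    obtain ⟨d, rfl⟩ := Nat.exists_eq_add_of_lt hi
    have := ha' i d
    simp only [n]
    rw [show i + d + 1 = i + 1 + d by ring, this]
  have hck : ∀ k, c < μ (f '' S n k) := fun k => by rw [hSn]; exact (a k).2
  let K : Set (ℕ → ℕ) := {x | ∀ i, x i ≤ n i}
  have hK : IsCompact K := by
    have : K = Set.pi univ fun i => Iic (n i) := by ext x; simp [K, Pi.le_def]
    rw [this]
    exact isCompact_univ_pi fun i => (finite_Iic (n i)).isCompact
  refine ⟨f '' K, image_subset_range _ _, hK.image hf, ?_⟩
  have hanti : Antitone fun k => closure (f '' S n k) := by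
    intro k l hkl
    exact closure_mono (image_mono fun x hx i hi => hx i (hi.trans_le hkl))
  -- A point off the compact image is separated from it by disjoint open sets, and the open set
  -- around `f '' K` already contains the image of some `S n k`.
  have hsub : ⋂ k, closure (f '' S n k) ⊆ f '' K := by
    intro y hy
    by_contra hyK
    obtain ⟨U, V, hU, hV, hKU, hyV, hUV⟩ :=
      (hK.image hf).separation_of_notMem hyK
    have : ∃ k, S n k ⊆ f ⁻¹' U := by
      by_contra! hno
      have : ∀ k, ∃ x ∈ S n k, x ∉ f ⁻¹' U := fun k => not_subset.1 (hno k)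
      choose x hxS hxU using this
      -- Clipping moves the points into `K` without changing their first `k` coordinates, so the
      -- original points have the same subsequential limit.
      let x' : ℕ → ℕ → ℕ := fun k i => min (x k i) (n i)
      obtain ⟨z, hz, φ, hφ, hlim⟩ := hK.tendsto_subseq (x := x') fun k i => min_le_right _ _
      have hlim' : Tendsto (fun k => x (φ k)) atTop (𝓝 z) := by
        rw [tendsto_pi_nhds] at hlim ⊢
        intro i
        refine (hlim i).congr' ?_
        filter_upwards [eventually_gt_atTop i] with k hk
        simp only [Function.comp, x']
        exact min_eq_left (hxS (φ k) i (hk.trans_le (hφ.id_le k)))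
      have hcl : IsClosed (f ⁻¹' U)ᶜ := (hU.preimage hf).isClosed_compl
      have := hcl.mem_of_tendsto hlim' (Eventually.of_forall fun k => hxU _)
      exact this (hKU (mem_image_of_mem f hz))
    obtain ⟨k, hk⟩ := this
    have h1 : closure (f '' S n k) ⊆ Vᶜ :=
      closure_minimal ((image_subset_iff.2 hk).trans (hUV.subset_compl_right)) hV.isClosed_compl
    exact h1 (mem_iInter.1 hy k) hyV
  have hle := tendsto_measure_iInter_atTop (μ := μ)
    (fun k => (isClosed_closure (s := f '' S n k)).measurableSet.nullMeasurableSet) hanti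
    ⟨0, measure_ne_top _ _⟩
  refine le_trans ?_ (measure_mono hsub)
  exact ge_of_tendsto' hle fun k => (hck k).le.trans (measure_mono subset_closure)

/-- Analytic sets are universally measurable. -/
theorem MeasureTheory.AnalyticSet.nullMeasurableSet {X : Type*} [TopologicalSpace X] [T2Space X]
    [MeasurableSpace X] [OpensMeasurableSpace X] (μ : Measure X) [IsFiniteMeasure μ] {s : Set X}
    (hs : AnalyticSet s) : NullMeasurableSet s μ := by
  by_cases h0 : μ s = 0
  · exact NullMeasurableSet.of_null h0
  obtain ⟨u, -, hu, hlim⟩ := exists_seq_strictMono_tendsto' (pos_iff_ne_zero.2 h0)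
  choose K hKs hK huK using fun n => hs.exists_isCompact_le μ (hu n).2
  have hT : MeasurableSet (⋃ n, K n) := MeasurableSet.iUnion fun n => (hK n).measurableSet
  have hTs : ⋃ n, K n ⊆ s := iUnion_subset hKs
  have hμ : μ s ≤ μ (⋃ n, K n) :=
    le_of_tendsto' hlim fun n => (huK n).trans (measure_mono (subset_iUnion K n))
  refine hT.nullMeasurableSet.congr ?_
  -- The difference is taken from the measurable hull, since `s` itself is not yet known to be
  -- measurable.
  have h2 : μ (toMeasurable μ s \ ⋃ n, K n) = 0 := by
    rw [measure_sdiff (hTs.trans (subset_toMeasurable _ _)) hT.nullMeasurableSet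
      (measure_ne_top _ _),
      measure_toMeasurable, tsub_eq_zero_of_le hμ]
  have h3 : μ (s \ ⋃ n, K n) = 0 :=
    measure_mono_null (sdiff_le_sdiff_right (subset_toMeasurable μ s)) h2
  exact (LE.le.eventuallyLE hTs).antisymm (ae_le_set.2 h3)

/-- A measurable subset of a product is the preimage of a measurable set under a map which
factors the first coordinate through the Cantor space. -/
theorem MeasurableSet.exists_preimage_cantor {Ω Y : Type*} [MeasurableSpace Ω] [MeasurableSpace Y]
    {B : Set (Ω × Y)} (hB : MeasurableSet B) :
    ∃ f : Ω → ℕ → Bool, Measurable f ∧ ∃ B' : Set ((ℕ → Bool) × Y), MeasurableSet B' ∧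
      B = Prod.map f id ⁻¹' B' := by
  classical
  rw [← generateFrom_prod] at hB
  induction hB with
  | basic t ht =>
    obtain ⟨S, hS, T, hT, rfl⟩ := ht
    refine ⟨fun ω _ => decide (ω ∈ S), ?_, {p | p.1 0 = true} ∩ Prod.snd ⁻¹' T, ?_, ?_⟩
    · refine measurable_pi_lambda _ fun _ => ?_
      exact measurable_to_bool (by
        have : (fun ω => decide (ω ∈ S)) ⁻¹' {true} = S := by ext; simp
        rw [this]; exact hS)
    · refine MeasurableSet.inter ?_ (measurable_snd hT)
      have h0 : Measurable fun p : (ℕ → Bool) × Y => p.1 0 := by fun_prop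
      exact h0 (measurableSet_singleton true)
    · ext ⟨ω, y⟩
      simp
  | empty => exact ⟨fun _ _ => true, measurable_const, ∅, MeasurableSet.empty, by simp⟩
  | compl t _ ih =>
    obtain ⟨f, hf, B', hB', rfl⟩ := ih
    exact ⟨f, hf, B'ᶜ, hB'.compl, by simp⟩
  | iUnion t _ ih =>
    choose f hf B' hB' hEq using ih
    -- Countably many Cantor codes are interleaved into a single one by the pairing function.
    refine ⟨fun ω k => f k.unpair.1 ω k.unpair.2, ?_,
      ⋃ n, (fun p : (ℕ → Bool) × Y => ((fun m => p.1 (Nat.pair n m)), p.2)) ⁻¹' B' n, ?_, ?_⟩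
    · exact measurable_pi_lambda _ fun k => (measurable_pi_apply _).comp (hf _)
    · refine MeasurableSet.iUnion fun n => ?_
      refine Measurable.prodMk ?_ measurable_snd (hB' n)
      exact measurable_pi_lambda _ fun m => (measurable_pi_apply _).comp measurable_fst
    · ext ⟨ω, y⟩
      simp only [mem_iUnion, mem_preimage, Prod.map, id, Nat.unpair_pair]
      refine exists_congr fun n => ?_
      rw [hEq n]
      rfl

/-- Measurable projection theorem: the projection of a measurable subset of a product with a
standard Borel space is null measurable. -/
theorem MeasurableSet.nullMeasurableSet_image_fst {Ω Y : Type*} [MeasurableSpace Ω]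
    [MeasurableSpace Y] [StandardBorelSpace Y] (P : Measure Ω) [IsFiniteMeasure P]
    {B : Set (Ω × Y)} (hB : MeasurableSet B) : NullMeasurableSet (Prod.fst '' B) P := by
  obtain ⟨f, hf, B', hB', rfl⟩ := hB.exists_preimage_cantor
  -- No structure is assumed on `Ω`. In the Cantor space the projection is analytic, hence null
  -- measurable for the law of `f`, and this pulls back along `f`.
  have h1 : AnalyticSet (Prod.fst '' B') := hB'.analyticSet_image measurable_fst
  have h2 : Prod.fst '' (Prod.map f (id : Y → Y) ⁻¹' B') = f ⁻¹' (Prod.fst '' B') := by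
    ext ω
    simp
  rw [h2]
  exact (h1.nullMeasurableSet (P.map f)).preimage (hf.quasiMeasurePreserving P)

end Projection

/-! ### Cover numbers and separated points. -/

section CoverNumber

open Set

/-- `A` contains points `y 0 < ⋯ < y n` with consecutive gaps larger than `ε`. -/
def HasSeparatedPoints (ε : ℝ) (A : Set ℝ) (n : ℕ) : Prop :=
  ∃ y : Fin (n + 1) → ℝ, (∀ i, y i ∈ A) ∧ ∀ i : Fin n, y i.castSucc + ε < y i.succ

/-- Greedy covering: one interval starts at the infimum, and what remains to its right admits one
separated point fewer. -/
theorem exists_cover_of_not_hasSeparatedPoints {ε : ℝ} (n : ℕ) :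
    ∀ {A : Set ℝ}, BddBelow A → ¬ HasSeparatedPoints ε A n →
      ∃ F : Finset ℝ, F.card ≤ n ∧ A ⊆ ⋃ x ∈ F, Icc x (x + ε) := by
  induction n with
  | zero =>
    intro A _ hA
    refine ⟨∅, by simp, fun x hx => (hA ⟨fun _ => x, fun _ => hx, fun i => i.elim0⟩).elim⟩
  | succ n ih =>
    intro A hb hA
    rcases A.eq_empty_or_nonempty with rfl | hne
    · exact ⟨∅, by simp, by simp⟩
    have hA' : ¬ HasSeparatedPoints ε (A ∩ Ioi (sInf A + ε)) n := by
      rintro ⟨y, hy, hgap⟩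
      -- The infimum may fail to belong to `A`; the strict gap leaves room for a point of `A`
      -- slightly above it.
      have h0 : sInf A < y 0 - ε := by have := (hy 0).2; rw [mem_Ioi] at this; linarith
      obtain ⟨z, hzA, hz⟩ := exists_lt_of_csInf_lt hne h0
      refine hA ⟨Fin.cons z y, fun i => ?_, fun i => ?_⟩
      · refine Fin.cases ?_ (fun j => ?_) i
        · simpa using hzA
        · simpa using (hy j).1
      · refine Fin.cases ?_ (fun j => ?_) i
        · simp only [Fin.castSucc_zero, Fin.cons_zero, Fin.cons_succ]; linarith
        · simpa [← Fin.succ_castSucc] using hgap j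
    obtain ⟨F, hF, hcov⟩ := ih (hb.mono inter_subset_left) hA'
    refine ⟨insert (sInf A) F, (Finset.card_insert_le _ _).trans (by omega), fun x hx => ?_⟩
    by_cases h : sInf A + ε < x
    · have := hcov ⟨hx, h⟩
      simp only [mem_iUnion, Finset.mem_insert] at this ⊢
      obtain ⟨w, hw, hxw⟩ := this
      exact ⟨w, Or.inr hw, hxw⟩
    · simp only [mem_iUnion, Finset.mem_insert]
      exact ⟨_, Or.inl rfl, csInf_le hb hx, not_lt.1 h⟩

/-- Gaps are strictly larger than `ε`, so a closed interval of length `ε` contains at most one of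
the points. -/
theorem HasSeparatedPoints.lt_card {ε : ℝ} (hε : 0 ≤ ε) {n : ℕ} {A : Set ℝ}
    (hA : HasSeparatedPoints ε A n) {F : Finset ℝ} (hF : A ⊆ ⋃ x ∈ F, Icc x (x + ε)) :
    n < F.card := by
  obtain ⟨y, hy, hgap⟩ := hA
  have hmem : ∀ i, ∃ x ∈ F, y i ∈ Icc x (x + ε) := fun i => by
    have := hF (hy i)
    simpa only [mem_iUnion, exists_prop] using this
  choose g hgF hg using hmem
  have hmono : StrictMono y := Fin.strictMono_iff_lt_succ.2 fun i => by linarith [hgap i]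
  have hlt : ∀ i j, i < j → y i + ε < y j := by
    intro i j hij
    obtain ⟨k, rfl⟩ : ∃ k : Fin n, k.castSucc = i :=
      ⟨i.castPred (Fin.ne_last_of_lt hij), Fin.castSucc_castPred _ _⟩
    exact (hgap k).trans_le (hmono.monotone (Fin.castSucc_lt_iff_succ_le.1 hij))
  have hinj : Function.Injective g := by
    intro i j hij
    by_contra hne
    rcases lt_or_gt_of_ne hne with h | h
    · have := hlt i j h
      have h1 := (hg i).1
      have h2 := (hg j).2
      rw [← hij] at h2
      linarith
    · have := hlt j i h
      have h1 := (hg j).1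
      have h2 := (hg i).2
      rw [hij] at h2
      linarith
  have := Finset.card_le_card_of_injOn (s := Finset.univ) (t := F) g (fun i _ => hgF i)
    hinj.injOn
  simpa using this

/-- This turns a statement about all covers into the existence of a finite tuple of reals, the form
needed for the projection theorem. -/
theorem lt_intervalCoverNumber_iff {ε : ℝ} (hε : 0 ≤ ε) {A : Set ℝ} (hb : BddBelow A) (n : ℕ) :
    (n : ℕ∞) < intervalCoverNumber ε A ↔ HasSeparatedPoints ε A n := by
  constructor
  · intro h
    by_contra hA
    obtain ⟨F, hF, hcov⟩ := exists_cover_of_not_hasSeparatedPoints n hb hA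
    refine absurd h (not_lt.2 ?_)
    exact (iInf₂_le F hcov).trans (by exact_mod_cast hF)
  · intro hA
    have : ((n + 1 : ℕ) : ℕ∞) ≤ intervalCoverNumber ε A :=
      le_iInf₂ fun F hF => by exact_mod_cast hA.lt_card hε hF
    refine lt_of_lt_of_le ?_ this
    exact_mod_cast Nat.lt_succ_self n

/-- An extended natural number is the number of naturals below it. -/
theorem ENat.toENNReal_eq_tsum (N : ℕ∞) :
    (N : ENNReal) = ∑' n : ℕ, if (n : ℕ∞) < N then 1 else 0 := by
  induction N with
  | top => simp
  | coe k =>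
    rw [tsum_eq_sum (s := Finset.range k) (by intro n hn; simpa using hn)]
    simp [Finset.filter_true_of_mem (s := Finset.range k)]

theorem intervalCoverNumber_le_sum {ε : ℝ} {A : Set ℝ} (M : ℕ) (x : ℕ → ℝ)
    (hA : A ⊆ ⋃ k ∈ Finset.range M, Icc (x k) (x k + ε)) :
    open Classical in (intervalCoverNumber ε A : ENNReal) ≤
      ∑ k ∈ Finset.range M, if (A ∩ Icc (x k) (x k + ε)).Nonempty then 1 else 0 := by
  classical
  let F := ((Finset.range M).filter fun k => (A ∩ Icc (x k) (x k + ε)).Nonempty).image x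
  have hF : A ⊆ ⋃ y ∈ F, Icc y (y + ε) := by
    intro t ht
    have := hA ht
    simp only [mem_iUnion, exists_prop, F, Finset.mem_image, Finset.mem_filter] at this ⊢
    obtain ⟨k, hk, hkt⟩ := this
    exact ⟨x k, ⟨k, ⟨hk, t, ht, hkt⟩, rfl⟩, hkt⟩
  have h1 : intervalCoverNumber ε A ≤ (F.card : ℕ∞) := iInf₂_le F hF
  have h2 : F.card ≤ ((Finset.range M).filter fun k => (A ∩ Icc (x k) (x k + ε)).Nonempty).card :=
    Finset.card_image_le
  rw [Finset.sum_boole]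
  have h3 := ENat.toENNReal_le.2 h1
  refine h3.trans ?_
  rw [ENat.toENNReal_coe]
  exact_mod_cast h2

end CoverNumber

/-! ### Running infimum, reflection, oscillation and push of a continuous path. -/

noncomputable section PathFunctionals

open Set

/-- The infimum of `f` over the segment between `s` and `t`. -/
def segInf (f : ℝ → ℝ) (s t : ℝ) : ℝ := sInf ((fun u => f (s + u * (t - s))) '' Icc (0 : ℝ) 1)

/-- Parametrising the segment by `[0, 1]` keeps the compact set fixed while the endpoints move, so
both endpoints may vary continuously. -/
theorem continuous_segInf {X : Type*} [TopologicalSpace X] {f : X → ℝ → ℝ} {s t : X → ℝ}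
    (hf : Continuous fun p : X × ℝ => f p.1 p.2) (hs : Continuous s) (ht : Continuous t) :
    Continuous fun x => segInf (f x) (s x) (t x) := by
  refine isCompact_Icc.continuous_sInf (f := fun x u => f x (s x + u * (t x - s x))) ?_
  have : Continuous fun p : X × ℝ => ((p.1, s p.1 + p.2 * (t p.1 - s p.1)) : X × ℝ) := by
    fun_prop
  exact hf.comp this

theorem segInf_le {f : ℝ → ℝ} (hf : Continuous f) {s t u : ℝ} (hu : u ∈ Icc s t) :
    segInf f s t ≤ f u := by
  have hb : BddBelow ((fun u => f (s + u * (t - s))) '' Icc (0 : ℝ) 1) :=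
    (isCompact_Icc.image (by fun_prop)).bddBelow
  refine csInf_le hb ?_
  rcases hu.1.eq_or_lt with rfl | h
  · exact ⟨0, by simp, by simp⟩
  · have hst : 0 < t - s := by linarith [hu.2]
    refine ⟨(u - s) / (t - s), ⟨div_nonneg (by linarith) hst.le, ?_⟩, ?_⟩
    · rw [div_le_one hst]; linarith [hu.2]
    · simp only [div_mul_cancel₀ _ hst.ne']; congr 1; ring

theorem exists_segInf_eq {f : ℝ → ℝ} (hf : Continuous f) {s t : ℝ} (hst : s ≤ t) :
    ∃ u ∈ Icc s t, segInf f s t = f u := by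
  obtain ⟨u, hu, h⟩ := (isCompact_Icc (a := (0 : ℝ)) (b := 1)).exists_sInf_image_eq
    (f := fun u => f (s + u * (t - s))) (nonempty_Icc.2 zero_le_one) (by fun_prop)
  refine ⟨s + u * (t - s), ⟨?_, ?_⟩, h⟩
  · nlinarith [hu.1, hu.2]
  · nlinarith [hu.1, hu.2]

theorem le_segInf_iff {f : ℝ → ℝ} (hf : Continuous f) {s t c : ℝ} (hst : s ≤ t) :
    c ≤ segInf f s t ↔ ∀ u ∈ Icc s t, c ≤ f u := by
  refine ⟨fun h u hu => h.trans (segInf_le hf hu), fun h => ?_⟩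
  obtain ⟨u, hu, he⟩ := exists_segInf_eq hf hst
  exact he ▸ h u hu

theorem segInf_lt_iff {f : ℝ → ℝ} (hf : Continuous f) {s t c : ℝ} (hst : s ≤ t) :
    segInf f s t < c ↔ ∃ u ∈ Icc s t, f u < c := by
  rw [← not_le, le_segInf_iff hf hst]; push Not; rfl

theorem segInf_anti {f : ℝ → ℝ} (hf : Continuous f) {s t s' t' : ℝ} (hst : s ≤ t) (hs : s' ≤ s)
    (ht : t ≤ t') : segInf f s' t' ≤ segInf f s t :=
  (le_segInf_iff hf hst).2 fun _ hu => segInf_le hf ⟨hs.trans hu.1, hu.2.trans ht⟩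

theorem segInf_sub_const {f : ℝ → ℝ} (hf : Continuous f) {s t c : ℝ} (hst : s ≤ t) :
    segInf (fun u => f u - c) s t = segInf f s t - c := by
  have hf' : Continuous fun u => f u - c := by fun_prop
  apply le_antisymm
  · obtain ⟨u, hu, he⟩ := exists_segInf_eq hf hst
    rw [he]; exact segInf_le hf' hu
  · rw [le_segInf_iff hf' hst]
    intro u hu
    linarith [segInf_le hf hu]

/-- Rational times are clamped to `[s, t]`, so only times of the segment enter. This gives
measurability for the σ-algebras of the past and of the future. -/
theorem measurable_segInf {Ω : Type*} {m : MeasurableSpace Ω} {F : ℝ → Ω → ℝ}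
    (hF : ∀ ω, Continuous fun u => F u ω) {s t : ℝ} (hst : s ≤ t)
    (hm : ∀ u ∈ Icc s t, Measurable[m] (F u)) :
    Measurable[m] fun ω => segInf (fun u => F u ω) s t := by
  have hproj : ∀ u : ℝ, max s (min t u) ∈ Icc s t := fun u =>
    ⟨le_max_left _ _, max_le hst (min_le_left _ _)⟩
  refine measurable_of_Ici fun c => ?_
  have : (fun ω => segInf (fun u => F u ω) s t) ⁻¹' Ici c =
      ⋂ q : ℚ, F (max s (min t q)) ⁻¹' Ici c := by
    ext ω
    simp only [mem_preimage, mem_Ici, mem_iInter]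
    rw [le_segInf_iff (hF ω) hst]
    refine ⟨fun h q => h _ (hproj q), fun h u hu => ?_⟩
    have hcl : IsClosed {u : ℝ | c ≤ F (max s (min t u)) ω} :=
      isClosed_le continuous_const ((hF ω).comp (by fun_prop))
    have := Rat.denseRange_cast.induction_on (p := fun u : ℝ => c ≤ F (max s (min t u)) ω) u hcl h
    simpa [min_eq_right hu.2, max_eq_right hu.1] using this
  rw [this]
  exact MeasurableSet.iInter fun q => hm _ (hproj _) measurableSet_Ici

/-- The process `f` reflected at its running infimum since time `s`. -/
def reflected (f : ℝ → ℝ) (s t : ℝ) : ℝ := f t - segInf f s t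

theorem reflected_nonneg {f : ℝ → ℝ} (hf : Continuous f) {s t : ℝ} (hst : s ≤ t) :
    0 ≤ reflected f s t :=
  sub_nonneg.2 (segInf_le hf (right_mem_Icc.2 hst))

theorem continuous_reflected {X : Type*} [TopologicalSpace X] {f : X → ℝ → ℝ} {s t : X → ℝ}
    (hf : Continuous fun p : X × ℝ => f p.1 p.2) (hs : Continuous s) (ht : Continuous t) :
    Continuous fun x => reflected (f x) (s x) (t x) := by
  refine Continuous.sub ?_ (continuous_segInf hf hs ht)
  exact hf.comp (continuous_id.prodMk ht)

theorem reflected_eq_zero_iff {f : ℝ → ℝ} (hf : Continuous f) {s t : ℝ} (hst : s ≤ t) :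
    reflected f s t = 0 ↔ ∀ u ∈ Icc s t, f t ≤ f u := by
  rw [← le_segInf_iff hf hst, reflected, sub_eq_zero]
  exact ⟨fun h => h.le, fun h => le_antisymm h (segInf_le hf (right_mem_Icc.2 hst))⟩

/-- The largest displacement of `f` from its value at `s` over `[s, t]`. -/
def osc (f : ℝ → ℝ) (s t : ℝ) : ℝ := - segInf (fun u => -|f u - f s|) s t

theorem abs_sub_le_osc {f : ℝ → ℝ} (hf : Continuous f) {s t u : ℝ} (hu : u ∈ Icc s t) :
    |f u - f s| ≤ osc f s t := by
  have := segInf_le (f := fun u => -|f u - f s|) (by fun_prop) hu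
  simp only [osc]; linarith

theorem exists_osc_eq {f : ℝ → ℝ} (hf : Continuous f) {s t : ℝ} (hst : s ≤ t) :
    ∃ u ∈ Icc s t, osc f s t = |f u - f s| := by
  obtain ⟨u, hu, h⟩ := exists_segInf_eq (f := fun u => -|f u - f s|) (by fun_prop) hst
  exact ⟨u, hu, by rw [osc, h, neg_neg]⟩

theorem osc_nonneg {f : ℝ → ℝ} (hf : Continuous f) {s t : ℝ} (hst : s ≤ t) : 0 ≤ osc f s t :=
  (abs_nonneg _).trans (abs_sub_le_osc hf (left_mem_Icc.2 hst))

theorem osc_le_add {f : ℝ → ℝ} (hf : Continuous f) {s t t' : ℝ} (hst : s ≤ t) (ht : t ≤ t') :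
    osc f s t' ≤ osc f s t + osc f t t' := by
  obtain ⟨u, hu, h⟩ := exists_osc_eq hf (hst.trans ht)
  rw [h]
  rcases le_total u t with hut | hut
  · linarith [abs_sub_le_osc hf (s := s) (t := t) ⟨hu.1, hut⟩, osc_nonneg hf ht]
  · have h1 := abs_sub_le_osc hf (s := s) (t := t) ⟨hst, le_rfl⟩
    have h2 := abs_sub_le_osc hf (s := t) (t := t') ⟨hut, hu.2⟩
    have := abs_sub_le (f u) (f t) (f s)
    linarith

theorem sub_osc_le_segInf {f : ℝ → ℝ} (hf : Continuous f) {s t : ℝ} (hst : s ≤ t) :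
    f s - osc f s t ≤ segInf f s t := by
  rw [le_segInf_iff hf hst]
  intro u hu
  have := abs_sub_le_osc hf hu
  linarith [neg_abs_le (f u - f s)]

theorem reflected_le_osc {f : ℝ → ℝ} (hf : Continuous f) {s t : ℝ} (hst : s ≤ t) :
    reflected f s t ≤ 2 * osc f s t := by
  have h1 := sub_osc_le_segInf hf hst
  have h2 := abs_sub_le_osc hf (right_mem_Icc.2 hst)
  rw [reflected]
  linarith [le_abs_self (f t - f s)]

/-- The amount by which the reflected process is pushed during `[t, t']`. -/
def push (f : ℝ → ℝ) (s t t' : ℝ) : ℝ := segInf f s t - segInf f s t'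

theorem reflected_eq_add_push (f : ℝ → ℝ) (s t t' : ℝ) :
    reflected f s t' = reflected f s t + (f t' - f t) + push f s t t' := by
  simp only [reflected, push]; ring

theorem push_nonneg {f : ℝ → ℝ} (hf : Continuous f) {s t t' : ℝ} (hst : s ≤ t) (ht : t ≤ t') :
    0 ≤ push f s t t' :=
  sub_nonneg.2 (segInf_anti hf hst le_rfl ht)

/-- If the infimum over `[s, t']` is attained before `t`, there is no push. Otherwise the path
descended after `t` to a level below its earlier infimum, and this descent bounds both the push and
the height of the reflected path at `t`. -/
theorem push_le_osc {f : ℝ → ℝ} (hf : Continuous f) {s t t' : ℝ} (hst : s ≤ t) (ht : t ≤ t') :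
    push f s t t' ≤ osc f t t' ∧ (0 < push f s t t' → reflected f s t ≤ osc f t t') := by
  obtain ⟨u, hu, h⟩ := exists_segInf_eq hf (hst.trans ht)
  rw [push, reflected, h]
  rcases le_total u t with hut | hut
  · have h1 := segInf_le hf (s := s) (t := t) ⟨hu.1, hut⟩
    exact ⟨by linarith [osc_nonneg hf ht], fun h' => by linarith⟩
  · have h2 := abs_sub_le_osc hf (s := t) (t := t') ⟨hut, hu.2⟩
    have h3 := segInf_le hf (s := s) (t := t) ⟨hst, le_rfl⟩
    have h4 := neg_abs_le (f u - f t)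
    exact ⟨by linarith, fun h' => by linarith⟩

end PathFunctionals

/-! ### Independence of past and future; normalised planar Brownian motion. -/

noncomputable section PlanarBM

open Set

/-- For a process with independent increments, the increments before time `s` are independent of
the increments after time `s`. -/
theorem ProbabilityTheory.HasIndepIncrements.indepFun_past_future {Ω E : Type*}
    [MeasurableSpace Ω] {P : Measure Ω} [IsProbabilityMeasure P] [AddCommGroup E]
    [MeasurableSpace E] [MeasurableAdd₂ E] [MeasurableNeg E] {Z : ℝ → Ω → E}
    (hZ : HasIndepIncrements Z P)
    (hm : ∀ s t, AEMeasurable (fun ω => Z t ω - Z s ω) P) (s : ℝ) :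
    IndepFun (fun ω (u : Iic s) => Z u ω - Z s ω) (fun ω (u : Ici s) => Z u ω - Z s ω) P := by
  classical
  refine IndepFun.process_indepFun_process₀ (fun _ => hm _ _) (fun _ => hm _ _) fun I J => ?_
  -- All times are sorted together with `s`. The successive increments before the index `k₀` of `s`
  -- determine the past ones by `φ`, and those from `k₀` on determine the future ones by `ψ`.
  let T : Finset ℝ := insert s (I.image Subtype.val ∪ J.image Subtype.val)
  have hT : 0 < T.card := Finset.card_pos.2 ⟨s, Finset.mem_insert_self _ _⟩
  let t : ℕ → ℝ := fun k => T.orderEmbOfFin rfl ⟨min k (T.card - 1), by omega⟩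
  have ht : Monotone t := fun k l hkl => (T.orderEmbOfFin rfl).monotone (by
    simp only [Fin.mk_le_mk]; omega)
  have hidx : ∀ u ∈ T, ∃ k < T.card, t k = u := by
    intro u hu
    have : u ∈ Set.range (T.orderEmbOfFin rfl) := by rw [Finset.range_orderEmbOfFin]; exact hu
    obtain ⟨⟨k, hk⟩, rfl⟩ := this
    refine ⟨k, hk, ?_⟩
    simp only [t]
    congr
    omega
  have hlt : ∀ k l, l < T.card → k < l → t k < t l := by
    intro k l hl hkl
    refine (T.orderEmbOfFin rfl).strictMono ?_
    simp only [Fin.mk_lt_mk]; omega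
  obtain ⟨k₀, hk₀, hs⟩ := hidx s (Finset.mem_insert_self _ _)
  have hI : ∀ u : I, ∃ k ≤ k₀, t k = u.1.1 := by
    rintro ⟨⟨u, hu⟩, hI⟩
    obtain ⟨k, hk, hku⟩ := hidx u (by
      refine Finset.mem_insert_of_mem (Finset.mem_union_left _ ?_)
      exact Finset.mem_image_of_mem Subtype.val hI)
    refine ⟨k, ?_, hku⟩
    by_contra! h
    have := hlt _ _ hk h
    rw [hs, hku] at this
    exact absurd hu (not_le.2 this)
  have hJ : ∀ u : J, ∃ k, k₀ ≤ k ∧ k < T.card ∧ t k = u.1.1 := by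
    rintro ⟨⟨u, hu⟩, hI⟩
    obtain ⟨k, hk, hku⟩ := hidx u (by
      refine Finset.mem_insert_of_mem (Finset.mem_union_right _ ?_)
      exact Finset.mem_image_of_mem Subtype.val hI)
    refine ⟨k, ?_, hk, hku⟩
    by_contra! h
    have := hlt _ _ hk₀ h
    rw [hs, hku] at this
    exact absurd hu (not_le.2 this)
  choose p hp hpu using hI
  choose q hq hq' hqu using hJ
  have hind := (hZ.nat ht).indepFun_finset₀ (Finset.range k₀) (Finset.Ico k₀ T.card)
    (by rw [Finset.range_eq_Ico]; exact Finset.Ico_disjoint_Ico_consecutive _ _ _)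
    (fun i => hm _ _)
  let φ : (Finset.range k₀ → E) → I → E := fun x u =>
    - ∑ j : Finset.range k₀, if p u ≤ j.1 then x j else 0
  let ψ : (Finset.Ico k₀ T.card → E) → J → E := fun x u =>
    ∑ j : Finset.Ico k₀ T.card, if j.1 < q u then x j else 0
  have hφ : Measurable φ := by
    refine measurable_pi_lambda _ fun u => Measurable.neg (Finset.measurable_sum _ fun j _ => ?_)
    split_ifs
    · exact measurable_pi_apply _
    · exact measurable_const
  have hψ : Measurable ψ := by
    refine measurable_pi_lambda _ fun u => Finset.measurable_sum _ fun j _ => ?_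
    split_ifs
    · exact measurable_pi_apply _
    · exact measurable_const
  have hmain := hind.comp hφ hψ
  have e1 : φ ∘ (fun ω (i : Finset.range k₀) => Z (t (i + 1)) ω - Z (t i) ω) =
      fun ω (u : I) => Z u.1 ω - Z s ω := by
    ext ω u
    simp only [φ, Function.comp]
    rw [Finset.sum_coe_sort (Finset.range k₀)
      (fun j => if p u ≤ j then Z (t (j + 1)) ω - Z (t j) ω else 0), ← Finset.sum_filter,
      show (Finset.range k₀).filter (fun j => p u ≤ j) = Finset.Ico (p u) k₀ by
        ext j; simp; tauto,
      Finset.sum_Ico_sub (fun k => Z (t k) ω) (hp u), hs, hpu u, neg_sub]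
  have e2 : ψ ∘ (fun ω (i : Finset.Ico k₀ T.card) => Z (t (i + 1)) ω - Z (t i) ω) =
      fun ω (u : J) => Z u.1 ω - Z s ω := by
    ext ω u
    simp only [ψ, Function.comp]
    rw [Finset.sum_coe_sort (Finset.Ico k₀ T.card)
      (fun j => if j < q u then Z (t (j + 1)) ω - Z (t j) ω else 0), ← Finset.sum_filter,
      show (Finset.Ico k₀ T.card).filter (fun j => j < q u) = Finset.Ico k₀ (q u) by
        ext j; simp only [Finset.mem_filter, Finset.mem_Ico]; have := hq' u; omega,
      Finset.sum_Ico_sub (fun k => Z (t k) ω) (hq u), hs, hqu u]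
  rwa [e1, e2] at hmain

/-- The σ-algebra generated by the increments of `(L, R)` between time `s` and the times in `S`. -/
@[reducible] def incrSigma {Ω : Type*} (L R : ℝ → Ω → ℝ) (S : Set ℝ) (s : ℝ) : MeasurableSpace Ω :=
  MeasurableSpace.comap (fun ω (u : S) => (L u ω - L s ω, R u ω - R s ω)) inferInstance

/-- A planar Brownian motion whose coordinates have unit variance and correlation `ρ`,
with continuous and measurable sample paths. -/
structure IsPlanarBM {Ω : Type*} [MeasurableSpace Ω] (ρ : ℝ) (L R : ℝ → Ω → ℝ)
    (P : Measure Ω) : Prop where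
  measL : ∀ t, Measurable (L t)
  measR : ∀ t, Measurable (R t)
  contL : ∀ ω, Continuous fun t => L t ω
  contR : ∀ ω, Continuous fun t => R t ω
  indep : ∀ s, Indep (incrSigma L R (Iic s) s) (incrSigma L R (Ici s) s) P
  lawL : ∀ s t, s ≤ t → HasLaw (fun ω => L t ω - L s ω) (gaussianReal 0 (t - s).toNNReal) P
  lawR : ∀ s t, s ≤ t → HasLaw (fun ω => R t ω - R s ω) (gaussianReal 0 (t - s).toNNReal) P
  cov : ∀ s t, s ≤ t → ∫ ω, (L t ω - L s ω) * (R t ω - R s ω) ∂P = ρ * (t - s)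

section IncrSigma

variable {Ω : Type*} {L R : ℝ → Ω → ℝ} {S : Set ℝ} {s u v : ℝ}

theorem measurable_incrSigma_left (hu : u ∈ S) :
    Measurable[incrSigma L R S s] fun ω => L u ω - L s ω := by
  have h : Measurable[incrSigma L R S s] fun ω (u : S) => (L u ω - L s ω, R u ω - R s ω) :=
    comap_measurable _
  exact measurable_fst.comp ((measurable_pi_apply (⟨u, hu⟩ : S)).comp h)

theorem measurable_incrSigma_right (hu : u ∈ S) :
    Measurable[incrSigma L R S s] fun ω => R u ω - R s ω := by
  have h : Measurable[incrSigma L R S s] fun ω (u : S) => (L u ω - L s ω, R u ω - R s ω) :=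
    comap_measurable _
  exact measurable_snd.comp ((measurable_pi_apply (⟨u, hu⟩ : S)).comp h)

theorem measurable_incrSigma_left' (hu : u ∈ S) (hv : v ∈ S) :
    Measurable[incrSigma L R S s] fun ω => L u ω - L v ω := by
  have := (measurable_incrSigma_left (L := L) (R := R) (s := s) hu).sub
    (measurable_incrSigma_left (L := L) (R := R) (s := s) hv)
  simpa [Pi.sub_def] using this

theorem measurable_incrSigma_right' (hu : u ∈ S) (hv : v ∈ S) :
    Measurable[incrSigma L R S s] fun ω => R u ω - R v ω := by
  have := (measurable_incrSigma_right (L := L) (R := R) (s := s) hu).sub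
    (measurable_incrSigma_right (L := L) (R := R) (s := s) hv)
  simpa [Pi.sub_def] using this

theorem incrSigma_le {m : MeasurableSpace Ω} (hL : ∀ u ∈ S, Measurable[m] fun ω => L u ω - L s ω)
    (hR : ∀ u ∈ S, Measurable[m] fun ω => R u ω - R s ω) : incrSigma L R S s ≤ m :=
  (measurable_pi_lambda _ fun u : S => (hL u.1 u.2).prodMk (hR u.1 u.2)).comap_le

theorem incrSigma_swap : incrSigma R L S s = incrSigma L R S s :=
  le_antisymm
    (incrSigma_le (fun _ hu => measurable_incrSigma_right hu)
      fun _ hu => measurable_incrSigma_left hu)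
    (incrSigma_le (fun _ hu => measurable_incrSigma_right hu)
      fun _ hu => measurable_incrSigma_left hu)

theorem incrSigma_reverse :
    incrSigma (fun t => L (-t)) (fun t => R (-t)) (Neg.neg ⁻¹' S) (-s) = incrSigma L R S s := by
  apply le_antisymm
  · refine incrSigma_le (fun u hu => ?_) fun u hu => ?_
    · simpa using measurable_incrSigma_left (L := L) (R := R) (s := s) (mem_preimage.1 hu)
    · simpa using measurable_incrSigma_right (L := L) (R := R) (s := s) (mem_preimage.1 hu)
  · refine incrSigma_le (fun u hu => ?_) fun u hu => ?_
    all_goals have hu' : -u ∈ Neg.neg ⁻¹' S := by simpa using hu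
    · simpa using measurable_incrSigma_left (L := fun t => L (-t)) (R := fun t => R (-t))
        (s := -s) hu'
    · simpa using measurable_incrSigma_right (L := fun t => L (-t)) (R := fun t => R (-t))
        (s := -s) hu'

end IncrSigma

/-- Estimates for one coordinate are proved for `L` and transferred to `R` by this symmetry. -/
theorem IsPlanarBM.swap {Ω : Type*} [MeasurableSpace Ω] {ρ : ℝ} {L R : ℝ → Ω → ℝ}
    {P : Measure Ω} (h : IsPlanarBM ρ L R P) : IsPlanarBM ρ R L P where
  measL := h.measR
  measR := h.measL
  contL := h.contR
  contR := h.contL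
  indep s := by
    rw [incrSigma_swap (S := Iic s), incrSigma_swap (S := Ici s)]; exact h.indep s
  lawL := h.lawR
  lawR := h.lawL
  cov s t hst := by simp_rw [mul_comm (R t _ - R s _)]; exact h.cov s t hst

/-- Time reversal turns the past minimum seen from `t` into a running minimum of a forward path. -/
theorem IsPlanarBM.reverse {Ω : Type*} [MeasurableSpace Ω] {ρ : ℝ} {L R : ℝ → Ω → ℝ}
    {P : Measure Ω} (h : IsPlanarBM ρ L R P) :
    IsPlanarBM ρ (fun t => L (-t)) (fun t => R (-t)) P where
  measL t := h.measL _
  measR t := h.measR _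
  contL ω := (h.contL ω).comp continuous_neg
  contR ω := (h.contR ω).comp continuous_neg
  indep s := by
    have h1 := incrSigma_reverse (L := L) (R := R) (S := Ici (-s)) (s := -s)
    have h2 := incrSigma_reverse (L := L) (R := R) (S := Iic (-s)) (s := -s)
    rw [show Neg.neg ⁻¹' Ici (-s) = Iic s by ext; simp, neg_neg] at h1
    rw [show Neg.neg ⁻¹' Iic (-s) = Ici s by ext; simp, neg_neg] at h2
    rw [h1, h2]
    exact (h.indep (-s)).symm
  lawL s t hst := by
    have := gaussianReal_neg (h.lawL (-t) (-s) (by linarith))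
    simp only [Pi.neg_def, neg_sub, neg_zero] at this
    rwa [show -s - -t = t - s by ring] at this
  lawR s t hst := by
    have := gaussianReal_neg (h.lawR (-t) (-s) (by linarith))
    simp only [Pi.neg_def, neg_sub, neg_zero] at this
    rwa [show -s - -t = t - s by ring] at this
  cov s t hst := by
    have := h.cov (-t) (-s) (by linarith)
    rw [show -s - -t = t - s by ring] at this
    rw [← this]
    congr 1
    ext ω
    ring

end PlanarBM

/-! ### Reduction to unit variance and to everywhere continuous, measurable paths. -/

noncomputable section Modification

open Set Filter Topology

theorem posSemidef_covMat {α γ : ℝ} (hα : 0 ≤ α) : (covMat α γ).PosSemidef := by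
  refine Matrix.PosSemidef.of_dotProduct_mulVec_nonneg ?_ fun x => ?_
  · ext i j
    fin_cases i <;> fin_cases j <;> simp [covMat]
  · simp only [covMat, dotProduct, Matrix.mulVec, Fin.sum_univ_two, Matrix.of_apply,
      Matrix.cons_val_zero, Matrix.cons_val_one, Pi.star_apply, star_trivial,
      Matrix.cons_val', Matrix.cons_val_fin_one]
    have h1 := Real.neg_one_le_cos (Real.pi * γ ^ 2 / 4)
    have h2 := Real.cos_le_one (Real.pi * γ ^ 2 / 4)
    set c := Real.cos (Real.pi * γ ^ 2 / 4)
    -- The quadratic form of the matrix is `α / 2` times this diagonalised expression.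
    have : 0 ≤ (1 - c) * (x 0 + x 1) ^ 2 + (1 + c) * (x 0 - x 1) ^ 2 := by
      have := mul_nonneg (sub_nonneg.2 h2) (sq_nonneg (x 0 + x 1))
      have := mul_nonneg (by linarith : 0 ≤ 1 + c) (sq_nonneg (x 0 - x 1))
      linarith
    nlinarith [mul_nonneg hα this]

/-- A process with almost surely continuous paths has a modification all of whose paths are
continuous and all of whose marginals are measurable. -/
theorem exists_continuous_modification {Ω E : Type*} [MeasurableSpace Ω] {P : Measure Ω}
    [NormedAddCommGroup E] [MeasurableSpace E] [BorelSpace E] {Z : ℝ → Ω → E}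
    (hm : ∀ t, AEMeasurable (Z t) P) (hc : ∀ᵐ ω ∂P, Continuous fun t => Z t ω) :
    ∃ Z' : ℝ → Ω → E, (∀ t, Measurable (Z' t)) ∧ (∀ ω, Continuous fun t => Z' t ω) ∧
      ∀ᵐ ω ∂P, ∀ t, Z' t ω = Z t ω := by
  have h1 : ∀ᵐ ω ∂P, (Continuous fun t => Z t ω) ∧ ∀ q : ℚ, Z q ω = (hm q).mk (Z q) ω := by
    filter_upwards [hc, ae_all_iff.2 fun q : ℚ => (hm q).ae_eq_mk] with ω h h' using ⟨h, h'⟩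
  -- Off the measurable null set `N` the path is continuous and agrees with measurable versions at
  -- rational times. Setting it to `0` on `N` gives measurability at rational times, then at all
  -- times by limits.
  let N := toMeasurable P {ω | ¬ ((Continuous fun t => Z t ω) ∧ ∀ q : ℚ, Z q ω = (hm q).mk (Z q) ω)}
  have hN : MeasurableSet N := measurableSet_toMeasurable _ _
  have hNP : P N = 0 := by rw [measure_toMeasurable]; exact h1
  have hNg : ∀ ω ∉ N, (Continuous fun t => Z t ω) ∧ ∀ q : ℚ, Z q ω = (hm q).mk (Z q) ω := by
    intro ω hω
    by_contra h
    exact hω (subset_toMeasurable P _ h)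
  let Z' : ℝ → Ω → E := fun t => Nᶜ.indicator (Z t)
  have hcont : ∀ ω, Continuous fun t => Z' t ω := by
    intro ω
    by_cases hω : ω ∈ N
    · simpa [Z', hω] using continuous_const
    · simpa [Z', hω] using (hNg ω hω).1
  have hrat : ∀ q : ℚ, Measurable (Z' q) := by
    intro q
    have : Z' q = Nᶜ.indicator ((hm q).mk (Z q)) := by
      ext ω
      by_cases hω : ω ∈ N
      · simp [Z', hω]
      · simp [Z', hω, (hNg ω hω).2 q]
    rw [this]
    exact (hm q).measurable_mk.indicator hN.compl
  refine ⟨Z', fun t => ?_, hcont, ?_⟩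
  · obtain ⟨q, hq⟩ : ∃ q : ℕ → ℚ, Tendsto (fun n => (q n : ℝ)) atTop (𝓝 t) := by
      have ht : t ∈ closure (range ((↑) : ℚ → ℝ)) := Rat.denseRange_cast t
      obtain ⟨x, hx, hxt⟩ := mem_closure_iff_seq_limit.1 ht
      choose q hq using hx
      exact ⟨q, by simpa [hq] using hxt⟩
    refine measurable_of_tendsto_metrizable (f := fun n => Z' (q n)) (fun n => hrat _) ?_
    rw [tendsto_pi_nhds]
    intro ω
    exact ((hcont ω).tendsto t).comp hq
  · have : ∀ᵐ ω ∂P, ω ∉ N := measure_eq_zero_iff_ae_notMem.1 hNP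
    filter_upwards [this] with ω hω t
    simp [Z', hω]

/-- Division by `√α` removes `α` from the law, which is why the final constant does not depend on
it. -/
theorem IsCorrelatedBM.exists_isPlanarBM {Ω : Type*} [MeasurableSpace Ω] {P : Measure Ω}
    [IsProbabilityMeasure P] {α γ : ℝ} (hα : 0 < α) {Z : ℝ → Ω → EuclideanSpace ℝ (Fin 2)}
    (hZ : IsCorrelatedBM (covMat α γ) Z P) :
    ∃ L R : ℝ → Ω → ℝ, IsPlanarBM (-Real.cos (Real.pi * γ ^ 2 / 4)) L R P ∧
      ∀ᵐ ω ∂P, ∀ t, Z t ω 0 = √α * L t ω ∧ Z t ω 1 = √α * R t ω := by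
  have hincr : ∀ s t, AEMeasurable (fun ω => Z t ω - Z s ω) P := by
    intro s t
    rcases le_total s t with h | h
    · exact (hZ.law s t h).aemeasurable
    · have := (hZ.law t s h).aemeasurable.neg
      simpa [Pi.neg_def] using this
  have hZm : ∀ t, AEMeasurable (Z t) P := by
    intro t
    refine (hincr 0 t).congr ?_
    filter_upwards [hZ.zero] with ω h
    simp [h]
  obtain ⟨Z', hZ'm, hZ'c, hZ'e⟩ := exists_continuous_modification hZm hZ.cont
  have hα' : 0 < √α := Real.sqrt_pos.2 hα
  have hsq : √α * √α = α := Real.mul_self_sqrt hα.le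
  have hlaw : ∀ s t, s ≤ t → HasLaw (fun ω ↦ Z' t ω - Z' s ω)
      (multivariateGaussian 0 ((t - s) • covMat α γ)) P := by
    intro s t hst
    refine (hZ.law s t hst).congr ?_
    filter_upwards [hZ'e] with ω h
    rw [h, h]
  have hpsd : ∀ s t, s ≤ t → ((t - s) • covMat α γ).PosSemidef := fun s t hst => by
    have h0 : (0 : ℝ) ≤ t - s := sub_nonneg.2 hst
    exact (posSemidef_covMat hα.le).smul h0
  have hcoord : ∀ (i : Fin 2) s t, s ≤ t →
      HasLaw (fun ω => (√α)⁻¹ * Z' t ω i - (√α)⁻¹ * Z' s ω i)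
        (gaussianReal 0 (t - s).toNNReal) P := by
    intro i s t hst
    have h1 := (measurePreserving_eval_multivariateGaussian (μ := 0) (hpsd s t hst)
      (i := i)).hasLaw.comp (hlaw s t hst)
    have h2 := gaussianReal_const_mul h1 (√α)⁻¹
    have hv : NNReal.mk ((√α)⁻¹ ^ 2) (sq_nonneg _) * (((t - s) • covMat α γ) i i).toNNReal
        = (t - s).toNNReal := by
      have hd : ((t - s) • covMat α γ) i i = (t - s) * α := by
        fin_cases i <;> simp [covMat]
      rw [hd]
      apply NNReal.coe_injective
      rw [NNReal.coe_mul, Real.coe_toNNReal _ (sub_nonneg.2 hst),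
        Real.coe_toNNReal _ (mul_nonneg (sub_nonneg.2 hst) hα.le)]
      change (√α)⁻¹ ^ 2 * ((t - s) * α) = t - s
      rw [inv_pow, Real.sq_sqrt hα.le]
      field_simp
    rw [hv] at h2
    convert h2 using 1
    · ext ω
      simp [mul_sub]
    · simp
  have hind : HasIndepIncrements Z P := hZ.indep
  refine ⟨fun t ω => (√α)⁻¹ * Z' t ω 0, fun t ω => (√α)⁻¹ * Z' t ω 1, ?_, ?_⟩
  · refine ⟨fun t => ?_, fun t => ?_, fun ω => ?_, fun ω => ?_, fun s => ?_, hcoord 0, hcoord 1,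
      fun s t hst => ?_⟩
    · have := hZ'm t
      fun_prop
    · have := hZ'm t
      fun_prop
    · have := hZ'c ω
      fun_prop
    · have := hZ'c ω
      fun_prop
    · have h1 := hind.indepFun_past_future hincr s
      have h2 := h1.process_congr (X' := fun (u : Iic s) ω => Z' u ω - Z' s ω)
        (Y' := fun (u : Ici s) ω => Z' u ω - Z' s ω)
        (fun u => by filter_upwards [hZ'e] with ω h; rw [h, h])
        (fun u => by filter_upwards [hZ'e] with ω h; rw [h, h])
      have h3 := h2.comp
        (φ := fun (x : Iic s → EuclideanSpace ℝ (Fin 2)) u => ((√α)⁻¹ * x u 0, (√α)⁻¹ * x u 1))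
        (ψ := fun (x : Ici s → EuclideanSpace ℝ (Fin 2)) u => ((√α)⁻¹ * x u 0, (√α)⁻¹ * x u 1))
        (by fun_prop) (by fun_prop)
      rw [IndepFun_iff_Indep] at h3
      simp only [Function.comp_def, PiLp.sub_apply, mul_sub] at h3
      exact h3
    · have h1 := covariance_eval_multivariateGaussian (μ := 0) (hpsd s t hst) 0 1
      have h2 := (hlaw s t hst).covariance_fun_comp (f := fun x => x 0) (g := fun x => x 1)
        (by fun_prop) (by fun_prop)
      rw [h1] at h2
      have hmean : ∀ i : Fin 2, ∫ ω, (Z' t ω i - Z' s ω i) ∂P = 0 := by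
        intro i
        have := (hcoord i s t hst).integral_eq
        rw [integral_id_gaussianReal] at this
        simp_rw [← mul_sub, integral_const_mul] at this
        rcases mul_eq_zero.1 this with h | h
        · exact absurd h (inv_pos.2 hα').ne'
        · exact h
      simp only [covariance, PiLp.sub_apply, hmean, sub_zero] at h2
      have h3 : ∀ ω, ((√α)⁻¹ * Z' t ω 0 - (√α)⁻¹ * Z' s ω 0) *
          ((√α)⁻¹ * Z' t ω 1 - (√α)⁻¹ * Z' s ω 1) =
          α⁻¹ * ((Z' t ω 0 - Z' s ω 0) * (Z' t ω 1 - Z' s ω 1)) := by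
        intro ω
        rw [show α⁻¹ = (√α)⁻¹ * (√α)⁻¹ by rw [← mul_inv, hsq]]
        ring
      simp_rw [h3]
      rw [integral_const_mul, h2]
      simp only [covMat, Matrix.smul_apply, Matrix.of_apply, Matrix.cons_val_zero,
        Matrix.cons_val_one, smul_eq_mul, Matrix.cons_val', Matrix.cons_val_fin_one]
      field_simp
  · filter_upwards [hZ'e] with ω h t
    constructor <;> rw [h t, mul_inv_cancel_left₀ hα'.ne']

end Modification

/-! ### Joint measurability of the ancestor-free set and measurability of the cover number. -/

noncomputable section Measurability

open Set Filter Topology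

variable {z : ℝ → EuclideanSpace ℝ (Fin 2)} {a b s t : ℝ}

theorem mem_coneStarts_iff (hz : Continuous z) {t' : ℝ} :
    t' ∈ coneStarts z t ↔ t' < t ∧ ∀ i, z t i ≤ segInf (fun u => z u i) t' t := by
  refine and_congr_right fun h => ?_
  have hi : ∀ i, z t i ≤ segInf (fun u => z u i) t' t ↔ ∀ u ∈ Icc t' t, z t i ≤ z u i := fun i =>
    le_segInf_iff (f := fun u => z u i) (by fun_prop) h.le
  simp_rw [hi]
  exact ⟨fun H i s hs => H s hs i, fun H s hs i => H i s hs⟩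

theorem coneStarts_of_le {t' t'' : ℝ} (h : t' ∈ coneStarts z t) (h' : t' ≤ t'') (ht : t'' < t) :
    t'' ∈ coneStarts z t :=
  ⟨ht, fun s hs => h.2 s ⟨h'.trans hs.1, hs.2⟩⟩

/-- Cone starts approach the infimum, which gives the inequality on `(t, s]`; continuity adds the
endpoint `t`. In particular the entrance time itself is a cone start when it is before `s`. -/
theorem mem_coneStarts_of_isGLB (hz : Continuous z) {v : ℝ} (hv : IsGLB (coneStarts z s) v)
    (ht : v ≤ t) (hts : t < s) : t ∈ coneStarts z s := by
  refine ⟨hts, fun u hu i => ?_⟩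
  have key : ∀ w ∈ Ioc t s, z s i ≤ z w i := by
    intro w hw
    obtain ⟨t', ht', h1⟩ := (isGLB_lt_iff hv).1 (ht.trans_lt hw.1)
    exact ht'.2 w ⟨h1.le, hw.2⟩ i
  have hcl : IsClosed {w | z s i ≤ z w i} := isClosed_le continuous_const (by fun_prop)
  have : Icc t s ⊆ {w | z s i ≤ z w i} := by
    rw [← closure_Ioc hts.ne]
    exact closure_minimal key hcl
  exact this hu

/-- The cone at the time `s` is not entered before time `a`. -/
def EntersAfter (z : ℝ → EuclideanSpace ℝ (Fin 2)) (a s : ℝ) : Prop :=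
  ∀ n : ℕ, ∃ i, segInf (fun u => z u i) (a - 1 / (n + 1)) s < z s i

/-- The slack `1 / (n + 1)` is needed because `a` itself is allowed to be a cone start; only starts
strictly before `a` are excluded. -/
theorem entersAfter_iff (hz : Continuous z) (has : a ≤ s) :
    EntersAfter z a s ↔ a ∈ lowerBounds (coneStarts z s) := by
  constructor
  · intro h t' ht'
    by_contra! hlt
    obtain ⟨n, hn⟩ := exists_nat_one_div_lt (sub_pos.2 hlt)
    have h0 : (0 : ℝ) < 1 / (n + 1) := by positivity
    have h1 : a - 1 / ((n : ℝ) + 1) ∈ coneStarts z s :=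
      coneStarts_of_le ht' (by linarith) (by linarith)
    obtain ⟨i, hi⟩ := h n
    exact absurd (((mem_coneStarts_iff hz).1 h1).2 i) (not_le.2 hi)
  · intro h n
    have h0 : (0 : ℝ) < 1 / (n + 1) := by positivity
    by_contra! hcon
    have := h ((mem_coneStarts_iff hz).2 ⟨by linarith, hcon⟩)
    linarith

/-- The entrance time is eliminated: cone starts form an upper set below `s`, so for `t < s`
membership in the interval means that `t` is a cone start. The case `s = t` is separate because cone
starts are strictly earlier than `s`. -/
theorem exists_coneInterval_iff (hz : Continuous z) (hat : a ≤ t) :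
    (∃ v s, IsConeInterval z v s ∧ Icc v s ⊆ Icc a b ∧ t ∈ Icc v s) ↔
      ∃ s ∈ Icc t b, EntersAfter z a s ∧
        (t ∈ coneStarts z s ∨ (s = t ∧ (coneStarts z s).Nonempty)) := by
  constructor
  · rintro ⟨v, s, ⟨hne, hv⟩, hsub, ht⟩
    have hvs : v ≤ s := ht.1.trans ht.2
    refine ⟨s, ⟨ht.2, (hsub (right_mem_Icc.2 hvs)).2⟩, ?_, ?_⟩
    · rw [entersAfter_iff hz (hat.trans ht.2)]
      have := (hsub (left_mem_Icc.2 hvs)).1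
      exact fun x hx => this.trans (hv.1 hx)
    · rcases ht.2.eq_or_lt with h | h
      · exact Or.inr ⟨h.symm, hne⟩
      · exact Or.inl (mem_coneStarts_of_isGLB hz hv ht.1 h)
  · rintro ⟨s, hs, hE, h⟩
    rw [entersAfter_iff hz (hat.trans hs.1)] at hE
    have hne : (coneStarts z s).Nonempty := by
      rcases h with h | h
      · exact ⟨t, h⟩
      · exact h.2
    have hglb := isGLB_csInf hne ⟨a, hE⟩
    refine ⟨sInf (coneStarts z s), s, ⟨hne, hglb⟩, ?_, ?_, hs.1⟩
    · exact Icc_subset_Icc (le_csInf hne hE) hs.2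
    · rcases h with h | h
      · exact hglb.1 h
      · obtain ⟨x, hx⟩ := h.2
        exact (hglb.1 hx).trans (hx.1.le.trans h.1.le)

/-- The sum of the two coordinates of the path reflected at its running infima since time `t`. -/
def cornerDist (z : ℝ → EuclideanSpace ℝ (Fin 2)) (t s : ℝ) : ℝ :=
  ∑ i, reflected (fun u => z u i) t s

theorem cornerDist_le_zero_iff (hz : Continuous z) (hts : t ≤ s) :
    cornerDist z t s ≤ 0 ↔ ∀ i, z s i ≤ segInf (fun u => z u i) t s := by
  have h : ∀ i, 0 ≤ reflected (fun u => z u i) t s := fun i =>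
    reflected_nonneg (by fun_prop) hts
  simp only [cornerDist, Fin.sum_univ_two, Fin.forall_fin_two] at h ⊢
  simp only [reflected] at h ⊢
  constructor
  · intro h'; constructor <;> linarith
  · intro h'; linarith [h'.1, h'.2]

theorem continuous_cornerDist (hz : Continuous z) :
    Continuous fun p : ℝ × ℝ => cornerDist z p.1 p.2 := by
  refine continuous_finsetSum _ fun i _ => ?_
  refine continuous_reflected (f := fun (_ : ℝ × ℝ) u => z u i) (by fun_prop) continuous_fst
    continuous_snd

/-- A description by countably many conditions of the times that lie in a cone interval contained
in `[a, b]`. -/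
theorem exists_coneInterval_iff_countable (hz : Continuous z) (hat : a ≤ t) (htb : t ≤ b) :
    (∃ v s, IsConeInterval z v s ∧ Icc v s ⊆ Icc a b ∧ t ∈ Icc v s) ↔
      (∃ q : ℚ, t < q ∧ q ≤ b ∧ ∀ n : ℕ, ∃ i, ∃ r : ℚ, q ≤ r ∧
        segInf (fun s => cornerDist z t s) q (min b r) ≤ 0 ∧
        segInf (fun u => z u i) (a - 1 / (n + 1)) t < segInf (fun u => z u i) t (min b r)) ∨
      ((∃ q : ℚ, q < t ∧ ∀ i, z t i ≤ segInf (fun u => z u i) q t) ∧ EntersAfter z a t) := by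
  have hzi : ∀ i, Continuous fun u => z u i := fun i => by fun_prop
  have hcd : ∀ t, Continuous fun s => cornerDist z t s := fun t =>
    (continuous_cornerDist hz).comp (continuous_const.prodMk continuous_id)
  rw [exists_coneInterval_iff hz hat]
  constructor
  · rintro ⟨s, hs, hE, h | ⟨rfl, t', ht'⟩⟩
    · left
      have hts := (mem_coneStarts_iff hz).1 h
      obtain ⟨q, hq, hqs⟩ := exists_rat_btwn hts.1
      refine ⟨q, hq, hqs.le.trans hs.2, fun n => ?_⟩
      have h0 : (0 : ℝ) < 1 / (n + 1) := by positivity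
      obtain ⟨i, hi⟩ := hE n
      refine ⟨i, ?_⟩
      rw [segInf_lt_iff (hzi i) (by linarith [hs.1])] at hi
      obtain ⟨u, hu, hus⟩ := hi
      have hut : u < t := by
        by_contra! hle
        exact absurd (h.2 u ⟨hle, hu.2⟩ i) (not_le.2 hus)
      have hlt : segInf (fun u => z u i) (a - 1 / (n + 1)) t < z s i :=
        (segInf_le (hzi i) ⟨hu.1, hut.le⟩).trans_lt hus
      have hlt' : segInf (fun u => z u i) (a - 1 / (n + 1)) t < segInf (fun u => z u i) t s :=
        hlt.trans_le (hts.2 i)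
      -- The strict inequality at `s` survives slightly beyond `s`, which leaves room for a rational
      -- `r`.
      have hcont : Continuous fun r => segInf (fun u => z u i) t r :=
        continuous_segInf (f := fun (_ : ℝ) u => z u i) (by fun_prop) continuous_const
          continuous_id
      have hev := hcont.continuousAt.eventually (lt_mem_nhds hlt')
      obtain ⟨η, hη, hball⟩ := Metric.eventually_nhds_iff.1 hev
      obtain ⟨r, hr, hr'⟩ := exists_rat_btwn (show s < s + η by linarith)
      have hsr : s ≤ min b r := le_min hs.2 hr.le
      refine ⟨r, by exact_mod_cast (hqs.le.trans hr.le), ?_, ?_⟩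
      · refine (segInf_le (hcd t) ⟨hqs.le, hsr⟩).trans ?_
        exact (cornerDist_le_zero_iff hz hts.1.le).2 hts.2
      · refine hball ?_
        rw [Real.dist_eq, abs_of_nonneg (by linarith)]
        linarith [min_le_right b (r : ℝ)]
    · right
      refine ⟨?_, hE⟩
      obtain ⟨q, hq, hqs⟩ := exists_rat_btwn ht'.1
      exact ⟨q, hqs, ((mem_coneStarts_iff hz).1 (coneStarts_of_le ht' hq.le hqs)).2⟩
  · rintro (⟨q, htq, hqb, H⟩ | ⟨⟨q, hqt, hq⟩, hE⟩)
    -- The witnesses `r` depend on `n`, but the first corner time `s₀` after `q` serves for all `n`: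
    -- a later corner time has coordinates at most those of `s₀`, so a past point strictly below the
    -- later one is also strictly below `z s₀`.
    · let K : Set ℝ := Icc (q : ℝ) b ∩ {s | cornerDist z t s ≤ 0}
      have hK : IsCompact K := isCompact_Icc.inter_right (isClosed_le (hcd t) continuous_const)
      have hex : ∀ r : ℚ, q ≤ r → segInf (fun s => cornerDist z t s) q (min b r) ≤ 0 →
          ∃ s ∈ K, s ≤ min b (r : ℝ) := by
        intro r hqr hr
        obtain ⟨s, hs, he⟩ := exists_segInf_eq (hcd t) (s := q) (t := min b (r : ℝ))
          (le_min hqb (by exact_mod_cast hqr))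
        exact ⟨s, ⟨⟨hs.1, hs.2.trans (min_le_left _ _)⟩, he.symm.le.trans hr⟩, hs.2⟩
      have hKne : K.Nonempty := by
        obtain ⟨i, r, hqr, hr, -⟩ := H 0
        obtain ⟨s, hs, -⟩ := hex r hqr hr
        exact ⟨s, hs⟩
      obtain ⟨s₀, hs₀, hmin⟩ := hK.exists_isLeast hKne
      have hts₀ : t < s₀ := htq.trans_le hs₀.1.1
      have hcone := (cornerDist_le_zero_iff hz hts₀.le).1 hs₀.2
      refine ⟨s₀, ⟨hts₀.le, hs₀.1.2⟩, fun n => ?_,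
        Or.inl ((mem_coneStarts_iff hz).2 ⟨hts₀, hcone⟩)⟩
      have h0 : (0 : ℝ) < 1 / (n + 1) := by positivity
      obtain ⟨i, r, hqr, hr, hlt⟩ := H n
      obtain ⟨s, hs, hsr⟩ := hex r hqr hr
      refine ⟨i, ?_⟩
      have hs₀s := hmin hs
      have h1 : segInf (fun u => z u i) t (min b r) ≤ z s i :=
        segInf_le (hzi i) ⟨hts₀.le.trans hs₀s, hsr⟩
      have h2 : z s i ≤ z s₀ i :=
        ((cornerDist_le_zero_iff hz (hts₀.le.trans hs₀s)).1 hs.2 i).trans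
          (segInf_le (hzi i) ⟨hts₀.le, hs₀s⟩)
      have h3 := segInf_anti (hzi i) (s := a - 1 / (n + 1)) (t := t) (s' := a - 1 / (n + 1))
        (t' := s₀) (by linarith) le_rfl hts₀.le
      linarith
    · exact ⟨t, ⟨le_rfl, htb⟩, hE, Or.inr ⟨rfl, q, (mem_coneStarts_iff hz).2 ⟨hqt, hq⟩⟩⟩

theorem measurable_segInf_of_forall {Ω : Type*} {m : MeasurableSpace Ω} {F : ℝ → Ω → ℝ}
    (hF : ∀ ω, Continuous fun u => F u ω) (hm : ∀ u, Measurable[m] (F u)) (s t : ℝ) :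
    Measurable[m] fun ω => segInf (fun u => F u ω) s t := by
  have h := measurable_segInf (m := m) (F := fun u => F (s + u * (t - s))) (s := 0) (t := 1)
    (fun ω => (hF ω).comp (by fun_prop)) zero_le_one fun u _ => hm _
  simpa [segInf] using h

section Joint

variable {Ω : Type*} [MeasurableSpace Ω] {Z : ℝ → Ω → EuclideanSpace ℝ (Fin 2)}

theorem measurable_of_continuous_snd {F : Ω → ℝ → ℝ} (hc : ∀ ω, Continuous (F ω))
    (hm : ∀ t, Measurable fun ω => F ω t) : Measurable fun p : Ω × ℝ => F p.1 p.2 :=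
  (measurable_uncurry_of_continuous_of_measurable (u := fun t ω => F ω t) hc hm).comp
    measurable_swap

/-- The random set of ancestor-free times is jointly measurable. -/
theorem measurableSet_ancestorFree (hZm : ∀ t, Measurable (Z t))
    (hZc : ∀ ω, Continuous fun t => Z t ω) (a b : ℝ) :
    MeasurableSet {p : Ω × ℝ | p.2 ∈ ancestorFree (fun t => Z t p.1) a b} := by
  have hZi : ∀ i t, Measurable fun ω => Z t ω i := fun i t => by
    have := hZm t
    fun_prop
  have hZic : ∀ i ω, Continuous fun t => Z t ω i := fun i ω => by
    have := hZc ω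
    fun_prop
  have h1 : ∀ i, Measurable fun p : Ω × ℝ => Z p.2 p.1 i := fun i =>
    measurable_of_continuous_snd (F := fun ω t => Z t ω i) (hZic i) (hZi i)
  have h2 : ∀ i (q : ℝ), Measurable fun p : Ω × ℝ => segInf (fun u => Z u p.1 i) q p.2 :=
    fun i q => measurable_of_continuous_snd (F := fun ω t => segInf (fun u => Z u ω i) q t)
      (fun ω => continuous_segInf (f := fun (_ : ℝ) u => Z u ω i)
        ((hZic i ω).comp continuous_snd) continuous_const continuous_id)
      (fun t => measurable_segInf_of_forall (hZic i) (hZi i) q t)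
  have h3 : ∀ i (q : ℝ), Measurable fun p : Ω × ℝ => segInf (fun u => Z u p.1 i) p.2 q :=
    fun i q => measurable_of_continuous_snd (F := fun ω t => segInf (fun u => Z u ω i) t q)
      (fun ω => continuous_segInf (f := fun (_ : ℝ) u => Z u ω i)
        ((hZic i ω).comp continuous_snd) continuous_id continuous_const)
      (fun t => measurable_segInf_of_forall (hZic i) (hZi i) t q)
  have h4 : ∀ q r : ℝ, Measurable fun p : Ω × ℝ =>
      segInf (fun s => cornerDist (fun t => Z t p.1) p.2 s) q r := by
    intro q r
    refine measurable_of_continuous_snd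
      (F := fun ω t => segInf (fun s => cornerDist (fun t => Z t ω) t s) q r)
      (fun ω => ?_) fun t => ?_
    · exact continuous_segInf (f := fun t s => cornerDist (fun t => Z t ω) t s)
        (continuous_cornerDist (hZc ω)) continuous_const continuous_const
    · refine measurable_segInf_of_forall (F := fun s ω => cornerDist (fun t => Z t ω) t s)
        (fun ω => (continuous_cornerDist (hZc ω)).comp (continuous_const.prodMk continuous_id))
        (fun s => ?_) q r
      exact Finset.measurable_sum _ fun i _ =>
        (hZi i s).sub (measurable_segInf_of_forall (hZic i) (hZi i) t s)
  have h5 : MeasurableSet {p : Ω × ℝ | EntersAfter (fun t => Z t p.1) a p.2} := by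
    simp only [EntersAfter, ofPred_forall, ofPred_exists]
    exact MeasurableSet.iInter fun n => MeasurableSet.iUnion fun i =>
      measurableSet_lt (h2 i _) (h1 i)
  have hset : {p : Ω × ℝ | p.2 ∈ ancestorFree (fun t => Z t p.1) a b} =
      {p | a ≤ p.2 ∧ p.2 ≤ b} ∩ {p |
        (∃ q : ℚ, p.2 < (q : ℝ) ∧ q ≤ b ∧ ∀ n : ℕ, ∃ i, ∃ r : ℚ, q ≤ r ∧
          segInf (fun s => cornerDist (fun t => Z t p.1) p.2 s) q (min b r) ≤ 0 ∧
          segInf (fun u => Z u p.1 i) (a - 1 / (n + 1)) p.2 <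
            segInf (fun u => Z u p.1 i) p.2 (min b r)) ∨
        ((∃ q : ℚ, (q : ℝ) < p.2 ∧ ∀ i, Z p.2 p.1 i ≤ segInf (fun u => Z u p.1 i) q p.2) ∧
          EntersAfter (fun t => Z t p.1) a p.2)}ᶜ := by
    ext ⟨ω, t⟩
    refine and_congr_right fun ht => ?_
    exact not_congr (exists_coneInterval_iff_countable (hZc ω) ht.1 ht.2)
  rw [hset]
  simp only [ofPred_or, ofPred_exists, ofPred_and, ofPred_forall]
  refine MeasurableSet.inter ?_ (MeasurableSet.compl (MeasurableSet.union ?_ ?_))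
  · exact (measurableSet_le measurable_const measurable_snd).inter
      (measurableSet_le measurable_snd measurable_const)
  · refine MeasurableSet.iUnion fun q => MeasurableSet.inter
      (measurableSet_lt measurable_snd measurable_const) (MeasurableSet.inter (.const _)
        (MeasurableSet.iInter fun n => MeasurableSet.iUnion fun i => MeasurableSet.iUnion fun r =>
          MeasurableSet.inter (.const _) (MeasurableSet.inter ?_ ?_)))
    · exact measurableSet_le (h4 _ _) measurable_const
    · exact measurableSet_lt (h2 i _) (h3 i _)
  · refine MeasurableSet.inter ?_ h5
    exact MeasurableSet.iUnion fun q => MeasurableSet.inter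
      (measurableSet_lt measurable_const measurable_snd)
      (MeasurableSet.iInter fun i => measurableSet_le (h1 i) (h2 i _))

/-- The cover number is the sum of the indicators of the events that it exceeds `n`, each the
projection of a measurable set of pairs of `ω` and an `(n + 1)`-tuple. -/
theorem aemeasurable_intervalCoverNumber (P : Measure Ω) [IsFiniteMeasure P]
    (hZm : ∀ t, Measurable (Z t)) (hZc : ∀ ω, Continuous fun t => Z t ω) (a b : ℝ) {ε : ℝ}
    (hε : 0 ≤ ε) :
    AEMeasurable
      (fun ω => (intervalCoverNumber ε (ancestorFree (fun t => Z t ω) a b) : ENNReal)) P := by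
  classical
  have hb : ∀ ω, BddBelow (ancestorFree (fun t => Z t ω) a b) := fun ω =>
    ⟨a, fun t ht => ht.1.1⟩
  simp_rw [ENat.toENNReal_eq_tsum, lt_intervalCoverNumber_iff hε (hb _)]
  refine AEMeasurable.tsum fun n => ?_
  have hB : MeasurableSet {p : Ω × (Fin (n + 1) → ℝ) |
      (∀ i, p.2 i ∈ ancestorFree (fun t => Z t p.1) a b) ∧
        ∀ i : Fin n, p.2 i.castSucc + ε < p.2 i.succ} := by
    simp only [ofPred_and, ofPred_forall]
    refine MeasurableSet.inter (MeasurableSet.iInter fun i => ?_)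
      (MeasurableSet.iInter fun i => measurableSet_lt (by fun_prop) (by fun_prop))
    have : Measurable fun p : Ω × (Fin (n + 1) → ℝ) => (p.1, p.2 i) := by fun_prop
    exact this (measurableSet_ancestorFree hZm hZc a b)
  have hN := hB.nullMeasurableSet_image_fst P
  have hset : Prod.fst '' {p : Ω × (Fin (n + 1) → ℝ) |
      (∀ i, p.2 i ∈ ancestorFree (fun t => Z t p.1) a b) ∧
        ∀ i : Fin n, p.2 i.castSucc + ε < p.2 i.succ} =
      {ω | HasSeparatedPoints ε (ancestorFree (fun t => Z t ω) a b) n} := by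
    ext ω
    constructor
    · rintro ⟨⟨ω', y⟩, h, rfl⟩
      exact ⟨y, h⟩
    · rintro ⟨y, h⟩
      exact ⟨(ω, y), h, rfl⟩
  rw [hset] at hN
  have := (aemeasurable_const (b := (1 : ENNReal)) (μ := P)).indicator₀ hN
  refine this.congr (Eventually.of_forall fun ω => ?_)
  simp [indicator_apply]

end Joint

end Measurability

/-! ### Moments of the oscillation of one coordinate. -/

noncomputable section Maximal

open Set Filter Topology

/-- The fourth moment of the standard Gaussian. -/
def gaussianFourthMoment : ℝ := ∫ x, x ^ 4 ∂(gaussianReal 0 1)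

theorem gaussianFourthMoment_nonneg : 0 ≤ gaussianFourthMoment :=
  integral_nonneg fun x => by positivity

theorem gaussianReal_eq_map_sqrt {v : ℝ} (hv : 0 ≤ v) :
    gaussianReal 0 v.toNNReal = (gaussianReal 0 1).map (√v * ·) := by
  rw [gaussianReal_map_const_mul]
  congr 1
  · simp
  · apply NNReal.coe_injective
    rw [Real.coe_toNNReal v hv]
    change v = √v ^ 2 * 1
    rw [Real.sq_sqrt hv, mul_one]

theorem measurable_osc_left {Ω : Type*} {L R : ℝ → Ω → ℝ} {S : Set ℝ} {s t v : ℝ}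
    (hc : ∀ ω, Continuous fun t => L t ω)
    (hst : s ≤ t) (hS : Icc s t ⊆ S) :
    Measurable[incrSigma L R S v] fun ω => osc (fun u => L u ω) s t := by
  refine Measurable.neg (measurable_segInf (F := fun u ω => -|L u ω - L s ω|) (fun ω => ?_) hst
    fun u hu => ?_)
  · have := hc ω
    fun_prop
  · have := measurable_incrSigma_left' (L := L) (R := R) (s := v) (hS hu)
      (hS (left_mem_Icc.2 hst))
    exact (measurable_norm.comp this).neg

theorem measurable_osc_right {Ω : Type*} {L R : ℝ → Ω → ℝ} {S : Set ℝ} {s t v : ℝ}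
    (hc : ∀ ω, Continuous fun t => R t ω)
    (hst : s ≤ t) (hS : Icc s t ⊆ S) :
    Measurable[incrSigma L R S v] fun ω => osc (fun u => R u ω) s t := by
  rw [← incrSigma_swap]
  exact measurable_osc_left hc hst hS

namespace IsPlanarBM

variable {Ω : Type*} [MeasurableSpace Ω] {P : Measure Ω} {ρ : ℝ} {L R : ℝ → Ω → ℝ}

theorem incrSigma_le' (h : IsPlanarBM ρ L R P) {S : Set ℝ} {s : ℝ} :
    incrSigma L R S s ≤ ‹MeasurableSpace Ω› :=
  incrSigma_le (fun u _ => (h.measL u).sub (h.measL s)) fun u _ => (h.measR u).sub (h.measR s)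

theorem indepFun (h : IsPlanarBM ρ L R P) {β γ : Type*} [MeasurableSpace β] [MeasurableSpace γ]
    {X : Ω → β} {Y : Ω → γ} (s : ℝ) (hX : Measurable[incrSigma L R (Iic s) s] X)
    (hY : Measurable[incrSigma L R (Ici s) s] Y) : IndepFun X Y P := by
  rw [IndepFun_iff_Indep]
  exact indep_of_indep_of_le_left (indep_of_indep_of_le_right (h.indep s) hY.comap_le)
    hX.comap_le

theorem integrable_pow (h : IsPlanarBM ρ L R P) {s t : ℝ} (hst : s ≤ t) (k : ℕ) :
    Integrable (fun ω => (L t ω - L s ω) ^ k) P := by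
  have hlaw := h.lawL s t hst
  have h1 : MemLp id (k : NNReal) (gaussianReal 0 (t - s).toNNReal) := memLp_id_gaussianReal _
  rw [← hlaw.map_eq, memLp_map_measure_iff (by fun_prop) hlaw.aemeasurable] at h1
  have : IsFiniteMeasure P := hlaw.isFiniteMeasure
  have h2 := (MemLp.integrable_norm_pow' (p := k) (by simpa using h1))
  refine h2.mono' ?_ (Eventually.of_forall fun ω => by simp)
  exact (((h.measL t).sub (h.measL s)).pow_const k).aestronglyMeasurable

theorem integral_incr (h : IsPlanarBM ρ L R P) {s t : ℝ} (hst : s ≤ t) :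
    ∫ ω, (L t ω - L s ω) ∂P = 0 := by
  rw [(h.lawL s t hst).integral_eq, integral_id_gaussianReal]

theorem integral_incr_sq (h : IsPlanarBM ρ L R P) {s t : ℝ} (hst : s ≤ t) :
    ∫ ω, (L t ω - L s ω) ^ 2 ∂P = t - s := by
  have h1 := (h.lawL s t hst).variance_eq
  have h0 : IsProbabilityMeasure P := (h.lawL s t hst).isProbabilityMeasure
  rw [variance_eq_integral (h.lawL s t hst).aemeasurable, h.integral_incr hst,
    variance_id_gaussianReal, Real.coe_toNNReal _ (sub_nonneg.2 hst)] at h1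
  simpa using h1

theorem integral_incr_pow_four (h : IsPlanarBM ρ L R P) {s t : ℝ} (hst : s ≤ t) :
    ∫ ω, (L t ω - L s ω) ^ 4 ∂P = gaussianFourthMoment * (t - s) ^ 2 := by
  have hlaw := h.lawL s t hst
  have h0 : (0 : ℝ) ≤ t - s := sub_nonneg.2 hst
  have := hlaw.integral_comp (f := fun x : ℝ => x ^ 4) (by fun_prop)
  simp only [Function.comp_def] at this
  rw [this, gaussianReal_eq_map_sqrt h0, integral_map (by fun_prop) (by fun_prop)]
  simp_rw [mul_pow]
  rw [integral_const_mul, gaussianFourthMoment, mul_comm]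
  congr 1
  rw [show √(t - s) ^ 4 = (√(t - s) ^ 2) ^ 2 by ring, Real.sq_sqrt h0]

/-- The grid `s, s + h, s + 2 * h, …` stopped at `t`. -/
def grid (s t h : ℝ) (k : ℕ) : ℝ := min (s + k * h) t

theorem monotone_grid {s t h : ℝ} (hh : 0 ≤ h) : Monotone (grid s t h) := by
  intro k l hkl
  refine min_le_min_right _ ?_
  have : (k : ℝ) ≤ l := by exact_mod_cast hkl
  nlinarith

/-- The fourth power is used because a tail of order `lam ^ (-4)` bounds the third moment of the
maximum, and third moments control the Taylor remainders below. -/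
theorem submartingale_pow_four (h : IsPlanarBM ρ L R P) [IsProbabilityMeasure P] {s t d : ℝ}
    (hst : s ≤ t) (hd : 0 ≤ d) :
    ∃ 𝒢 : Filtration ℕ ‹MeasurableSpace Ω›,
      Submartingale (fun k ω => (L (grid s t d k) ω - L s ω) ^ 4) 𝒢 P := by
  have hg := monotone_grid (s := s) (t := t) hd
  have hs : ∀ k, s ≤ grid s t d k := fun k => by
    have : grid s t d 0 = s := by simp [grid, hst]
    exact this.symm.le.trans (hg (Nat.zero_le k))
  let 𝒢 : Filtration ℕ ‹MeasurableSpace Ω› :=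
    { seq := fun k => incrSigma L R (Icc s (grid s t d k)) s
      mono' := fun k l hkl => incrSigma_le
        (fun u hu => measurable_incrSigma_left ⟨hu.1, hu.2.trans (hg hkl)⟩)
        (fun u hu => measurable_incrSigma_right ⟨hu.1, hu.2.trans (hg hkl)⟩)
      le' := fun k => h.incrSigma_le' }
  refine ⟨𝒢, submartingale_of_setIntegral_le_succ (fun k => ?_) (fun k => h.integrable_pow (hs k) 4)
    fun k A hA => ?_⟩
  · refine Measurable.stronglyMeasurable ?_
    exact (measurable_incrSigma_left (right_mem_Icc.2 (hs k))).pow_const 4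
  · set u := grid s t d k
    set v := grid s t d (k + 1)
    have huv : u ≤ v := hg (Nat.le_succ k)
    have hle : incrSigma L R (Icc s u) s ≤ incrSigma L R (Iic u) u :=
      incrSigma_le (fun w hw => measurable_incrSigma_left' hw.2 (hs k))
        fun w hw => measurable_incrSigma_right' hw.2 (hs k)
    have hAm : MeasurableSet A := h.incrSigma_le' _ hA
    have hind : IndepFun (A.indicator fun ω => (L u ω - L s ω) ^ 3) (fun ω => L v ω - L u ω) P := by
      refine h.indepFun u ?_ (measurable_incrSigma_left huv)
      refine Measurable.indicator ?_ (hle _ hA)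
      exact (measurable_incrSigma_left' (mem_Iic.2 le_rfl) (hs k)).pow_const 3
    have hi3 : Integrable (A.indicator fun ω => (L u ω - L s ω) ^ 3) P :=
      (h.integrable_pow (hs k) 3).indicator hAm
    have hi1 : Integrable (fun ω => L v ω - L u ω) P := by
      simpa using h.integrable_pow huv 1
    have hprod : Integrable (fun ω => A.indicator (fun ω => (L u ω - L s ω) ^ 3) ω *
        (L v ω - L u ω)) P := hind.integrable_mul hi3 hi1
    have hzero : ∫ ω, A.indicator (fun ω => (L u ω - L s ω) ^ 3) ω * (L v ω - L u ω) ∂P = 0 := by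
      have := hind.integral_mul_eq_mul_integral hi3.aestronglyMeasurable hi1.aestronglyMeasurable
      rw [h.integral_incr huv, mul_zero] at this
      exact this
    -- This is the tangent inequality `x ^ 4 + 4 * x ^ 3 * y ≤ (x + y) ^ 4`; its linear term has
    -- mean zero since `y` is a future increment.
    have e1 : ∀ ω, A.indicator (fun ω => (L u ω - L s ω) ^ 4) ω +
        4 * (A.indicator (fun ω => (L u ω - L s ω) ^ 3) ω * (L v ω - L u ω)) ≤
        A.indicator (fun ω => (L v ω - L s ω) ^ 4) ω := by
      intro ω
      by_cases hω : ω ∈ A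
      · simp only [indicator_of_mem hω]
        set x := L u ω - L s ω with hx
        set y := L v ω - L u ω with hy
        have : L v ω - L s ω = x + y := by rw [hx, hy]; ring
        rw [this]
        nlinarith [sq_nonneg (y * (y + 2 * x)), sq_nonneg (x * y)]
      · simp [indicator_of_notMem hω]
    have := integral_mono (μ := P) (((h.integrable_pow (hs k) 4).indicator hAm).add
      (hprod.const_mul 4)) ((h.integrable_pow ((hs k).trans huv) 4).indicator hAm) e1
    rw [integral_add' ((h.integrable_pow (hs k) 4).indicator hAm) (hprod.const_mul 4),
      integral_const_mul, hzero, integral_indicator hAm, integral_indicator hAm] at this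
    linarith

theorem measure_grid_ge_le (h : IsPlanarBM ρ L R P) [IsProbabilityMeasure P] {s t d lam : ℝ}
    (hst : s ≤ t) (hd : 0 ≤ d) (hlam : 0 < lam) (n : ℕ) :
    P {ω | ∃ k ≤ n, lam ≤ |L (grid s t d k) ω - L s ω|} ≤
      ENNReal.ofReal (gaussianFourthMoment * (t - s) ^ 2 / lam ^ 4) := by
  obtain ⟨𝒢, hsub⟩ := h.submartingale_pow_four hst hd
  have hmax := maximal_ineq hsub (fun k ω => by positivity) (ε := (lam ^ 4).toNNReal) n
  have hlam4 : 0 < lam ^ 4 := by positivity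
  rw [Real.coe_toNNReal _ hlam4.le] at hmax
  set A := {ω | lam ^ 4 ≤ (Finset.range (n + 1)).sup' Finset.nonempty_range_add_one
    fun k => (L (grid s t d k) ω - L s ω) ^ 4}
  have hsubset : {ω | ∃ k ≤ n, lam ≤ |L (grid s t d k) ω - L s ω|} ⊆ A := by
    rintro ω ⟨k, hk, hle⟩
    change lam ^ 4 ≤ _
    refine le_trans ?_ (Finset.le_sup' _ (Finset.mem_range.2 (Nat.lt_succ_of_le hk)))
    rw [← Even.pow_abs (by decide : Even 4) (L (grid s t d k) ω - L s ω)]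
    exact pow_le_pow_left₀ hlam.le hle 4
  have hgs : s ≤ grid s t d n := by
    refine le_min ?_ hst
    have : (0 : ℝ) ≤ n := by positivity
    nlinarith
  have hgt : grid s t d n ≤ t := min_le_right _ _
  have hAle : ∫ ω in A, (L (grid s t d n) ω - L s ω) ^ 4 ∂P ≤
      gaussianFourthMoment * (t - s) ^ 2 := by
    calc ∫ ω in A, (L (grid s t d n) ω - L s ω) ^ 4 ∂P
        ≤ ∫ ω, (L (grid s t d n) ω - L s ω) ^ 4 ∂P :=
          setIntegral_le_integral (h.integrable_pow hgs 4)
            (Eventually.of_forall fun ω => by positivity)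
      _ = gaussianFourthMoment * (grid s t d n - s) ^ 2 := h.integral_incr_pow_four hgs
      _ ≤ _ := by
        refine mul_le_mul_of_nonneg_left ?_ gaussianFourthMoment_nonneg
        exact pow_le_pow_left₀ (by linarith) (by linarith) 2
  refine (measure_mono hsubset).trans ?_
  rw [ENNReal.ofReal_div_of_pos hlam4, ENNReal.le_div_iff_mul_le
    (Or.inl (by simpa using hlam4)) (Or.inl ENNReal.ofReal_ne_top), mul_comm]
  exact hmax.trans (ENNReal.ofReal_le_ofReal hAle)

/-- A strict excess at one time persists nearby, so all sufficiently fine grids detect it: the event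
lies in a `liminf` of grid events, each bounded by Doob's inequality. -/
theorem measure_lt_osc_le (h : IsPlanarBM ρ L R P) [IsProbabilityMeasure P] {s t lam : ℝ}
    (hst : s ≤ t) (hlam : 0 < lam) :
    P {ω | lam < osc (fun u => L u ω) s t} ≤
      ENNReal.ofReal (gaussianFourthMoment * (t - s) ^ 2 / lam ^ 4) := by
  let E : ℕ → Set Ω := fun n =>
    {ω | ∃ k ≤ n + 1, lam ≤ |L (grid s t ((t - s) / (n + 1)) k) ω - L s ω|}
  have hE : ∀ n, P (E n) ≤ ENNReal.ofReal (gaussianFourthMoment * (t - s) ^ 2 / lam ^ 4) :=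
    fun n => h.measure_grid_ge_le hst (div_nonneg (sub_nonneg.2 hst) (by positivity)) hlam _
  have hsub : {ω | lam < osc (fun u => L u ω) s t} ⊆ ⋃ N, ⋂ n ≥ N, E n := by
    intro ω hω
    obtain ⟨u, hu, he⟩ := exists_osc_eq (h.contL ω) hst
    have hω' : lam < |L u ω - L s ω| := he ▸ (show lam < osc (fun u => L u ω) s t from hω)
    have hcont : Continuous fun u => |L u ω - L s ω| := by
      have := h.contL ω
      fun_prop
    obtain ⟨η, hη, hball⟩ := Metric.eventually_nhds_iff.1
      (hcont.continuousAt.eventually (lt_mem_nhds hω'))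
    obtain ⟨N, hN⟩ := exists_nat_gt ((t - s) / η)
    simp only [mem_iUnion, mem_iInter]
    refine ⟨N, fun n hn => ?_⟩
    have hn1 : (0 : ℝ) < n + 1 := by positivity
    rcases hst.eq_or_lt with rfl | hlt
    · have : u = s := le_antisymm hu.2 hu.1
      subst this
      simp at hω'
      linarith
    set d := (t - s) / (n + 1) with hd
    have hdpos : 0 < d := div_pos (sub_pos.2 hlt) hn1
    have hdη : d < η := by
      rw [hd, div_lt_iff₀ hn1]
      rw [div_lt_iff₀ hη] at hN
      have : (N : ℝ) ≤ n := by exact_mod_cast hn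
      nlinarith
    have hnd : (n + 1) * d = t - s := by rw [hd]; field_simp
    set k := ⌊(u - s) / d⌋₊ with hk
    have hk1 : (k : ℝ) * d ≤ u - s := by
      rw [← le_div_iff₀ hdpos]
      exact Nat.floor_le (div_nonneg (sub_nonneg.2 hu.1) hdpos.le)
    have hk2 : u - s < (k + 1) * d := by
      rw [← div_lt_iff₀ hdpos]
      exact Nat.lt_floor_add_one _
    have hkn : k ≤ n + 1 := by
      have : (k : ℝ) * d ≤ ((n + 1 : ℕ) : ℝ) * d := by
        push_cast
        rw [hnd]
        linarith [hu.2]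
      exact_mod_cast le_of_mul_le_mul_right this hdpos
    have hgrid : grid s t d k = s + k * d := min_eq_left (by linarith [hu.2])
    refine ⟨k, hkn, ?_⟩
    rw [hgrid]
    refine (hball ?_).le
    rw [Real.dist_eq, abs_lt]
    constructor <;> nlinarith
  refine (measure_mono hsub).trans ?_
  have hmono : Monotone fun N => ⋂ n ≥ N, E n := by
    intro N M hNM
    exact biInter_mono (fun n hn => le_trans hNM hn) fun n _ => le_rfl
  rw [hmono.measure_iUnion]
  exact iSup_le fun N => (measure_mono (biInter_subset_of_mem (mem_Ici.2 le_rfl))).trans (hE N)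

theorem measurable_osc (h : IsPlanarBM ρ L R P) {s t : ℝ} (hst : s ≤ t) :
    Measurable fun ω => osc (fun u => L u ω) s t :=
  (measurable_osc_left (R := R) (v := s) h.contL hst (subset_univ _)).mono h.incrSigma_le' le_rfl

end IsPlanarBM

theorem ofReal_pow_three_le_tsum {y : ℝ} (hy : 0 ≤ y) :
    ENNReal.ofReal (y ^ 3) ≤
      1 + ∑' j : ℕ, ENNReal.ofReal (8 ^ (j + 1)) * (if 2 ^ j / 2 < y then 1 else 0) := by
  rcases le_or_gt y 1 with h | h
  · refine le_trans ?_ le_self_add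
    rw [← ENNReal.ofReal_one]
    exact ENNReal.ofReal_le_ofReal (pow_le_one₀ hy h)
  · obtain ⟨n, hn, hn'⟩ := exists_nat_pow_near h.le (one_lt_two (α := ℝ))
    refine le_trans ?_ le_add_self
    refine le_trans ?_ (ENNReal.le_tsum n)
    rw [if_pos (by have : (0 : ℝ) < 2 ^ n := by positivity
                   linarith), mul_one]
    refine ENNReal.ofReal_le_ofReal ?_
    calc y ^ 3 ≤ (2 ^ (n + 1)) ^ 3 := pow_le_pow_left₀ hy hn'.le 3
      _ = 8 ^ (n + 1) := by rw [← pow_mul, mul_comm, pow_mul]; norm_num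

/-- A constant bounding the third moment of the running maximum at time one. -/
def oscConst : ℝ := 1 + 256 * gaussianFourthMoment

theorem one_le_oscConst : 1 ≤ oscConst := by
  have := gaussianFourthMoment_nonneg
  rw [oscConst]; linarith

namespace IsPlanarBM

variable {Ω : Type*} [MeasurableSpace Ω] {P : Measure Ω} {ρ : ℝ} {L R : ℝ → Ω → ℝ}

theorem lintegral_osc_pow_three_le (h : IsPlanarBM ρ L R P) [IsProbabilityMeasure P] {s t : ℝ}
    (hst : s < t) :
    ∫⁻ ω, ENNReal.ofReal ((osc (fun u => L u ω) s t / √(t - s)) ^ 3) ∂P ≤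
      ENNReal.ofReal oscConst := by
  have hd : 0 < t - s := sub_pos.2 hst
  have hsq : 0 < √(t - s) := Real.sqrt_pos.2 hd
  set Y : Ω → ℝ := fun ω => osc (fun u => L u ω) s t / √(t - s) with hY
  have hYm : Measurable Y := (h.measurable_osc hst.le).div_const _
  have hY0 : ∀ ω, 0 ≤ Y ω := fun ω => div_nonneg (osc_nonneg (h.contL ω) hst.le) hsq.le
  have htail : ∀ j : ℕ, P {ω | 2 ^ j / 2 < Y ω} ≤
      ENNReal.ofReal (16 * gaussianFourthMoment * (1 / 16) ^ j) := by
    intro j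
    have h1 := h.measure_lt_osc_le hst.le (lam := 2 ^ j / 2 * √(t - s)) (by positivity)
    have hset : {ω | 2 ^ j / 2 < Y ω} =
        {ω | 2 ^ j / 2 * √(t - s) < osc (fun u => L u ω) s t} := by
      ext ω
      simp only [hY, mem_ofPred_eq, lt_div_iff₀ hsq]
    rw [hset]
    refine h1.trans (ENNReal.ofReal_le_ofReal (le_of_eq ?_))
    rw [mul_pow, show √(t - s) ^ 4 = (√(t - s) ^ 2) ^ 2 by ring, Real.sq_sqrt hd.le, div_pow,
      ← pow_mul, mul_comm j 4, pow_mul, one_div, inv_pow]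
    field_simp
    norm_num
    ring
  -- Weights `8 ^ (j + 1)` against tails of order `16 ^ (-j)` leave a geometric series of ratio
  -- `1/2`.
  have hterm : ∀ j : ℕ, ∫⁻ ω, ENNReal.ofReal (8 ^ (j + 1)) * (if 2 ^ j / 2 < Y ω then 1 else 0) ∂P ≤
      ENNReal.ofReal (128 * gaussianFourthMoment * (1 / 2) ^ j) := by
    intro j
    have hm : MeasurableSet {ω | 2 ^ j / 2 < Y ω} := measurableSet_lt measurable_const hYm
    rw [lintegral_const_mul' _ _ ENNReal.ofReal_ne_top]
    have : ∫⁻ ω, (if 2 ^ j / 2 < Y ω then 1 else 0) ∂P = P {ω | 2 ^ j / 2 < Y ω} := by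
      rw [← lintegral_indicator_one hm]
      rfl
    rw [this]
    refine (mul_le_mul_right (htail j) _).trans (le_of_eq ?_)
    rw [← ENNReal.ofReal_mul (by positivity)]
    congr 1
    rw [pow_succ, show (1 / 2 : ℝ) ^ j = 8 ^ j * (1 / 16) ^ j by rw [← mul_pow]; norm_num]
    ring
  calc ∫⁻ ω, ENNReal.ofReal (Y ω ^ 3) ∂P
      ≤ ∫⁻ ω, (1 + ∑' j : ℕ, ENNReal.ofReal (8 ^ (j + 1)) *
          (if 2 ^ j / 2 < Y ω then 1 else 0)) ∂P :=
        lintegral_mono fun ω => ofReal_pow_three_le_tsum (hY0 ω)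
    _ = 1 + ∑' j : ℕ, ∫⁻ ω, ENNReal.ofReal (8 ^ (j + 1)) *
          (if 2 ^ j / 2 < Y ω then 1 else 0) ∂P := by
        rw [lintegral_add_left measurable_const, lintegral_const, measure_univ, mul_one,
          lintegral_tsum]
        intro j
        refine (Measurable.const_mul (Measurable.ite ?_ measurable_const measurable_const)
          _).aemeasurable
        exact measurableSet_lt measurable_const hYm
    _ ≤ 1 + ∑' j : ℕ, ENNReal.ofReal (128 * gaussianFourthMoment * (1 / 2) ^ j) := by
        gcongr with j
        exact hterm j
    _ = ENNReal.ofReal oscConst := by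
        rw [← ENNReal.ofReal_tsum_of_nonneg, tsum_mul_left, tsum_geometric_two,
          ← ENNReal.ofReal_one, ← ENNReal.ofReal_add zero_le_one]
        · congr 1
          rw [oscConst]; ring
        · have := gaussianFourthMoment_nonneg
          positivity
        · intro j
          have := gaussianFourthMoment_nonneg
          positivity
        · exact (summable_geometric_two).mul_left _

theorem integrable_osc_pow_three (h : IsPlanarBM ρ L R P) [IsProbabilityMeasure P] {s t : ℝ}
    (hst : s < t) :
    Integrable (fun ω => osc (fun u => L u ω) s t ^ 3) P ∧
      ∫ ω, osc (fun u => L u ω) s t ^ 3 ∂P ≤ oscConst * √(t - s) ^ 3 := by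
  have hd : 0 < t - s := sub_pos.2 hst
  have hsq : 0 < √(t - s) := Real.sqrt_pos.2 hd
  have h1 := h.lintegral_osc_pow_three_le hst
  have hm := h.measurable_osc hst.le
  have hY0 : ∀ ω, 0 ≤ osc (fun u => L u ω) s t / √(t - s) := fun ω =>
    div_nonneg (osc_nonneg (h.contL ω) hst.le) hsq.le
  have hYi : Integrable (fun ω => (osc (fun u => L u ω) s t / √(t - s)) ^ 3) P := by
    refine ⟨((hm.div_const _).pow_const 3).aestronglyMeasurable, ?_⟩
    rw [hasFiniteIntegral_iff_ofReal (Eventually.of_forall fun ω => pow_nonneg (hY0 ω) 3)]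
    exact h1.trans_lt ENNReal.ofReal_lt_top
  have hYle : ∫ ω, (osc (fun u => L u ω) s t / √(t - s)) ^ 3 ∂P ≤ oscConst := by
    rw [integral_eq_lintegral_of_nonneg_ae
      (Eventually.of_forall fun ω => pow_nonneg (hY0 ω) 3) hYi.aestronglyMeasurable]
    refine ENNReal.toReal_le_of_le_ofReal ?_ h1
    linarith [one_le_oscConst]
  have he : ∀ ω, osc (fun u => L u ω) s t ^ 3 =
      √(t - s) ^ 3 * (osc (fun u => L u ω) s t / √(t - s)) ^ 3 := by
    intro ω
    rw [← mul_pow, mul_div_cancel₀ _ hsq.ne']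
  simp_rw [he]
  refine ⟨hYi.const_mul _, ?_⟩
  rw [integral_const_mul, mul_comm]
  exact mul_le_mul_of_nonneg_right hYle (by positivity)

theorem integrable_osc (h : IsPlanarBM ρ L R P) [IsProbabilityMeasure P] {s t : ℝ} (hst : s < t) :
    Integrable (fun ω => osc (fun u => L u ω) s t) P ∧
      ∫ ω, osc (fun u => L u ω) s t ∂P ≤ 2 * oscConst * √(t - s) := by
  have hd : 0 < t - s := sub_pos.2 hst
  have hsq : 0 < √(t - s) := Real.sqrt_pos.2 hd
  obtain ⟨hi, hle⟩ := h.integrable_osc_pow_three hst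
  -- The inequality `x ≤ y + x ^ 3 / y ^ 2` derives the first moment from the third, at the Brownian
  -- scale `y = √(t - s)`.
  have hb : ∀ ω, osc (fun u => L u ω) s t ≤
      √(t - s) + (√(t - s) ^ 2)⁻¹ * osc (fun u => L u ω) s t ^ 3 := by
    intro ω
    have h0 := osc_nonneg (h.contL ω) hst.le
    set x := osc (fun u => L u ω) s t
    set y := √(t - s)
    rw [← sub_nonneg, show y + (y ^ 2)⁻¹ * x ^ 3 - x = (y ^ 3 + x ^ 3 - x * y ^ 2) / y ^ 2 by
      field_simp]
    refine div_nonneg ?_ (by positivity)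
    rcases le_total x y with hxy | hxy
    · nlinarith [mul_le_mul_of_nonneg_right hxy (sq_nonneg y), pow_nonneg h0 3]
    · nlinarith [mul_le_mul_of_nonneg_left (pow_le_pow_left₀ hsq.le hxy 2) h0, pow_pos hsq 3]
  have hi2 : Integrable (fun ω => √(t - s) + (√(t - s) ^ 2)⁻¹ * osc (fun u => L u ω) s t ^ 3) P :=
    (integrable_const _).add (hi.const_mul _)
  have hi1 : Integrable (fun ω => osc (fun u => L u ω) s t) P := by
    refine hi2.mono' (h.measurable_osc hst.le).aestronglyMeasurable
      (Eventually.of_forall fun ω => ?_)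
    rw [Real.norm_eq_abs, abs_of_nonneg (osc_nonneg (h.contL ω) hst.le)]
    exact hb ω
  refine ⟨hi1, (integral_mono hi1 hi2 hb).trans ?_⟩
  rw [integral_add (integrable_const _) (hi.const_mul _), integral_const, integral_const_mul]
  simp only [probReal_univ, smul_eq_mul, one_mul]
  have h2 : (√(t - s) ^ 2)⁻¹ * ∫ ω, osc (fun u => L u ω) s t ^ 3 ∂P ≤ oscConst * √(t - s) := by
    rw [inv_mul_le_iff₀ (by positivity)]
    calc _ ≤ _ := hle
      _ = _ := by ring
  nlinarith [mul_le_mul_of_nonneg_right one_le_oscConst hsq.le]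

end IsPlanarBM

end Maximal

/-! ### Taylor expansion of complex powers on a half plane. -/

noncomputable section Harmonic

open Set Filter Topology Complex

/-- Second order Taylor estimate for a real power on a half plane. -/
theorem norm_cpow_sub_taylor_le {a c : ℝ} (ha : 0 < a) (ha1 : a < 1) (hc : 0 < c) {w w' : ℂ}
    (hw : c ≤ w.re) (hw' : c ≤ w'.re) :
    ‖w' ^ (a : ℂ) - w ^ (a : ℂ) - a * w ^ ((a - 1 : ℝ) : ℂ) * (w' - w) -
      a * (a - 1) / 2 * w ^ ((a - 2 : ℝ) : ℂ) * (w' - w) ^ 2‖ ≤ 2 * c ^ (a - 3) * ‖w' - w‖ ^ 3 ∧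
    ‖w' ^ ((a - 1 : ℝ) : ℂ) - w ^ ((a - 1 : ℝ) : ℂ)‖ ≤ c ^ (a - 2) * ‖w' - w‖ := by
  set H : Set ℂ := {z | c ≤ z.re} with hH
  have hHc : Convex ℝ H := convex_halfSpace_re_ge c
  have hslit : ∀ z ∈ H, z ∈ slitPlane := fun z hz => Or.inl (hc.trans_le hz)
  have hnorm : ∀ z ∈ H, c ≤ ‖z‖ := fun z hz => (show c ≤ z.re from hz).trans (re_le_norm z)
  have hderiv : ∀ (p : ℝ), ∀ z ∈ H, HasDerivAt (fun z : ℂ => z ^ (p : ℂ))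
      (p * z ^ ((p - 1 : ℝ) : ℂ)) z := by
    intro p z hz
    have := (hasDerivAt_id z).cpow_const (c := (p : ℂ)) (hslit z hz)
    simpa using this
  have hbound : ∀ (p : ℝ), p ≤ 0 → ∀ z ∈ H, ‖z ^ (p : ℂ)‖ ≤ c ^ p := by
    intro p hp z hz
    rw [norm_cpow_real]
    exact Real.rpow_le_rpow_of_nonpos hc (hnorm z hz) hp
  have hlip : ∀ p : ℝ, p ≤ 1 → ∀ z ∈ H, ∀ z' ∈ H,
      ‖z' ^ (p : ℂ) - z ^ (p : ℂ)‖ ≤ |p| * c ^ (p - 1) * ‖z' - z‖ := by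
    intro p hp z hz z' hz'
    refine hHc.norm_image_sub_le_of_norm_hasDerivWithin_le
      (fun x hx => (hderiv p x hx).hasDerivWithinAt) (fun x hx => ?_) hz hz'
    rw [norm_mul, norm_real, Real.norm_eq_abs]
    exact mul_le_mul_of_nonneg_left (hbound _ (by linarith) x hx) (abs_nonneg _)
  have hc2 : 0 < c ^ (a - 2) := Real.rpow_pos_of_pos hc _
  have hc3 : 0 < c ^ (a - 3) := Real.rpow_pos_of_pos hc _
  refine ⟨?_, ?_⟩
  swap
  · refine (hlip (a - 1) (by linarith) w hw w' hw').trans ?_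
    rw [show a - 1 - 1 = a - 2 by ring, abs_of_neg (by linarith)]
    refine mul_le_mul_of_nonneg_right ?_ (norm_nonneg _)
    nlinarith
  set r := ‖w' - w‖ with hr
  have hr0 : 0 ≤ r := norm_nonneg _
  -- The mean value inequality is applied successively on this convex set: the half plane keeps away
  -- from the singularity, and the ball gives `‖z - w‖ ≤ r` at intermediate points.
  set S : Set ℂ := H ∩ Metric.closedBall w r with hS
  have hSc : Convex ℝ S := hHc.inter (convex_closedBall w r)
  have hwS : w ∈ S := ⟨hw, Metric.mem_closedBall_self hr0⟩
  have hw'S : w' ∈ S := ⟨hw', by rw [Metric.mem_closedBall, dist_eq_norm]⟩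
  have hSr : ∀ z ∈ S, ‖z - w‖ ≤ r := fun z hz => by
    have := hz.2
    rwa [Metric.mem_closedBall, dist_eq_norm] at this
  have h2 : ∀ z ∈ S, ‖z ^ ((a - 2 : ℝ) : ℂ) - w ^ ((a - 2 : ℝ) : ℂ)‖ ≤ 2 * c ^ (a - 3) * r := by
    intro z hz
    refine (hlip (a - 2) (by linarith) w hw z hz.1).trans ?_
    rw [show a - 2 - 1 = a - 3 by ring, abs_of_neg (by linarith)]
    exact mul_le_mul (mul_le_mul_of_nonneg_right (by linarith) hc3.le) (hSr z hz) (norm_nonneg _)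
      (by positivity)
  have hid : ∀ z : ℂ, HasDerivAt (fun z : ℂ => z - w) 1 z := fun z => (hasDerivAt_id z).sub_const w
  have h1 : ∀ z ∈ S, ‖z ^ ((a - 1 : ℝ) : ℂ) - w ^ ((a - 1 : ℝ) : ℂ) -
      (a - 1) * w ^ ((a - 2 : ℝ) : ℂ) * (z - w)‖ ≤ 2 * c ^ (a - 3) * r * r := by
    intro z hz
    have hd : ∀ x ∈ S, HasDerivWithinAt (fun z : ℂ => z ^ ((a - 1 : ℝ) : ℂ) -
        w ^ ((a - 1 : ℝ) : ℂ) - (a - 1) * w ^ ((a - 2 : ℝ) : ℂ) * (z - w))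
        ((a - 1) * (x ^ ((a - 2 : ℝ) : ℂ) - w ^ ((a - 2 : ℝ) : ℂ))) S x := by
      intro x hx
      refine HasDerivAt.hasDerivWithinAt ?_
      have e1 := hderiv (a - 1) x hx.1
      rw [show a - 1 - 1 = a - 2 by ring] at e1
      have e2 := ((e1.sub_const (w ^ ((a - 1 : ℝ) : ℂ))).sub
        ((hid x).const_mul ((a - 1) * w ^ ((a - 2 : ℝ) : ℂ))))
      refine HasDerivAt.congr_deriv e2 ?_
      push_cast
      ring
    have hmv := hSc.norm_image_sub_le_of_norm_hasDerivWithin_le hd (C := 2 * c ^ (a - 3) * r)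
      (fun x hx => ?_) hwS hz
    · simp only [sub_self, mul_zero, sub_zero] at hmv
      exact hmv.trans (mul_le_mul_of_nonneg_left (hSr z hz) (by positivity))
    · rw [norm_mul]
      have : ‖(a : ℂ) - 1‖ ≤ 1 := by
        rw [show (a : ℂ) - 1 = ((a - 1 : ℝ) : ℂ) by push_cast; ring, norm_real, Real.norm_eq_abs,
          abs_le]
        constructor <;> linarith
      calc _ ≤ 1 * (2 * c ^ (a - 3) * r) :=
            mul_le_mul this (h2 x hx) (norm_nonneg _) zero_le_one
        _ = _ := one_mul _
  have hd0 : ∀ x ∈ S, HasDerivWithinAt (fun z : ℂ => z ^ (a : ℂ) - w ^ (a : ℂ) -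
      a * w ^ ((a - 1 : ℝ) : ℂ) * (z - w) - a * (a - 1) / 2 * w ^ ((a - 2 : ℝ) : ℂ) * (z - w) ^ 2)
      (a * (x ^ ((a - 1 : ℝ) : ℂ) - w ^ ((a - 1 : ℝ) : ℂ) -
      (a - 1) * w ^ ((a - 2 : ℝ) : ℂ) * (x - w))) S x := by
    intro x hx
    refine HasDerivAt.hasDerivWithinAt ?_
    have e1 := hderiv a x hx.1
    have e2 := ((e1.sub_const (w ^ (a : ℂ))).sub
      ((hid x).const_mul (a * w ^ ((a - 1 : ℝ) : ℂ)))).sub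
      (((hid x).pow 2).const_mul (a * (a - 1) / 2 * w ^ ((a - 2 : ℝ) : ℂ)))
    refine HasDerivAt.congr_deriv e2 ?_
    push_cast
    ring
  have hmv := hSc.norm_image_sub_le_of_norm_hasDerivWithin_le hd0 (C := 2 * c ^ (a - 3) * r * r)
    (fun x hx => ?_) hwS hw'S
  · simp only [sub_self, mul_zero, sub_zero, ne_eq, OfNat.ofNat_ne_zero, not_false_eq_true,
      zero_pow] at hmv
    calc _ ≤ _ := hmv
      _ = _ := by rw [← hr]; ring
  · rw [norm_mul]
    have : ‖(a : ℂ)‖ ≤ 1 := by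
      rw [norm_real, Real.norm_eq_abs, abs_le]
      constructor <;> linarith
    calc _ ≤ 1 * (2 * c ^ (a - 3) * r * r) :=
          mul_le_mul this (h1 x hx) (norm_nonneg _) zero_le_one
      _ = _ := one_mul _

end Harmonic

/-! ### The cone and its positive harmonic function. -/

noncomputable section Harmonic

open Set Filter Topology Complex

/-- Half of the opening angle of the cone for which the exponent of the reflected process is `a`. -/
def halfAngle (a : ℝ) : ℝ := Real.pi / (2 * (2 - a))

theorem halfAngle_pos {a : ℝ} (ha1 : a < 1) : 0 < halfAngle a :=
  div_pos Real.pi_pos (by linarith)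

theorem halfAngle_lt {a : ℝ} (ha1 : a < 1) : halfAngle a < Real.pi / 2 := by
  rw [halfAngle]
  exact div_lt_div_of_pos_left Real.pi_pos (by norm_num) (by linarith)

theorem cos_halfAngle_pos {a : ℝ} (ha1 : a < 1) : 0 < Real.cos (halfAngle a) :=
  Real.cos_pos_of_mem_Ioo
    ⟨by linarith [halfAngle_pos ha1, Real.pi_pos], halfAngle_lt ha1⟩

/-- The linear map that sends the quadrant to a cone symmetric about the positive real axis and
the correlated Brownian motion to a multiple of the standard one. -/
def conePoint (a x y : ℝ) : ℂ := x * exp (-(halfAngle a) * I) + y * exp (halfAngle a * I)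

theorem norm_exp_halfAngle (θ : ℝ) : ‖exp (θ * I)‖ = 1 := norm_exp_ofReal_mul_I θ

theorem norm_exp_neg_halfAngle (θ : ℝ) : ‖exp (-θ * I)‖ = 1 := by
  have := norm_exp_ofReal_mul_I (-θ)
  rwa [ofReal_neg] at this

/-- Since the cosine is positive for `a < 1`, the closed cone apart from its apex lies in the open
right half plane, where the power is analytic, and `x + y` measures the distance to the corner. -/
theorem conePoint_re (a x y : ℝ) : (conePoint a x y).re = (x + y) * Real.cos (halfAngle a) := by
  rw [conePoint, add_re, re_ofReal_mul, re_ofReal_mul, exp_ofReal_mul_I_re, ← ofReal_neg,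
    exp_ofReal_mul_I_re, Real.cos_neg]
  ring

theorem norm_conePoint_le (a : ℝ) (x y : ℝ) :
    ‖conePoint a x y‖ ≤ |x| + |y| := by
  refine (norm_add_le _ _).trans ?_
  rw [norm_mul, norm_mul, norm_exp_neg_halfAngle, norm_exp_halfAngle, norm_real, norm_real]
  simp

/-- The positive harmonic function with vanishing reflection derivative on the sides of the
quadrant. -/
def coneHarmonic (a x y : ℝ) : ℝ := (conePoint a x y ^ (a : ℂ)).re

theorem measurable_conePoint (a : ℝ) : Measurable fun p : ℝ × ℝ => conePoint a p.1 p.2 := by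
  unfold conePoint
  fun_prop

theorem measurable_coneHarmonic (a : ℝ) : Measurable fun p : ℝ × ℝ => coneHarmonic a p.1 p.2 :=
  measurable_re.comp ((measurable_conePoint a).pow_const _)

theorem coneHarmonic_le {a x y : ℝ} (ha : 0 < a) (hx : 0 ≤ x) (hy : 0 ≤ y) :
    coneHarmonic a x y ≤ (x + y) ^ a := by
  refine (re_le_norm _).trans ?_
  rw [norm_cpow_real]
  refine Real.rpow_le_rpow (norm_nonneg _) ?_ ha.le
  have := norm_conePoint_le a x y
  rwa [abs_of_nonneg hx, abs_of_nonneg hy] at this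

/-- The constant in the lower bound for `coneHarmonic`. -/
def harmonicConst (a : ℝ) : ℝ := Real.cos (halfAngle a) ^ a * Real.cos (Real.pi / 2 * a)

theorem harmonicConst_pos {a : ℝ} (ha : 0 < a) (ha1 : a < 1) : 0 < harmonicConst a := by
  refine mul_pos (Real.rpow_pos_of_pos (cos_halfAngle_pos ha1) _) ?_
  refine Real.cos_pos_of_mem_Ioo ⟨?_, ?_⟩
  · nlinarith [Real.pi_pos]
  · nlinarith [Real.pi_pos]

/-- The argument of a point in the right half plane is at most `π/2` in absolute value, so that of
its `a`-th power stays at most `a * π/2 < π/2`. -/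
theorem le_coneHarmonic {a x y : ℝ} (ha : 0 < a) (ha1 : a < 1) (hx : 0 ≤ x) (hy : 0 ≤ y) :
    harmonicConst a * (x + y) ^ a ≤ coneHarmonic a x y := by
  have hre := conePoint_re a x y
  have hcos := cos_halfAngle_pos ha1
  have hre0 : 0 ≤ (conePoint a x y).re := by rw [hre]; positivity
  rw [coneHarmonic, cpow_ofReal_re, harmonicConst]
  have h1 : (x + y) ^ a * Real.cos (halfAngle a) ^ a ≤ ‖conePoint a x y‖ ^ a := by
    rw [← Real.mul_rpow (by linarith) hcos.le, ← hre]
    exact Real.rpow_le_rpow hre0 (re_le_norm _) ha.le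
  have harg := abs_le.1 (abs_arg_le_pi_div_two_iff.2 hre0)
  have h2 : Real.cos (Real.pi / 2 * a) ≤ Real.cos (arg (conePoint a x y) * a) := by
    rw [← Real.cos_abs (arg (conePoint a x y) * a)]
    refine Real.cos_le_cos_of_nonneg_of_le_pi (abs_nonneg _) ?_ ?_
    · nlinarith [Real.pi_pos]
    · rw [abs_mul, abs_of_pos ha]
      exact mul_le_mul_of_nonneg_right (abs_le.2 harg) ha.le
  have h3 : 0 ≤ Real.cos (Real.pi / 2 * a) :=
    Real.cos_nonneg_of_mem_Icc ⟨by nlinarith [Real.pi_pos], by nlinarith [Real.pi_pos]⟩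
  calc _ = (x + y) ^ a * Real.cos (halfAngle a) ^ a * Real.cos (Real.pi / 2 * a) := by ring
    _ ≤ _ := mul_le_mul h1 h2 h3 (by positivity)

theorem coneHarmonic_nonneg {a x y : ℝ} (ha : 0 < a) (ha1 : a < 1) (hx : 0 ≤ x) (hy : 0 ≤ y) :
    0 ≤ coneHarmonic a x y :=
  (mul_nonneg (harmonicConst_pos ha ha1).le (by positivity)).trans (le_coneHarmonic ha ha1 hx hy)

/-- The reflection derivative vanishes on the two sides. -/
theorem re_cpow_mul_exp_eq_zero {a y : ℝ} (ha1 : a < 1) (hy : 0 < y) :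
    ((y * exp (halfAngle a * I)) ^ ((a - 1 : ℝ) : ℂ) * exp (-(halfAngle a) * I)).re = 0 ∧
    ((y * exp (-(halfAngle a) * I)) ^ ((a - 1 : ℝ) : ℂ) * exp (halfAngle a * I)).re = 0 := by
  have hθ := halfAngle_pos ha1
  have hθ' := halfAngle_lt ha1
  -- This relation fixes the angle `θ`: on a side, the derivative times the push direction has
  -- argument `±((a - 1) * θ - θ) = ±π/2`, hence real part `0`.
  have key : halfAngle a * (a - 2) = -(Real.pi / 2) := by
    have : (2 - a) ≠ 0 := by linarith
    rw [halfAngle]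
    field_simp
    ring
  have hgen : ∀ θ : ℝ, |θ| < Real.pi / 2 → Real.cos (θ * (a - 2)) = 0 →
      ((y * exp (θ * I)) ^ ((a - 1 : ℝ) : ℂ) * exp (-θ * I)).re = 0 := by
    intro θ hθ h0
    have hlt := abs_lt.1 hθ
    have hlog : log (y * exp (θ * I)) = Real.log y + θ * I := by
      rw [log_ofReal_mul hy (exp_ne_zero _), log_exp]
      · simp; linarith [Real.pi_pos]
      · simp; linarith [Real.pi_pos]
    rw [cpow_def_of_ne_zero (mul_ne_zero (by exact_mod_cast hy.ne') (exp_ne_zero _)), hlog,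
      ← exp_add, exp_re]
    have : ((Real.log y + θ * I) * ((a - 1 : ℝ) : ℂ) + -θ * I).im = θ * (a - 2) := by
      simp
      ring
    rw [this, h0, mul_zero]
  refine ⟨hgen (halfAngle a) (by rw [abs_of_pos hθ]; exact hθ') (by rw [key]; simp), ?_⟩
  have := hgen (-halfAngle a) (by rw [abs_neg, abs_of_pos hθ]; exact hθ')
    (by rw [neg_mul, key]; simp)
  simpa using this

/-- The coefficients of the second order expansion of `coneHarmonic`. -/
def coneCoeff (a p : ℝ) (c : ℂ) (x y : ℝ) : ℝ := (c * conePoint a x y ^ (p : ℂ)).re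

theorem measurable_coneCoeff (a p : ℝ) (c : ℂ) :
    Measurable fun q : ℝ × ℝ => coneCoeff a p c q.1 q.2 :=
  measurable_re.comp (((measurable_conePoint a).pow_const _).const_mul c)

theorem abs_coneCoeff_le {a p x y δ : ℝ} (ha1 : a < 1) (hp : p ≤ 0) (hδ : 0 < δ) (c : ℂ)
    (hc : ‖c‖ ≤ 1) (hxy : δ ≤ x + y) :
    |coneCoeff a p c x y| ≤ (δ * Real.cos (halfAngle a)) ^ p := by
  refine (abs_re_le_norm _).trans ?_
  rw [norm_mul, norm_cpow_real]
  have hcos := cos_halfAngle_pos ha1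
  have h1 : δ * Real.cos (halfAngle a) ≤ ‖conePoint a x y‖ := by
    refine le_trans ?_ (re_le_norm _)
    rw [conePoint_re]
    exact mul_le_mul_of_nonneg_right hxy hcos.le
  have h2 := Real.rpow_le_rpow_of_nonpos (mul_pos hδ hcos) h1 hp
  have h3 : 0 ≤ ‖conePoint a x y‖ ^ p := Real.rpow_nonneg (norm_nonneg _) _
  nlinarith [norm_nonneg c]

end Harmonic

/-! ### Second order expansion in the coordinates of the quadrant. -/

noncomputable section Harmonic

open Set Filter Topology Complex

/-- First order coefficient of `coneHarmonic` in the first variable. -/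
def coefX (a : ℝ) : ℝ → ℝ → ℝ := coneCoeff a (a - 1) (a * exp (-(halfAngle a) * I))

/-- First order coefficient of `coneHarmonic` in the second variable. -/
def coefY (a : ℝ) : ℝ → ℝ → ℝ := coneCoeff a (a - 1) (a * exp (halfAngle a * I))

/-- Second order coefficient of `coneHarmonic` in the first variable. -/
def coefXX (a : ℝ) : ℝ → ℝ → ℝ :=
  coneCoeff a (a - 2) (a * (a - 1) / 2 * exp (-(halfAngle a) * I) ^ 2)

/-- Mixed second order coefficient of `coneHarmonic`. -/
def coefXY (a : ℝ) : ℝ → ℝ → ℝ := coneCoeff a (a - 2) (a * (a - 1))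

/-- Second order coefficient of `coneHarmonic` in the second variable. -/
def coefYY (a : ℝ) : ℝ → ℝ → ℝ :=
  coneCoeff a (a - 2) (a * (a - 1) / 2 * exp (halfAngle a * I) ^ 2)

/-- Harmonicity in the correlated coordinates: for unit variances and correlation `-cos (2θ)` the
generator multiplies `w ^ (a - 2)` by a multiple of `exp (-2iθ) + exp (2iθ) - 2 * cos (2θ) = 0`. -/
theorem coef_harmonic (a x y : ℝ) :
    coefXX a x y + (-Real.cos (2 * halfAngle a)) * coefXY a x y + coefYY a x y = 0 := by
  have h1 : exp (-(halfAngle a) * I) ^ 2 + exp (halfAngle a * I) ^ 2 =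
      ((2 * Real.cos (2 * halfAngle a) : ℝ) : ℂ) := by
    rw [← exp_nat_mul, ← exp_nat_mul]
    push_cast
    rw [Complex.cos]
    ring_nf
  simp only [coefXX, coefXY, coefYY, coneCoeff]
  set W := conePoint a x y ^ ((a - 2 : ℝ) : ℂ)
  rw [← re_ofReal_mul, ← add_re, ← add_re]
  have : (a * (a - 1) / 2 * exp (-(halfAngle a) * I) ^ 2 * W +
      ((-Real.cos (2 * halfAngle a) : ℝ) : ℂ) * (a * (a - 1) * W) +
      a * (a - 1) / 2 * exp (halfAngle a * I) ^ 2 * W) =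
      a * (a - 1) / 2 * W * (exp (-(halfAngle a) * I) ^ 2 + exp (halfAngle a * I) ^ 2 -
        ((2 * Real.cos (2 * halfAngle a) : ℝ) : ℂ)) := by
    push_cast
    ring
  rw [this, h1]
  simp

theorem abs_coef_le {a δ : ℝ} (ha : 0 < a) (ha1 : a < 1) (hδ : 0 < δ) :
    ∃ K, 0 ≤ K ∧ ∀ x y, δ ≤ x + y → |coefX a x y| ≤ K ∧ |coefY a x y| ≤ K ∧ |coefXX a x y| ≤ K ∧
      |coefXY a x y| ≤ K ∧ |coefYY a x y| ≤ K := by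
  have hcos := cos_halfAngle_pos ha1
  have hp : 0 < δ * Real.cos (halfAngle a) := mul_pos hδ hcos
  have h1 : 0 < (δ * Real.cos (halfAngle a)) ^ (a - 1) := Real.rpow_pos_of_pos hp _
  have h2 : 0 < (δ * Real.cos (halfAngle a)) ^ (a - 2) := Real.rpow_pos_of_pos hp _
  refine ⟨(δ * Real.cos (halfAngle a)) ^ (a - 1) + (δ * Real.cos (halfAngle a)) ^ (a - 2),
    by positivity, fun x y hxy => ?_⟩
  have na : ‖(a : ℂ)‖ ≤ 1 := by
    rw [norm_real, Real.norm_eq_abs, abs_of_pos ha]; exact ha1.le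
  have na1 : ‖(a : ℂ) - 1‖ ≤ 1 := by
    rw [show (a : ℂ) - 1 = ((a - 1 : ℝ) : ℂ) by push_cast; ring, norm_real, Real.norm_eq_abs,
      abs_of_neg (by linarith)]
    linarith
  have na2 : ‖(a : ℂ) * (a - 1)‖ ≤ 1 := by
    rw [norm_mul]; exact mul_le_one₀ na (norm_nonneg _) na1
  have na3 : ‖(a : ℂ) * (a - 1) / 2‖ ≤ 1 := by
    rw [norm_div, div_le_one (by simp)]
    simp only [Complex.norm_ofNat]
    linarith
  refine ⟨?_, ?_, ?_, ?_, ?_⟩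
  · refine (abs_coneCoeff_le ha1 (by linarith) hδ _ ?_ hxy).trans (by linarith)
    rw [norm_mul, norm_exp_neg_halfAngle, mul_one]; exact na
  · refine (abs_coneCoeff_le ha1 (by linarith) hδ _ ?_ hxy).trans (by linarith)
    rw [norm_mul, norm_exp_halfAngle, mul_one]; exact na
  · refine (abs_coneCoeff_le ha1 (by linarith) hδ _ ?_ hxy).trans (by linarith)
    rw [norm_mul, norm_pow, norm_exp_neg_halfAngle, one_pow, mul_one]; exact na3
  · exact (abs_coneCoeff_le ha1 (by linarith) hδ _ na2 hxy).trans (by linarith)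
  · refine (abs_coneCoeff_le ha1 (by linarith) hδ _ ?_ hxy).trans (by linarith)
    rw [norm_mul, norm_pow, norm_exp_halfAngle, one_pow, mul_one]; exact na3

/-- The quadratic part of the expansion of `coneHarmonic`. -/
def coneTaylor (a x y p q : ℝ) : ℝ :=
  coefX a x y * p + coefY a x y * q + coefXX a x y * p ^ 2 + coefXY a x y * (p * q) +
    coefYY a x y * q ^ 2

theorem coneHarmonic_le_taylor {a x y p q c : ℝ} (ha : 0 < a) (ha1 : a < 1) (hc : 0 < c)
    (hxy : c ≤ x + y) (hpq : c ≤ x + p + (y + q)) :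
    coneHarmonic a (x + p) (y + q) ≤ coneHarmonic a x y + coneTaylor a x y p q +
      2 * (c * Real.cos (halfAngle a)) ^ (a - 3) * (|p| + |q|) ^ 3 := by
  have hcos := cos_halfAngle_pos ha1
  set w := conePoint a x y with hw
  set w' := conePoint a (x + p) (y + q) with hw'
  have hdiff : w' - w = p * exp (-(halfAngle a) * I) + q * exp (halfAngle a * I) := by
    rw [hw, hw', conePoint, conePoint]
    push_cast
    ring
  have hn : ‖w' - w‖ ≤ |p| + |q| := by
    have := norm_conePoint_le a p q
    rwa [conePoint, ← hdiff] at this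
  have h1 := (norm_cpow_sub_taylor_le ha ha1 (mul_pos hc hcos)
    (w := w) (w' := w')
    (by rw [hw, conePoint_re]; exact mul_le_mul_of_nonneg_right hxy hcos.le)
    (by rw [hw', conePoint_re]; exact mul_le_mul_of_nonneg_right hpq hcos.le)).1
  have h2 := (re_le_norm _).trans h1
  have e1 : (a * w ^ ((a - 1 : ℝ) : ℂ) * (w' - w)).re = coefX a x y * p + coefY a x y * q := by
    rw [hdiff]
    simp only [coefX, coefY, coneCoeff]
    rw [← hw, mul_comm _ p, mul_comm _ q, ← re_ofReal_mul, ← re_ofReal_mul, ← add_re]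
    congr 1
    ring
  have hef : exp (-(halfAngle a) * I) * exp (halfAngle a * I) = 1 := by
    rw [← exp_add]; simp
  have e2 : (a * (a - 1) / 2 * w ^ ((a - 2 : ℝ) : ℂ) * (w' - w) ^ 2).re =
      coefXX a x y * p ^ 2 + coefXY a x y * (p * q) + coefYY a x y * q ^ 2 := by
    rw [hdiff]
    simp only [coefXX, coefXY, coefYY, coneCoeff]
    rw [← hw, mul_comm _ (p ^ 2), mul_comm _ (p * q), mul_comm _ (q ^ 2), ← re_ofReal_mul,
      ← re_ofReal_mul, ← re_ofReal_mul, ← add_re, ← add_re]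
    congr 1
    push_cast
    linear_combination (a * (a - 1) * w ^ ((a : ℂ) - 2) * p * q) * hef
  rw [sub_re, sub_re, sub_re, e1, e2] at h2
  have h3 : ‖w' - w‖ ^ 3 ≤ (|p| + |q|) ^ 3 := pow_le_pow_left₀ (norm_nonneg _) hn 3
  have h4 : 0 < (c * Real.cos (halfAngle a)) ^ (a - 3) := Real.rpow_pos_of_pos (mul_pos hc hcos) _
  have h5 := mul_le_mul_of_nonneg_left h3 (by positivity :
    0 ≤ 2 * (c * Real.cos (halfAngle a)) ^ (a - 3))
  simp only [coneHarmonic, coneTaylor]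
  linarith

/-- The coefficient vanishes on the side `x = 0` by the reflection condition and is Lipschitz away
from the corner. A push in the first coordinate occurs only near that side, so its first order
effect is negligible. -/
theorem abs_coefX_le {a x y c : ℝ} (ha : 0 < a) (ha1 : a < 1) (hc : 0 < c) (hx : 0 ≤ x)
    (hy : c ≤ y) : |coefX a x y| ≤ (c * Real.cos (halfAngle a)) ^ (a - 2) * x := by
  have hcos := cos_halfAngle_pos ha1
  have h0 := (re_cpow_mul_exp_eq_zero (a := a) ha1 (hc.trans_le hy)).1
  set w := conePoint a x y with hw
  set w₀ : ℂ := y * exp (halfAngle a * I) with hw₀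
  have hw₀' : w₀ = conePoint a 0 y := by simp [conePoint, hw₀]
  have h1 := (norm_cpow_sub_taylor_le ha ha1 (mul_pos hc hcos) (w := w₀) (w' := w)
    (by rw [hw₀', conePoint_re]; exact mul_le_mul_of_nonneg_right (by linarith) hcos.le)
    (by rw [hw, conePoint_re]; exact mul_le_mul_of_nonneg_right (by linarith) hcos.le)).2
  have hd : ‖w - w₀‖ = x := by
    rw [hw, hw₀, conePoint, add_sub_cancel_right, norm_mul, norm_exp_neg_halfAngle, norm_real,
      mul_one, Real.norm_eq_abs, abs_of_nonneg hx]
  rw [hd] at h1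
  have e : coefX a x y = (a * ((w ^ ((a - 1 : ℝ) : ℂ) - w₀ ^ ((a - 1 : ℝ) : ℂ)) *
      exp (-(halfAngle a) * I))).re := by
    rw [re_ofReal_mul, sub_mul, sub_re, h0, sub_zero, ← re_ofReal_mul, coefX, coneCoeff, ← hw]
    congr 1
    ring
  rw [e]
  refine (abs_re_le_norm _).trans ?_
  rw [norm_mul, norm_mul, norm_exp_neg_halfAngle, mul_one, norm_real, Real.norm_eq_abs,
    abs_of_pos ha]
  nlinarith [norm_nonneg (w ^ ((a - 1 : ℝ) : ℂ) - w₀ ^ ((a - 1 : ℝ) : ℂ))]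

theorem abs_coefY_le {a x y c : ℝ} (ha : 0 < a) (ha1 : a < 1) (hc : 0 < c) (hx : c ≤ x)
    (hy : 0 ≤ y) : |coefY a x y| ≤ (c * Real.cos (halfAngle a)) ^ (a - 2) * y := by
  have hcos := cos_halfAngle_pos ha1
  have h0 := (re_cpow_mul_exp_eq_zero (a := a) ha1 (hc.trans_le hx)).2
  set w := conePoint a x y with hw
  set w₀ : ℂ := x * exp (-(halfAngle a) * I) with hw₀
  have hw₀' : w₀ = conePoint a x 0 := by simp [conePoint, hw₀]
  have h1 := (norm_cpow_sub_taylor_le ha ha1 (mul_pos hc hcos) (w := w₀) (w' := w)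
    (by rw [hw₀', conePoint_re]; exact mul_le_mul_of_nonneg_right (by linarith) hcos.le)
    (by rw [hw, conePoint_re]; exact mul_le_mul_of_nonneg_right (by linarith) hcos.le)).2
  have hd : ‖w - w₀‖ = y := by
    rw [hw, hw₀, conePoint, add_sub_cancel_left, norm_mul, norm_exp_halfAngle, norm_real,
      mul_one, Real.norm_eq_abs, abs_of_nonneg hy]
  rw [hd] at h1
  have e : coefY a x y = (a * ((w ^ ((a - 1 : ℝ) : ℂ) - w₀ ^ ((a - 1 : ℝ) : ℂ)) *
      exp (halfAngle a * I))).re := by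
    rw [re_ofReal_mul, sub_mul, sub_re, h0, sub_zero, ← re_ofReal_mul, coefY, coneCoeff, ← hw]
    congr 1
    ring
  rw [e]
  refine (abs_re_le_norm _).trans ?_
  rw [norm_mul, norm_mul, norm_exp_halfAngle, mul_one, norm_real, Real.norm_eq_abs,
    abs_of_pos ha]
  nlinarith [norm_nonneg (w ^ ((a - 1 : ℝ) : ℂ) - w₀ ^ ((a - 1 : ℝ) : ℂ))]

end Harmonic

/-! ### Effect of one reflected step on the harmonic function. -/

noncomputable section Harmonic

open Set

theorem mul_le_of_abs_le {u v M N : ℝ} (hu : |u| ≤ M) (hv : |v| ≤ N) : u * v ≤ M * N :=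
  (le_abs_self _).trans (by
    rw [abs_mul]
    exact mul_le_mul hu hv (abs_nonneg _) ((abs_nonneg _).trans hu))

theorem abs_two_mul_add_sq_le {D l m : ℝ} (hD : |D| ≤ m) (hl : 0 ≤ l) (hlm : l ≤ m) :
    |2 * D * l + l ^ 2| ≤ 3 * (m * l) := by
  have h1 : |2 * D * l| ≤ 2 * (m * l) := by
    rw [abs_mul, abs_mul, abs_two, abs_of_nonneg hl, mul_assoc]
    exact mul_le_mul_of_nonneg_left (mul_le_mul_of_nonneg_right hD hl) zero_le_two
  have h2 : |l ^ 2| ≤ m * l := by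
    rw [abs_of_nonneg (by positivity), sq]
    exact mul_le_mul_of_nonneg_right hlm hl
  have := abs_add_le (2 * D * l) (l ^ 2)
  linarith

theorem abs_cross_le {D₁ D₂ l₁ l₂ m : ℝ} (hD₁ : |D₁| ≤ m) (hD₂ : |D₂| ≤ m) (hl₁ : 0 ≤ l₁)
    (hl₂ : 0 ≤ l₂) (hl₁m : l₁ ≤ m) :
    |D₁ * l₂ + l₁ * D₂ + l₁ * l₂| ≤ 2 * (m * (l₁ + l₂)) := by
  have e1 : |D₁ * l₂| ≤ m * l₂ := by
    rw [abs_mul, abs_of_nonneg hl₂]; exact mul_le_mul_of_nonneg_right hD₁ hl₂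
  have e2 : |l₁ * D₂| ≤ m * l₁ := by
    rw [abs_mul, abs_of_nonneg hl₁, mul_comm]; exact mul_le_mul_of_nonneg_right hD₂ hl₁
  have e3 : |l₁ * l₂| ≤ m * l₂ := by
    rw [abs_of_nonneg (by positivity)]; exact mul_le_mul_of_nonneg_right hl₁m hl₂
  have h3 := abs_add_three (D₁ * l₂) (l₁ * D₂) (l₁ * l₂)
  have h4 : 0 ≤ m * l₁ := mul_nonneg ((abs_nonneg _).trans hD₁) hl₁
  rw [mul_add]
  linarith

/-- Small displacement, `m < δ/4`: both endpoints keep coordinate sum at least `δ/2`, so Taylor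
applies. If the first coordinate is pushed, then `x ≤ m` forces `y ≥ δ/2`, and the bound on `coefX`
near its side is available; likewise for the second. -/
theorem coneHarmonic_step_le_of_lt {a δ c M M₂ M₃ x y D₁ D₂ l₁ l₂ m : ℝ} (ha : 0 < a) (ha1 : a < 1)
    (hc : c = δ / 2) (hc0 : 0 < c) (hM₂ : M₂ = (c * Real.cos (halfAngle a)) ^ (a - 2))
    (hM₃ : M₃ = (c * Real.cos (halfAngle a)) ^ (a - 3)) (hM₂0 : 0 < M₂) (hM₃0 : 0 < M₃)
    (hM0 : 0 ≤ M) (hB₁₁ : |coefXX a x y| ≤ M) (hB₁₂ : |coefXY a x y| ≤ M)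
    (hB₂₂ : |coefYY a x y| ≤ M) (hx : 0 ≤ x) (hy : 0 ≤ y) (hxy : δ ≤ x + y) (hD₁ : |D₁| ≤ m)
    (hD₂ : |D₂| ≤ m) (hl₁ : 0 ≤ l₁) (hl₂ : 0 ≤ l₂) (hl₁m : l₁ ≤ m) (hl₂m : l₂ ≤ m)
    (hxm : 0 < l₁ → x ≤ m) (hym : 0 < l₂ → y ≤ m) (hlt : m < δ / 4) :
    coneHarmonic a (x + D₁ + l₁) (y + D₂ + l₂) ≤ coneHarmonic a x y + coneTaylor a x y D₁ D₂ +
      ((M₂ + 6 * M) * (m * (l₁ + l₂)) + 128 * M₃ * m ^ 3) := by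
  have hm0 : 0 ≤ m := (abs_nonneg _).trans hD₁
  have hD₁' := abs_le.1 hD₁
  have hD₂' := abs_le.1 hD₂
  have hT := coneHarmonic_le_taylor (x := x) (y := y) (p := D₁ + l₁) (q := D₂ + l₂) ha ha1 hc0
    (by rw [hc]; linarith) (by rw [hc]; linarith)
  rw [← add_assoc, ← add_assoc, ← hM₃] at hT
  have hp : |D₁ + l₁| ≤ 2 * m := abs_le.2 ⟨by linarith, by linarith⟩
  have hq : |D₂ + l₂| ≤ 2 * m := abs_le.2 ⟨by linarith, by linarith⟩
  have h3 : (|D₁ + l₁| + |D₂ + l₂|) ^ 3 ≤ (4 * m) ^ 3 :=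
    pow_le_pow_left₀ (by positivity) (by linarith) 3
  have hcube : 2 * M₃ * (|D₁ + l₁| + |D₂ + l₂|) ^ 3 ≤ 128 * M₃ * m ^ 3 := by
    calc _ ≤ 2 * M₃ * (4 * m) ^ 3 := mul_le_mul_of_nonneg_left h3 (by positivity)
      _ = _ := by ring
  have hX : coefX a x y * l₁ ≤ M₂ * (m * l₁) := by
    rcases hl₁.eq_or_lt with h | h
    · rw [← h]; simp
    · have hxm' := hxm h
      have := abs_coefX_le ha ha1 hc0 hx (y := y) (by rw [hc]; linarith)
      rw [← hM₂] at this
      have h2 : |coefX a x y| ≤ M₂ * m :=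
        this.trans (mul_le_mul_of_nonneg_left hxm' hM₂0.le)
      calc _ ≤ M₂ * m * l₁ := mul_le_mul_of_nonneg_right ((le_abs_self _).trans h2) hl₁
        _ = _ := by ring
  have hY : coefY a x y * l₂ ≤ M₂ * (m * l₂) := by
    rcases hl₂.eq_or_lt with h | h
    · rw [← h]; simp
    · have hym' := hym h
      have := abs_coefY_le ha ha1 hc0 (x := x) (by rw [hc]; linarith) hy
      rw [← hM₂] at this
      have h2 : |coefY a x y| ≤ M₂ * m :=
        this.trans (mul_le_mul_of_nonneg_left hym' hM₂0.le)
      calc _ ≤ M₂ * m * l₂ := mul_le_mul_of_nonneg_right ((le_abs_self _).trans h2) hl₂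
        _ = _ := by ring
  have hXX := mul_le_of_abs_le hB₁₁ (abs_two_mul_add_sq_le hD₁ hl₁ hl₁m)
  have hYY := mul_le_of_abs_le hB₂₂ (abs_two_mul_add_sq_le hD₂ hl₂ hl₂m)
  have hXY := mul_le_of_abs_le hB₁₂ (abs_cross_le hD₁ hD₂ hl₁ hl₂ hl₁m)
  have hTay : coneTaylor a x y (D₁ + l₁) (D₂ + l₂) ≤ coneTaylor a x y D₁ D₂ +
      (M₂ + 6 * M) * (m * (l₁ + l₂)) := by
    have e : coneTaylor a x y (D₁ + l₁) (D₂ + l₂) = coneTaylor a x y D₁ D₂ +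
        (coefX a x y * l₁ + coefY a x y * l₂ + coefXX a x y * (2 * D₁ * l₁ + l₁ ^ 2) +
          coefXY a x y * (D₁ * l₂ + l₁ * D₂ + l₁ * l₂) +
          coefYY a x y * (2 * D₂ * l₂ + l₂ ^ 2)) := by
      simp only [coneTaylor]; ring
    have e' : (M₂ + 6 * M) * (m * (l₁ + l₂)) = M₂ * (m * l₁) + M₂ * (m * l₂) +
        M * (3 * (m * l₁)) + M * (3 * (m * l₂)) + M * (2 * (m * (l₁ + l₂))) +
        M * (m * (l₁ + l₂)) := by ring
    have e'' : 0 ≤ M * (m * (l₁ + l₂)) := by positivity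
    rw [e, e']
    linarith
  linarith

/-- Large displacement: `1 ≤ e * m` with `e = 4 / δ` absorbs every lower power of `m` into `m ^ 3`,
so crude linear growth of the function is enough. -/
theorem coneHarmonic_step_le_of_ge {a e K₂ M x y D₁ D₂ l₁ l₂ m : ℝ} (ha : 0 < a)
    (ha1 : a < 1) (he0 : 0 < e) (hK₂ : K₂ = e ^ 3 + (4 + 2 * M) * e ^ 2 + 3 * M * e)
    (hM0 : 0 ≤ M) (hA₁ : |coefX a x y| ≤ M) (hA₂ : |coefY a x y| ≤ M)
    (hB₁₁ : |coefXX a x y| ≤ M) (hB₁₂ : |coefXY a x y| ≤ M) (hB₂₂ : |coefYY a x y| ≤ M)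
    (hx : 0 ≤ x) (hy : 0 ≤ y) (hD₁ : |D₁| ≤ m) (hD₂ : |D₂| ≤ m) (hl₁m : l₁ ≤ m) (hl₂m : l₂ ≤ m)
    (hx' : 0 ≤ x + D₁ + l₁) (hy' : 0 ≤ y + D₂ + l₂) (hem : 1 ≤ e * m) :
    coneHarmonic a (x + D₁ + l₁) (y + D₂ + l₂) ≤ coneHarmonic a x y + coneTaylor a x y D₁ D₂ +
      K₂ * ((1 + x + y) * m ^ 3) := by
  have hm0 : 0 ≤ m := (abs_nonneg _).trans hD₁
  have hm3 : 0 ≤ m ^ 3 := by positivity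
  have hD₁' := abs_le.1 hD₁
  have hD₂' := abs_le.1 hD₂
  have p1 : m ^ 2 ≤ e * m ^ 3 := by
    calc m ^ 2 = 1 * m ^ 2 := (one_mul _).symm
      _ ≤ e * m * m ^ 2 := mul_le_mul_of_nonneg_right hem (by positivity)
      _ = _ := by ring
  have p2 : m ≤ e ^ 2 * m ^ 3 := by
    calc m = 1 * m := (one_mul _).symm
      _ ≤ (e * m) ^ 2 * m := mul_le_mul_of_nonneg_right (one_le_pow₀ hem) hm0
      _ = _ := by ring
  have p3 : 1 ≤ e ^ 3 * m ^ 3 := by rw [← mul_pow]; exact one_le_pow₀ hem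
  have hup : coneHarmonic a (x + D₁ + l₁) (y + D₂ + l₂) ≤ 1 + (x + y + 4 * m) := by
    refine (coneHarmonic_le ha hx' hy').trans ?_
    set z := x + D₁ + l₁ + (y + D₂ + l₂) with hz
    have hz0 : 0 ≤ z := by linarith
    have hz1 : z ≤ x + y + 4 * m := by linarith
    rcases le_total z 1 with h | h
    · have := Real.rpow_le_one hz0 h ha.le
      linarith
    · have := Real.rpow_le_rpow_of_exponent_le h ha1.le
      rw [Real.rpow_one] at this
      linarith
  have hlow := coneHarmonic_nonneg ha ha1 hx hy
  have habs : |D₁ * D₂| ≤ m * m := by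
    rw [abs_mul]; exact mul_le_mul hD₁ hD₂ (abs_nonneg _) hm0
  have q1 : |D₁ ^ 2| ≤ m ^ 2 := by
    rw [abs_pow]; exact pow_le_pow_left₀ (abs_nonneg _) hD₁ 2
  have q2 : |D₂ ^ 2| ≤ m ^ 2 := by
    rw [abs_pow]; exact pow_le_pow_left₀ (abs_nonneg _) hD₂ 2
  have hTay : -(2 * M * m + 3 * M * m ^ 2) ≤ coneTaylor a x y D₁ D₂ := by
    have n : ∀ {u v N : ℝ}, |u| ≤ M → |v| ≤ N → -(M * N) ≤ u * v := by
      intro u v N hu hv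
      have := mul_le_of_abs_le (u := -u) (M := M) (by rwa [abs_neg]) hv
      linarith
    have r1 := n hA₁ hD₁
    have r2 := n hA₂ hD₂
    have r3 := n hB₁₁ q1
    have r4 := n hB₁₂ habs
    have r5 := n hB₂₂ q2
    simp only [coneTaylor]
    linarith [mul_comm M m]
  have hK : 1 + (x + y + 4 * m) + 2 * M * m + 3 * M * m ^ 2 ≤ K₂ * ((1 + x + y) * m ^ 3) := by
    have t1 : (1 + x + y) * 1 ≤ (1 + x + y) * (e ^ 3 * m ^ 3) :=
      mul_le_mul_of_nonneg_left p3 (by linarith)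
    have t2 : (4 + 2 * M) * m ≤ (4 + 2 * M) * (e ^ 2 * m ^ 3) :=
      mul_le_mul_of_nonneg_left p2 (by linarith)
    have t3 : 3 * M * m ^ 2 ≤ 3 * M * (e * m ^ 3) :=
      mul_le_mul_of_nonneg_left p1 (by linarith)
    have t4 : ((4 + 2 * M) * e ^ 2 + 3 * M * e) * m ^ 3 ≤
        ((4 + 2 * M) * e ^ 2 + 3 * M * e) * ((1 + x + y) * m ^ 3) := by
      refine mul_le_mul_of_nonneg_left ?_ (by positivity)
      exact le_mul_of_one_le_left hm3 (by linarith)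
    have t5 : K₂ * ((1 + x + y) * m ^ 3) = (1 + x + y) * (e ^ 3 * m ^ 3) +
        ((4 + 2 * M) * e ^ 2 + 3 * M * e) * ((1 + x + y) * m ^ 3) := by
      rw [hK₂]; ring
    rw [t5]
    linarith
  linarith

/-- The effect on `coneHarmonic` of one step of a reflected path that is away from the corner:
`(D₁, D₂)` is the increment of the free path, `(l₁, l₂)` is the push, and `m` bounds the
displacement during the step. -/
theorem exists_coneHarmonic_step_le {a δ : ℝ} (ha : 0 < a) (ha1 : a < 1) (hδ : 0 < δ) :
    ∃ K, 0 ≤ K ∧ ∀ x y D₁ D₂ l₁ l₂ m : ℝ, 0 ≤ x → 0 ≤ y → δ ≤ x + y → |D₁| ≤ m → |D₂| ≤ m →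
      0 ≤ l₁ → 0 ≤ l₂ → l₁ ≤ m → l₂ ≤ m → (0 < l₁ → x ≤ m) → (0 < l₂ → y ≤ m) →
      0 ≤ x + D₁ + l₁ → 0 ≤ y + D₂ + l₂ →
      coneHarmonic a (x + D₁ + l₁) (y + D₂ + l₂) ≤
        coneHarmonic a x y + coneTaylor a x y D₁ D₂ +
          K * (m * (l₁ + l₂) + (1 + x + y) * m ^ 3) := by
  obtain ⟨M, hM0, hM⟩ := abs_coef_le ha ha1 hδ
  have hcos := cos_halfAngle_pos ha1
  set c := δ / 2 with hc
  have hc0 : 0 < c := by positivity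
  have hcc := mul_pos hc0 hcos
  set M₂ := (c * Real.cos (halfAngle a)) ^ (a - 2) with hM₂
  set M₃ := (c * Real.cos (halfAngle a)) ^ (a - 3) with hM₃
  have hM₂0 : 0 < M₂ := Real.rpow_pos_of_pos hcc _
  have hM₃0 : 0 < M₃ := Real.rpow_pos_of_pos hcc _
  set K₁ := M₂ + 6 * M + 128 * M₃ with hK₁
  set e := 4 / δ with he
  have he0 : 0 < e := by positivity
  set K₂ := e ^ 3 + (4 + 2 * M) * e ^ 2 + 3 * M * e with hK₂
  have hK₁0 : 0 ≤ K₁ := by positivity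
  have hK₂0 : 0 ≤ K₂ := by positivity
  refine ⟨K₁ + K₂, by positivity, ?_⟩
  intro x y D₁ D₂ l₁ l₂ m hx hy hxy hD₁ hD₂ hl₁ hl₂ hl₁m hl₂m hxm hym hx' hy'
  have hm0 : 0 ≤ m := (abs_nonneg _).trans hD₁
  obtain ⟨hA₁, hA₂, hB₁₁, hB₁₂, hB₂₂⟩ := hM x y hxy
  have hm3 : 0 ≤ m ^ 3 := by positivity
  have hml : 0 ≤ m * (l₁ + l₂) := by positivity
  have hE : 0 ≤ m * (l₁ + l₂) + (1 + x + y) * m ^ 3 := by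
    have : 0 ≤ (1 + x + y) * m ^ 3 := by positivity
    linarith
  rcases lt_or_ge m (δ / 4) with hlt | hge
  · refine (coneHarmonic_step_le_of_lt ha ha1 hc hc0 hM₂ hM₃ hM₂0 hM₃0 hM0 hB₁₁ hB₁₂ hB₂₂ hx hy hxy
      hD₁ hD₂ hl₁ hl₂ hl₁m hl₂m hxm hym hlt).trans (add_le_add_right ?_ _)
    have h1 : (K₁ + K₂) * (m * (l₁ + l₂) + (1 + x + y) * m ^ 3) ≥
        K₁ * (m * (l₁ + l₂) + (1 + x + y) * m ^ 3) :=
      mul_le_mul_of_nonneg_right (by linarith) hE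
    have h2 : K₁ * (m * (l₁ + l₂)) ≥ (M₂ + 6 * M) * (m * (l₁ + l₂)) :=
      mul_le_mul_of_nonneg_right (by linarith) hml
    have h3 : K₁ * ((1 + x + y) * m ^ 3) ≥ 128 * M₃ * m ^ 3 :=
      mul_le_mul (by linarith) (le_mul_of_one_le_left hm3 (by linarith)) hm3 hK₁0
    linarith
  · have hem : 1 ≤ e * m := by
      rw [he, div_mul_eq_mul_div, le_div_iff₀ hδ]; linarith
    refine (coneHarmonic_step_le_of_ge ha ha1 he0 hK₂ hM0 hA₁ hA₂ hB₁₁ hB₁₂ hB₂₂ hx hy hD₁ hD₂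
      hl₁m hl₂m hx' hy' hem).trans (add_le_add_right ?_ _)
    exact mul_le_mul (by linarith) (by linarith) (by positivity) (by positivity)

end Harmonic

/-! ### Adaptedness and integrability along the reflected process. -/

noncomputable section Supermartingale

open Set Filter Topology

/-- The reflected value depends only on the increments `L u - L t`, so it is measurable for
σ-algebras generated by increments. -/
theorem measurable_reflected_left {Ω : Type*} {L R : ℝ → Ω → ℝ} {S : Set ℝ} {s t v : ℝ}
    (hc : ∀ ω, Continuous fun t => L t ω) (hst : s ≤ t) (hS : Icc s t ⊆ S) :
    Measurable[incrSigma L R S v] fun ω => reflected (fun u => L u ω) s t := by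
  have h1 : (fun ω => reflected (fun u => L u ω) s t) =
      fun ω => -segInf (fun u => L u ω - L t ω) s t := by
    funext ω
    rw [segInf_sub_const (hc ω) hst, reflected]
    ring
  rw [h1]
  refine Measurable.neg (measurable_segInf (F := fun u ω => L u ω - L t ω) (fun ω => ?_) hst
    fun u hu => ?_)
  · have := hc ω
    fun_prop
  · exact measurable_incrSigma_left' (hS hu) (hS (right_mem_Icc.2 hst))

theorem measurable_reflected_right {Ω : Type*} {L R : ℝ → Ω → ℝ} {S : Set ℝ} {s t v : ℝ}
    (hc : ∀ ω, Continuous fun t => R t ω) (hst : s ≤ t) (hS : Icc s t ⊆ S) :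
    Measurable[incrSigma L R S v] fun ω => reflected (fun u => R u ω) s t := by
  rw [← incrSigma_swap]
  exact measurable_reflected_left hc hst hS

theorem incrSigma_mono_Iic {Ω : Type*} {L R : ℝ → Ω → ℝ} {s s' : ℝ} (h : s ≤ s') :
    incrSigma L R (Iic s) s ≤ incrSigma L R (Iic s') s' :=
  incrSigma_le (fun _ hu => measurable_incrSigma_left' (le_trans (mem_Iic.1 hu) h) h)
    fun _ hu => measurable_incrSigma_right' (le_trans (mem_Iic.1 hu) h) h

/-- This separates the two errors of a step: pushes add up to a bounded total, which `η` makes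
small, while the cubes sum to a quantity that vanishes with the mesh. -/
theorem mul_push_le {m l η : ℝ} (hη : 0 < η) (hl : 0 ≤ l) (hlm : l ≤ m) :
    m * l ≤ η * l + m ^ 3 / η := by
  rcases le_total m η with h | h
  · have : 0 ≤ m ^ 3 / η := by have := hl.trans hlm; positivity
    nlinarith
  · have hm : 0 ≤ m := hl.trans hlm
    have h1 : m * l ≤ m ^ 3 / η := by
      rw [le_div_iff₀ hη]
      calc m * l * η ≤ m * m * m := by gcongr
        _ = m ^ 3 := by ring
    have : 0 ≤ η * l := by positivity
    linarith

theorem add_pow_three_le {x y : ℝ} (hx : 0 ≤ x) (hy : 0 ≤ y) :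
    (x + y) ^ 3 ≤ 4 * (x ^ 3 + y ^ 3) := by
  nlinarith [mul_nonneg (add_nonneg hx hy) (sq_nonneg (x - y))]

namespace IsPlanarBM

variable {Ω : Type*} [MeasurableSpace Ω] {P : Measure Ω} {ρ : ℝ} {L R : ℝ → Ω → ℝ}

theorem integral_mul_past_future (h : IsPlanarBM ρ L R P) {s : ℝ} {U V : Ω → ℝ}
    (hU : Measurable[incrSigma L R (Iic s) s] U) (hV : Measurable[incrSigma L R (Ici s) s] V)
    (iU : Integrable U P) (iV : Integrable V P) :
    Integrable (fun ω => U ω * V ω) P ∧ ∫ ω, U ω * V ω ∂P = (∫ ω, U ω ∂P) * ∫ ω, V ω ∂P := by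
  have hi := h.indepFun s hU hV
  exact ⟨hi.integrable_mul iU iV, hi.integral_fun_mul_eq_mul_integral iU.1 iV.1⟩

theorem integrable_reflected (h : IsPlanarBM ρ L R P) [IsProbabilityMeasure P] {s t : ℝ}
    (hst : s < t) :
    Integrable (fun ω => reflected (fun u => L u ω) s t) P ∧
      ∫ ω, reflected (fun u => L u ω) s t ∂P ≤ 4 * oscConst * √(t - s) := by
  obtain ⟨h1, h2⟩ := h.integrable_osc hst
  have hm : Measurable fun ω => reflected (fun u => L u ω) s t :=
    (measurable_reflected_left (R := R) (v := s) h.contL hst.le (subset_univ _)).mono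
      h.incrSigma_le' le_rfl
  have hi : Integrable (fun ω => reflected (fun u => L u ω) s t) P := by
    refine (h1.const_mul 2).mono' hm.aestronglyMeasurable (Eventually.of_forall fun ω => ?_)
    rw [Real.norm_eq_abs, abs_of_nonneg (reflected_nonneg (h.contL ω) hst.le)]
    exact reflected_le_osc (h.contL ω) hst.le
  refine ⟨hi, ?_⟩
  calc _ ≤ ∫ ω, 2 * osc (fun u => L u ω) s t ∂P :=
        integral_mono hi (h1.const_mul 2) fun ω => reflected_le_osc (h.contL ω) hst.le
    _ ≤ _ := by rw [integral_const_mul]; linarith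

theorem integrable_push (h : IsPlanarBM ρ L R P) [IsProbabilityMeasure P] {s t t' : ℝ}
    (hst : s ≤ t) (ht : t < t') :
    Integrable (fun ω => push (fun u => L u ω) s t t') P ∧
      ∫ ω, push (fun u => L u ω) s t t' ∂P ≤ 2 * oscConst * √(t' - t) := by
  obtain ⟨h1, h2⟩ := h.integrable_osc ht
  have hm : Measurable fun ω => push (fun u => L u ω) s t t' := by
    refine Measurable.sub ?_ ?_
    · exact measurable_segInf h.contL hst fun u _ => h.measL u
    · exact measurable_segInf h.contL (hst.trans ht.le) fun u _ => h.measL u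
  have hi : Integrable (fun ω => push (fun u => L u ω) s t t') P := by
    refine h1.mono' hm.aestronglyMeasurable (Eventually.of_forall fun ω => ?_)
    rw [Real.norm_eq_abs, abs_of_nonneg (push_nonneg (h.contL ω) hst ht.le)]
    exact (push_le_osc (h.contL ω) hst ht.le).1
  exact ⟨hi, (integral_mono hi h1 fun ω => (push_le_osc (h.contL ω) hst ht.le).1).trans h2⟩

/-- The sum of the two coordinates at time `u` of the process reflected from time `t` on. -/
def cornerSum (L R : ℝ → Ω → ℝ) (t u : ℝ) (ω : Ω) : ℝ :=
  reflected (fun v => L v ω) t u + reflected (fun v => R v ω) t u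

/-- `coneHarmonic` evaluated along the reflected process. -/
def harmonicProc (a : ℝ) (L R : ℝ → Ω → ℝ) (t u : ℝ) (ω : Ω) : ℝ :=
  coneHarmonic a (reflected (fun v => L v ω) t u) (reflected (fun v => R v ω) t u)

theorem cornerSum_nonneg (h : IsPlanarBM ρ L R P) {t u : ℝ} (htu : t ≤ u) (ω : Ω) :
    0 ≤ cornerSum L R t u ω :=
  add_nonneg (reflected_nonneg (h.contL ω) htu) (reflected_nonneg (h.contR ω) htu)

theorem measurable_cornerSum (h : IsPlanarBM ρ L R P) {t u : ℝ} (htu : t ≤ u) :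
    Measurable[incrSigma L R (Iic u) u] (cornerSum L R t u) :=
  (measurable_reflected_left h.contL htu Icc_subset_Iic_self).add
    (measurable_reflected_right h.contR htu Icc_subset_Iic_self)

theorem integrable_cornerSum (h : IsPlanarBM ρ L R P) [IsProbabilityMeasure P] {t u : ℝ}
    (htu : t < u) : Integrable (cornerSum L R t u) P ∧
      ∫ ω, cornerSum L R t u ω ∂P ≤ 8 * oscConst * √(u - t) := by
  obtain ⟨h1, h2⟩ := h.integrable_reflected htu
  obtain ⟨h3, h4⟩ := h.swap.integrable_reflected htu
  refine ⟨h1.add h3, ?_⟩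
  simp only [cornerSum]
  rw [integral_add h1 h3]
  linarith

theorem measurable_harmonicProc (h : IsPlanarBM ρ L R P) (a : ℝ) {t u : ℝ} (htu : t ≤ u) :
    Measurable[incrSigma L R (Iic u) u] (harmonicProc a L R t u) :=
  (measurable_coneHarmonic a).comp
    ((measurable_reflected_left h.contL htu Icc_subset_Iic_self).prodMk
      (measurable_reflected_right h.contR htu Icc_subset_Iic_self))

theorem harmonicProc_nonneg (h : IsPlanarBM ρ L R P) {a t u : ℝ} (ha : 0 < a) (ha1 : a < 1)
    (htu : t ≤ u) (ω : Ω) : 0 ≤ harmonicProc a L R t u ω :=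
  coneHarmonic_nonneg ha ha1 (reflected_nonneg (h.contL ω) htu) (reflected_nonneg (h.contR ω) htu)

theorem rpow_le_one_add {a x : ℝ} (ha : 0 < a) (ha1 : a < 1) (hx : 0 ≤ x) : x ^ a ≤ 1 + x := by
  rcases le_total x 1 with h | h
  · have := Real.rpow_le_one hx h ha.le
    linarith
  · have := Real.rpow_le_rpow_of_exponent_le h ha1.le
    rw [Real.rpow_one] at this
    linarith

/-- The free scale `r` is chosen later as `√(u - t)`, which gives the expectation its Brownian
scaling from first moments alone. -/
theorem harmonicProc_le (h : IsPlanarBM ρ L R P) {a t u r : ℝ} (ha : 0 < a) (ha1 : a < 1)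
    (htu : t ≤ u) (hr : 0 < r) (ω : Ω) :
    harmonicProc a L R t u ω ≤ r ^ a * (1 + r⁻¹ * cornerSum L R t u ω) := by
  have h0 := h.cornerSum_nonneg htu ω
  refine (coneHarmonic_le ha (reflected_nonneg (h.contL ω) htu)
    (reflected_nonneg (h.contR ω) htu)).trans ?_
  change cornerSum L R t u ω ^ a ≤ _
  have h1 : cornerSum L R t u ω = r * (r⁻¹ * cornerSum L R t u ω) := by field_simp
  conv_lhs => rw [h1, Real.mul_rpow hr.le (by positivity)]
  exact mul_le_mul_of_nonneg_left (rpow_le_one_add ha ha1 (by positivity)) (by positivity)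

theorem integrable_harmonicProc (h : IsPlanarBM ρ L R P) [IsProbabilityMeasure P] {a t u : ℝ}
    (ha : 0 < a) (ha1 : a < 1) (htu : t < u) :
    Integrable (harmonicProc a L R t u) P ∧
      ∫ ω, harmonicProc a L R t u ω ∂P ≤ (1 + 8 * oscConst) * √(u - t) ^ a := by
  obtain ⟨h1, h2⟩ := h.integrable_cornerSum htu
  have hr : 0 < √(u - t) := Real.sqrt_pos.2 (sub_pos.2 htu)
  have hd : Integrable (fun ω => √(u - t) ^ a * (1 + (√(u - t))⁻¹ * cornerSum L R t u ω)) P :=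
    ((integrable_const _).add (h1.const_mul _)).const_mul _
  have hi : Integrable (harmonicProc a L R t u) P := by
    refine hd.mono' ((h.measurable_harmonicProc a htu.le).mono h.incrSigma_le'
      le_rfl).aestronglyMeasurable (Eventually.of_forall fun ω => ?_)
    rw [Real.norm_eq_abs, abs_of_nonneg (h.harmonicProc_nonneg ha ha1 htu.le ω)]
    exact h.harmonicProc_le ha ha1 htu.le hr ω
  refine ⟨hi, (integral_mono hi hd fun ω => h.harmonicProc_le ha ha1 htu.le hr ω).trans ?_⟩
  rw [integral_const_mul, integral_add (integrable_const _) (h1.const_mul _), integral_const_mul,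
    mul_comm]
  refine mul_le_mul_of_nonneg_right ?_ (by positivity)
  have h3 : (√(u - t))⁻¹ * ∫ ω, cornerSum L R t u ω ∂P ≤
      (√(u - t))⁻¹ * (8 * oscConst * √(u - t)) := mul_le_mul_of_nonneg_left h2 (by positivity)
  have h4 : (√(u - t))⁻¹ * (8 * oscConst * √(u - t)) = 8 * oscConst := by field_simp
  simp only [integral_const, probReal_univ, smul_eq_mul, one_mul]
  linarith

end IsPlanarBM

end Supermartingale

/-! ### The approximate supermartingale inequality for one step. -/

noncomputable section Supermartingale

open Set Filter Topology

namespace IsPlanarBM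

variable {Ω : Type*} [MeasurableSpace Ω] {P : Measure Ω} {ρ : ℝ} {L R : ℝ → Ω → ℝ}

theorem integrable_incr (h : IsPlanarBM ρ L R P) {s t : ℝ} (hst : s ≤ t) :
    Integrable (fun ω => L t ω - L s ω) P := by
  simpa using h.integrable_pow hst 1

theorem integrable_incr_mul (h : IsPlanarBM ρ L R P) {s t : ℝ} (hst : s ≤ t) :
    Integrable (fun ω => (L t ω - L s ω) * (R t ω - R s ω)) P := by
  refine ((h.integrable_pow hst 2).add (h.swap.integrable_pow hst 2)).mono'
    (((h.measL t).sub (h.measL s)).mul ((h.measR t).sub (h.measR s))).aestronglyMeasurable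
    (Eventually.of_forall fun ω => ?_)
  rw [Real.norm_eq_abs, abs_le]
  simp only [Pi.add_apply]
  constructor <;>
    nlinarith [sq_nonneg (L t ω - L s ω + (R t ω - R s ω)),
      sq_nonneg (L t ω - L s ω - (R t ω - R s ω)), sq_nonneg (L t ω - L s ω),
      sq_nonneg (R t ω - R s ω)]

theorem integral_add_three {f₁ f₂ f₃ : Ω → ℝ} (h₁ : Integrable f₁ P) (h₂ : Integrable f₂ P)
    (h₃ : Integrable f₃ P) :
    Integrable (fun ω => f₁ ω + f₂ ω + f₃ ω) P ∧
      ∫ ω, (f₁ ω + f₂ ω + f₃ ω) ∂P = ∫ ω, f₁ ω ∂P + ∫ ω, f₂ ω ∂P + ∫ ω, f₃ ω ∂P := by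
  have h₁₂ : Integrable (fun ω => f₁ ω + f₂ ω) P := h₁.add h₂
  exact ⟨h₁₂.add h₃, by rw [integral_add h₁₂ h₃, integral_add h₁ h₂]⟩

/-- The second order Taylor terms of `coneHarmonic` have mean zero over any past event. -/
theorem integral_coneTaylor_eq_zero {a δ t s s' : ℝ}
    (h : IsPlanarBM (-Real.cos (2 * halfAngle a)) L R P) [IsProbabilityMeasure P]
    (ha : 0 < a) (ha1 : a < 1) (hδ : 0 < δ) (hts : t ≤ s) (hs : s ≤ s') {G : Set Ω}
    (hG : MeasurableSet[incrSigma L R (Iic s) s] G) (hGδ : ∀ ω ∈ G, δ ≤ cornerSum L R t s ω) :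
    Integrable (G.indicator fun ω => coneTaylor a (reflected (fun v => L v ω) t s)
      (reflected (fun v => R v ω) t s) (L s' ω - L s ω) (R s' ω - R s ω)) P ∧
    ∫ ω, G.indicator (fun ω => coneTaylor a (reflected (fun v => L v ω) t s)
      (reflected (fun v => R v ω) t s) (L s' ω - L s ω) (R s' ω - R s ω)) ω ∂P = 0 := by
  obtain ⟨M, hM0, hM⟩ := abs_coef_le ha ha1 hδ
  set X := fun ω => reflected (fun v => L v ω) t s with hX
  set Y := fun ω => reflected (fun v => R v ω) t s with hY
  have hXY : Measurable[incrSigma L R (Iic s) s] fun ω => (X ω, Y ω) :=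
    (measurable_reflected_left h.contL hts Icc_subset_Iic_self).prodMk
      (measurable_reflected_right h.contR hts Icc_subset_Iic_self)
  -- On `G` the coefficients are bounded functions of the past, and the monomials in the increment
  -- belong to the future, so expectations factor.
  have key : ∀ c : ℝ → ℝ → ℝ, (Measurable fun q : ℝ × ℝ => c q.1 q.2) →
      (∀ ω ∈ G, |c (X ω) (Y ω)| ≤ M) → ∀ V : Ω → ℝ, Measurable[incrSigma L R (Ici s) s] V →
      Integrable V P → Integrable (fun ω => G.indicator (fun ω => c (X ω) (Y ω)) ω * V ω) P ∧
      ∫ ω, G.indicator (fun ω => c (X ω) (Y ω)) ω * V ω ∂P =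
        (∫ ω, G.indicator (fun ω => c (X ω) (Y ω)) ω ∂P) * ∫ ω, V ω ∂P := by
    intro c hc hcM V hV iV
    have hm : Measurable[incrSigma L R (Iic s) s] (G.indicator fun ω => c (X ω) (Y ω)) :=
      (hc.comp hXY).indicator hG
    refine h.integral_mul_past_future hm hV ?_ iV
    refine Integrable.of_bound (hm.mono h.incrSigma_le' le_rfl).aestronglyMeasurable M
      (Eventually.of_forall fun ω => ?_)
    by_cases hω : ω ∈ G
    · rw [indicator_of_mem hω]; exact hcM ω hω
    · rw [indicator_of_notMem hω]; simpa using hM0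
  have hMG := fun ω (hω : ω ∈ G) => hM (X ω) (Y ω) (hGδ ω hω)
  have hs' : s' ∈ Ici s := hs
  have mL : Measurable[incrSigma L R (Ici s) s] fun ω => L s' ω - L s ω :=
    measurable_incrSigma_left hs'
  have mR : Measurable[incrSigma L R (Ici s) s] fun ω => R s' ω - R s ω :=
    measurable_incrSigma_right hs'
  obtain ⟨i1, e1⟩ := key (coefX a) (measurable_coneCoeff _ _ _) (fun ω hω => (hMG ω hω).1) _ mL
    (h.integrable_incr hs)
  obtain ⟨i2, e2⟩ := key (coefY a) (measurable_coneCoeff _ _ _) (fun ω hω => (hMG ω hω).2.1) _ mR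
    (h.swap.integrable_incr hs)
  obtain ⟨i3, e3⟩ := key (coefXX a) (measurable_coneCoeff _ _ _) (fun ω hω => (hMG ω hω).2.2.1) _
    (mL.pow_const 2) (h.integrable_pow hs 2)
  obtain ⟨i4, e4⟩ := key (coefXY a) (measurable_coneCoeff _ _ _)
    (fun ω hω => (hMG ω hω).2.2.2.1) 
    (fun ω => (L s' ω - L s ω) * (R s' ω - R s ω)) (mL.mul mR) (h.integrable_incr_mul hs)
  obtain ⟨i5, e5⟩ := key (coefYY a) (measurable_coneCoeff _ _ _)
    (fun ω hω => (hMG ω hω).2.2.2.2) _ (mR.pow_const 2) (h.swap.integrable_pow hs 2)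
  have hsum : (G.indicator fun ω => coneTaylor a (X ω) (Y ω) (L s' ω - L s ω) (R s' ω - R s ω)) =
      fun ω => G.indicator (fun ω => coefX a (X ω) (Y ω)) ω * (L s' ω - L s ω) +
        G.indicator (fun ω => coefY a (X ω) (Y ω)) ω * (R s' ω - R s ω) +
        G.indicator (fun ω => coefXX a (X ω) (Y ω)) ω * (L s' ω - L s ω) ^ 2 +
        G.indicator (fun ω => coefXY a (X ω) (Y ω)) ω *
          ((L s' ω - L s ω) * (R s' ω - R s ω)) +
        G.indicator (fun ω => coefYY a (X ω) (Y ω)) ω * (R s' ω - R s ω) ^ 2 := by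
    funext ω
    by_cases hω : ω ∈ G
    · simp only [indicator_of_mem hω, coneTaylor]
    · simp [indicator_of_notMem hω]
  rw [hsum]
  obtain ⟨i123, e123⟩ := integral_add_three i1 i2 i3
  obtain ⟨i15, e15⟩ := integral_add_three i123 i4 i5
  refine ⟨i15, ?_⟩
  rw [e15, e123, e1, e2, e3, e4, e5]
  rw [h.integral_incr hs, h.swap.integral_incr hs, h.integral_incr_sq hs,
    h.swap.integral_incr_sq hs, h.cov s s' hs]
  -- First order terms have mean zero; the second order ones add up to `s' - s` times the integral
  -- of the generator, which vanishes pointwise.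
  have hz : (fun ω => G.indicator (fun ω => coefXX a (X ω) (Y ω)) ω +
      (-Real.cos (2 * halfAngle a)) * G.indicator (fun ω => coefXY a (X ω) (Y ω)) ω +
      G.indicator (fun ω => coefYY a (X ω) (Y ω)) ω) = fun _ => 0 := by
    funext ω
    by_cases hω : ω ∈ G
    · simp only [indicator_of_mem hω]; exact coef_harmonic a _ _
    · simp [indicator_of_notMem hω]
  have ic : ∀ c : ℝ → ℝ → ℝ, (Measurable fun q : ℝ × ℝ => c q.1 q.2) →
      (∀ ω ∈ G, |c (X ω) (Y ω)| ≤ M) → Integrable (G.indicator fun ω => c (X ω) (Y ω)) P := by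
    intro c hc hcM
    simpa using (key c hc hcM (fun _ => 1) measurable_const (integrable_const _)).1
  have j3 := ic (coefXX a) (measurable_coneCoeff _ _ _) fun ω hω => (hMG ω hω).2.2.1
  have j4 := ic (coefXY a) (measurable_coneCoeff _ _ _) fun ω hω => (hMG ω hω).2.2.2.1
  have j5 := ic (coefYY a) (measurable_coneCoeff _ _ _) fun ω hω => (hMG ω hω).2.2.2.2
  have hz' := congrArg (fun f : Ω → ℝ => ∫ ω, f ω ∂P) hz
  simp only [integral_zero] at hz'
  rw [(integral_add_three j3 (j4.const_mul _) j5).2, integral_const_mul] at hz'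
  linear_combination (s' - s) * hz'

/-- One step of the approximate supermartingale property of `coneHarmonic` along the reflected
process, over a past event on which the process is away from the corner. -/
theorem exists_integral_harmonicProc_step_le {a δ : ℝ} (ha : 0 < a) (ha1 : a < 1) (hδ : 0 < δ) :
    ∃ K, 0 ≤ K ∧ ∀ {L R : ℝ → Ω → ℝ}, IsPlanarBM (-Real.cos (2 * halfAngle a)) L R P →
      IsProbabilityMeasure P → ∀ {t s s' η : ℝ}, t < s → s < s' → 0 < η → ∀ {G : Set Ω},
      MeasurableSet[incrSigma L R (Iic s) s] G → (∀ ω ∈ G, δ ≤ cornerSum L R t s ω) →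
      ∫ ω in G, harmonicProc a L R t s' ω ∂P ≤ ∫ ω in G, harmonicProc a L R t s ω ∂P +
        K * (η * ∫ ω, (push (fun u => L u ω) t s s' + push (fun u => R u ω) t s s') ∂P +
          (1 / η + 1 + 8 * oscConst * √(s - t)) * (8 * oscConst * √(s' - s) ^ 3)) := by
  obtain ⟨K, hK0, hK⟩ := exists_coneHarmonic_step_le ha ha1 hδ
  refine ⟨K, hK0, ?_⟩
  intro L R h hP t s s' η hts hss hη G hG hGδ
  have hGm : MeasurableSet G := h.incrSigma_le' _ hG
  obtain ⟨iT, eT⟩ := h.integral_coneTaylor_eq_zero ha ha1 hδ hts.le hss.le hG hGδ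
  set T := G.indicator fun ω => coneTaylor a (reflected (fun v => L v ω) t s)
      (reflected (fun v => R v ω) t s) (L s' ω - L s ω) (R s' ω - R s ω) with hT
  set m := fun ω => osc (fun u => L u ω) s s' + osc (fun u => R u ω) s s' with hm
  set l := fun ω => push (fun u => L u ω) t s s' + push (fun u => R u ω) t s s' with hl
  have il : Integrable l P :=
    (h.integrable_push hts.le hss).1.add (h.swap.integrable_push hts.le hss).1
  obtain ⟨i1, b1⟩ := h.integrable_osc_pow_three hss
  obtain ⟨i2, b2⟩ := h.swap.integrable_osc_pow_three hss
  have hmm : Measurable[incrSigma L R (Ici s) s] m :=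
    (measurable_osc_left h.contL hss.le Icc_subset_Ici_self).add
      (measurable_osc_right h.contR hss.le Icc_subset_Ici_self)
  have oL := fun ω => osc_nonneg (h.contL ω) hss.le
  have oR := fun ω => osc_nonneg (h.contR ω) hss.le
  have hm0 : ∀ ω, 0 ≤ m ω := fun ω => add_nonneg (oL ω) (oR ω)
  have hm3 := fun ω => add_pow_three_le (oL ω) (oR ω)
  have im : Integrable (fun ω => m ω ^ 3) P := by
    refine ((i1.add i2).const_mul 4).mono' ((hmm.mono h.incrSigma_le'
      le_rfl).pow_const 3).aestronglyMeasurable (Eventually.of_forall fun ω => ?_)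
    rw [Real.norm_eq_abs, abs_of_nonneg (pow_nonneg (hm0 ω) 3)]
    exact hm3 ω
  have bm : ∫ ω, m ω ^ 3 ∂P ≤ 8 * oscConst * √(s' - s) ^ 3 := by
    calc _ ≤ ∫ ω, 4 * (osc (fun u => L u ω) s s' ^ 3 + osc (fun u => R u ω) s s' ^ 3) ∂P :=
          integral_mono im ((i1.add i2).const_mul 4) hm3
      _ ≤ _ := by
        rw [integral_const_mul, integral_add i1 i2]
        linarith
  obtain ⟨iC, bC⟩ := h.integrable_cornerSum hts
  obtain ⟨iCm, eCm⟩ := h.integral_mul_past_future (h.measurable_cornerSum hts.le)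
    (hmm.pow_const 3) iC im
  have iH' := (h.integrable_harmonicProc ha ha1 (hts.trans hss)).1
  have iH := (h.integrable_harmonicProc ha ha1 hts).1
  -- The size of the present position enters only through `cornerSum * m ^ 3`, a product of a past
  -- and a future variable, so its integral factors.
  have hpt : ∀ ω, G.indicator (harmonicProc a L R t s') ω ≤
      G.indicator (harmonicProc a L R t s) ω + T ω +
        K * (η * l ω + ((1 / η + 1) * m ω ^ 3 + cornerSum L R t s ω * m ω ^ 3)) := by
    intro ω
    have p1 := push_nonneg (h.contL ω) hts.le hss.le
    have p2 := push_nonneg (h.contR ω) hts.le hss.le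
    obtain ⟨q1, q1'⟩ := push_le_osc (h.contL ω) hts.le hss.le
    obtain ⟨q2, q2'⟩ := push_le_osc (h.contR ω) hts.le hss.le
    have hl0 : 0 ≤ l ω := add_nonneg p1 p2
    have hlm : l ω ≤ m ω := add_le_add q1 q2
    have hc0 := h.cornerSum_nonneg hts.le ω
    have hm3' : 0 ≤ m ω ^ 3 := pow_nonneg (hm0 ω) 3
    by_cases hω : ω ∈ G
    · rw [indicator_of_mem hω, indicator_of_mem hω, hT, indicator_of_mem hω]
      have := hK (reflected (fun v => L v ω) t s) (reflected (fun v => R v ω) t s)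
        (L s' ω - L s ω) (R s' ω - R s ω) (push (fun u => L u ω) t s s')
        (push (fun u => R u ω) t s s') (m ω) (reflected_nonneg (h.contL ω) hts.le)
        (reflected_nonneg (h.contR ω) hts.le) (hGδ ω hω)
        ((abs_sub_le_osc (h.contL ω) (right_mem_Icc.2 hss.le)).trans
          (le_add_of_nonneg_right (oR ω)))
        ((abs_sub_le_osc (h.contR ω) (right_mem_Icc.2 hss.le)).trans
          (le_add_of_nonneg_left (oL ω))) p1 p2
        (q1.trans (le_add_of_nonneg_right (oR ω))) (q2.trans (le_add_of_nonneg_left (oL ω)))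
        (fun h' => (q1' h').trans (le_add_of_nonneg_right (oR ω)))
        (fun h' => (q2' h').trans (le_add_of_nonneg_left (oL ω)))
        (by rw [← reflected_eq_add_push (fun v => L v ω)]
            exact reflected_nonneg (h.contL ω) (hts.trans hss).le)
        (by rw [← reflected_eq_add_push (fun v => R v ω)]
            exact reflected_nonneg (h.contR ω) (hts.trans hss).le)
      rw [← reflected_eq_add_push (fun v => L v ω),
        ← reflected_eq_add_push (fun v => R v ω)] at this
      refine this.trans (add_le_add_right (mul_le_mul_of_nonneg_left ?_ hK0) _)
      have h5 := mul_push_le hη hl0 hlm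
      have h6 : (1 / η + 1) * m ω ^ 3 + cornerSum L R t s ω * m ω ^ 3 =
        m ω ^ 3 / η + (1 + reflected (fun v => L v ω) t s + reflected (fun v => R v ω) t s) *
          m ω ^ 3 := by
        simp only [cornerSum]; ring
      rw [h6]
      have h7 : m ω * l ω = m ω * (push (fun u => L u ω) t s s' +
        push (fun u => R u ω) t s s') := rfl
      linarith
    · rw [indicator_of_notMem hω, indicator_of_notMem hω, hT, indicator_of_notMem hω]
      have : 0 ≤ 1 / η := by positivity
      positivity
  have iE : Integrable (fun ω => η * l ω + ((1 / η + 1) * m ω ^ 3 +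
      cornerSum L R t s ω * m ω ^ 3)) P := (il.const_mul η).add ((im.const_mul _).add iCm)
  obtain ⟨iS, eS⟩ := integral_add_three (iH.indicator hGm) iT (iE.const_mul K)
  have eE := (integral_add_three (il.const_mul η) (im.const_mul (1 / η + 1)) iCm).2
  simp only [add_assoc] at eE
  have hfin := integral_mono (iH'.indicator hGm) iS hpt
  rw [eS, integral_indicator hGm, integral_indicator hGm, eT, add_zero, integral_const_mul, eE,
    eCm, integral_const_mul, integral_const_mul] at hfin
  refine hfin.trans (add_le_add_right (mul_le_mul_of_nonneg_left (add_le_add_right ?_ _) hK0) _)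
  rw [← add_mul]
  have hη' : 0 ≤ 1 / η := by positivity
  have := one_le_oscConst
  have hi0 : 0 ≤ ∫ ω, m ω ^ 3 ∂P := integral_nonneg fun ω => pow_nonneg (hm0 ω) 3
  exact mul_le_mul (by linarith) bm hi0 (by positivity)

end IsPlanarBM

end Supermartingale

/-! ### Summation over a grid and passage to the limit. -/

noncomputable section Supermartingale

open Set Filter Topology

namespace IsPlanarBM

variable {Ω : Type*} [MeasurableSpace Ω] {P : Measure Ω} {ρ : ℝ} {L R : ℝ → Ω → ℝ}

/-- The reflected process stays at distance `δ` from the corner at the first `k + 1` points of a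
grid of mesh `d` started at `s`. -/
def awaySet (L R : ℝ → Ω → ℝ) (t s d δ : ℝ) (k : ℕ) : Set Ω :=
  {ω | ∀ j ≤ k, δ ≤ cornerSum L R t (s + j * d) ω}

theorem measurableSet_awaySet (h : IsPlanarBM ρ L R P) {t s d δ : ℝ} (hts : t ≤ s) (hd : 0 ≤ d)
    (k : ℕ) :
    MeasurableSet[incrSigma L R (Iic (s + k * d)) (s + k * d)] (awaySet L R t s d δ k) := by
  have : awaySet L R t s d δ k =
      ⋂ j ∈ Finset.range (k + 1), (cornerSum L R t (s + j * d)) ⁻¹' Ici δ := by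
    ext ω
    simp [awaySet]
  rw [this]
  refine MeasurableSet.biInter (Finset.countable_toSet _) fun j hj => ?_
  have hjk : (j : ℝ) ≤ k := by
    exact_mod_cast Nat.lt_succ_iff.1 (Finset.mem_range.1 (Finset.mem_coe.1 hj))
  have h0 : (0 : ℝ) ≤ j := Nat.cast_nonneg j
  refine incrSigma_mono_Iic (s := s + j * d) (by nlinarith) _ ?_
  exact (h.measurable_cornerSum (by nlinarith)) measurableSet_Ici

/-- Over `n` steps of length `d = (T - s) / n` the pushes telescope to a quantity with bounded mean,
while the cubic errors total `n * d ^ (3/2)`, of order `1 / √n`. -/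
theorem exists_setIntegral_awaySet_le {a δ t s T : ℝ}
    (h : IsPlanarBM (-Real.cos (2 * halfAngle a)) L R P) [IsProbabilityMeasure P]
    (ha : 0 < a) (ha1 : a < 1) (hδ : 0 < δ) (hts : t < s) (hsT : s < T) :
    ∃ K, 0 ≤ K ∧ ∀ η, 0 < η → ∀ n : ℕ, 0 < n →
      ∫ ω in awaySet L R t s ((T - s) / n) δ n, harmonicProc a L R t T ω ∂P ≤
        ∫ ω, harmonicProc a L R t s ω ∂P + K * (η + (1 / η + 1) / √n) := by
  obtain ⟨K, hK0, hK⟩ := exists_integral_harmonicProc_step_le (Ω := Ω) (P := P) ha ha1 hδ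
  have hoc := one_le_oscConst
  have hsT' : 0 < T - s := sub_pos.2 hsT
  set Q₁ := 4 * oscConst * √(T - s) with hQ₁
  set Q₂ := 8 * oscConst * √(T - t) with hQ₂
  set Q₃ := 8 * oscConst * √(T - s) ^ 3 with hQ₃
  have hQ₁0 : 0 ≤ Q₁ := by positivity
  have hQ₂0 : 0 ≤ Q₂ := by positivity
  have hQ₃0 : 0 ≤ Q₃ := by positivity
  refine ⟨K * (Q₁ + (1 + Q₂) * Q₃), by positivity, fun η hη n hn => ?_⟩
  have hn' : (0 : ℝ) < n := by exact_mod_cast hn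
  have hd : 0 < (T - s) / n := by positivity
  set d := (T - s) / n with hdd
  set p : ℕ → ℝ := fun k => ∫ ω, (push (fun u => L u ω) t (s + k * d) (s + (k + 1 : ℕ) * d) +
    push (fun u => R u ω) t (s + k * d) (s + (k + 1 : ℕ) * d)) ∂P with hp
  set B := (1 / η + 1 + Q₂) * (8 * oscConst * √d ^ 3) with hB
  have hnd : s + n * d = T := by rw [hdd]; field_simp; ring
  have hτ : ∀ k : ℕ, s + k * d < s + (k + 1 : ℕ) * d := fun k => by push_cast; linarith
  have hτ' : ∀ k : ℕ, t < s + k * d := fun k => by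
    have : 0 ≤ k * d := by positivity
    linarith
  have hτn : ∀ k : ℕ, k ≤ n → s + k * d ≤ T := fun k hk => by
    have : (k : ℝ) ≤ n := by exact_mod_cast hk
    nlinarith
  have hGs : ∀ k, MeasurableSet (awaySet L R t s d δ k) := fun k =>
    h.incrSigma_le' _ (h.measurableSet_awaySet hts.le hd.le k)
  have hind : ∀ k ≤ n, ∫ ω in awaySet L R t s d δ k, harmonicProc a L R t (s + k * d) ω ∂P ≤
      ∫ ω, harmonicProc a L R t s ω ∂P + K * (η * ∑ j ∈ Finset.range k, p j + k * B) := by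
    intro k
    induction k with
    | zero =>
      intro _
      simp only [Nat.cast_zero, zero_mul, add_zero, Finset.range_zero, Finset.sum_empty, mul_zero]
      exact setIntegral_le_integral (h.integrable_harmonicProc ha ha1 hts).1
        (Eventually.of_forall (h.harmonicProc_nonneg ha ha1 hts.le))
    | succ k ih =>
      intro hk
      have ih' := ih (by omega)
      -- The away sets decrease and the function is nonnegative, so paths that approach the corner
      -- can be discarded.
      have h1 : ∫ ω in awaySet L R t s d δ (k + 1),
          harmonicProc a L R t (s + (k + 1 : ℕ) * d) ω ∂P ≤
          ∫ ω in awaySet L R t s d δ k, harmonicProc a L R t (s + (k + 1 : ℕ) * d) ω ∂P := by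
        refine setIntegral_mono_set
          (h.integrable_harmonicProc ha ha1 (hτ' (k + 1))).1.integrableOn
          (Eventually.of_forall (h.harmonicProc_nonneg ha ha1 (hτ' (k + 1)).le))
          (LE.le.eventuallyLE fun ω hω j hj => hω j (by omega))
      have h2 := hK h inferInstance (hτ' k) (hτ k) hη (h.measurableSet_awaySet hts.le hd.le k)
        (fun ω hω => hω k le_rfl)
      have h3 : (1 / η + 1 + 8 * oscConst * √(s + k * d - t)) *
          (8 * oscConst * √(s + (k + 1 : ℕ) * d - (s + k * d)) ^ 3) ≤ B := by
        have e : s + (k + 1 : ℕ) * d - (s + k * d) = d := by push_cast; ring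
        rw [e, hB, hQ₂]
        refine mul_le_mul_of_nonneg_right (add_le_add_right (mul_le_mul_of_nonneg_left
          (Real.sqrt_le_sqrt ?_) (by positivity)) _) (by positivity)
        linarith [hτn k (by omega)]
      have h4 := mul_le_mul_of_nonneg_left (add_le_add_right h3 (η * p k)) hK0
      rw [Finset.sum_range_succ]
      have e5 : K * (η * (∑ j ∈ Finset.range k, p j + p k) + (k + 1 : ℕ) * B) =
          K * (η * ∑ j ∈ Finset.range k, p j + k * B) + K * (η * p k + B) := by
        push_cast; ring
      rw [e5]
      linarith
  have hfin := hind n le_rfl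
  rw [hnd] at hfin
  have hsum : ∑ j ∈ Finset.range n, p j ≤ Q₁ := by
    have hi : ∀ j : ℕ, Integrable (fun ω => push (fun u => L u ω) t (s + j * d)
        (s + (j + 1 : ℕ) * d) + push (fun u => R u ω) t (s + j * d) (s + (j + 1 : ℕ) * d)) P :=
      fun j => (h.integrable_push (hτ' j).le (hτ j)).1.add
        (h.swap.integrable_push (hτ' j).le (hτ j)).1
    rw [hp, ← integral_finsetSum _ fun j _ => hi j]
    have e : ∀ ω, ∑ j ∈ Finset.range n, (push (fun u => L u ω) t (s + j * d)
        (s + (j + 1 : ℕ) * d) + push (fun u => R u ω) t (s + j * d) (s + (j + 1 : ℕ) * d)) =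
        push (fun u => L u ω) t s T + push (fun u => R u ω) t s T := by
      intro ω
      simp only [push]
      rw [Finset.sum_add_distrib,
        Finset.sum_range_sub' (fun j : ℕ => segInf (fun u => L u ω) t (s + j * d)),
        Finset.sum_range_sub' (fun j : ℕ => segInf (fun u => R u ω) t (s + j * d)), hnd]
      simp
    simp_rw [e]
    obtain ⟨i1, b1⟩ := h.integrable_push hts.le hsT
    obtain ⟨i2, b2⟩ := h.swap.integrable_push hts.le hsT
    rw [integral_add i1 i2]
    linarith
  have hnB : n * B = (1 / η + 1 + Q₂) * Q₃ / √n := by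
    have hsn : √(n : ℝ) ^ 2 = n := Real.sq_sqrt hn'.le
    have hs0 : 0 < √(n : ℝ) := Real.sqrt_pos.2 hn'
    rw [hB, hQ₃, hdd, Real.sqrt_div hsT'.le, div_pow]
    field_simp
    rw [hsn]
  rw [hnB] at hfin
  refine hfin.trans (add_le_add_right ?_ _)
  rw [mul_assoc]
  refine mul_le_mul_of_nonneg_left ?_ hK0
  have hη' : 0 ≤ 1 / η := by positivity
  have hs0 : 0 < √(n : ℝ) := Real.sqrt_pos.2 hn'
  have b1 : η * ∑ j ∈ Finset.range n, p j ≤ η * Q₁ := mul_le_mul_of_nonneg_left hsum hη.le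
  have b2 : (1 / η + 1 + Q₂) * Q₃ / √n ≤ (1 + Q₂) * Q₃ * ((1 / η + 1) / √n) := by
    rw [← mul_div_assoc]
    refine div_le_div_of_nonneg_right ?_ hs0.le
    have : 0 ≤ 1 / η * Q₂ * Q₃ := by positivity
    nlinarith
  have b3 : 0 ≤ (1 + Q₂) * Q₃ * η := by positivity
  have b4 : 0 ≤ Q₁ * ((1 / η + 1) / √n) := by positivity
  nlinarith

/-- The event that the process reflected from time `t` on does not visit the corner during
`[s, T]`. -/
def noVisit (L R : ℝ → Ω → ℝ) (t s T : ℝ) : Set Ω := {ω | ∀ u ∈ Icc s T, 0 < cornerSum L R t u ω}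

theorem continuous_cornerSum (h : IsPlanarBM ρ L R P) (t : ℝ) (ω : Ω) :
    Continuous fun u => cornerSum L R t u ω := by
  have h1 := h.contL ω
  have h2 := h.contR ω
  refine Continuous.add ?_ ?_
  · exact continuous_reflected (f := fun (_ : ℝ) v => L v ω) (by fun_prop) continuous_const
      continuous_id
  · exact continuous_reflected (f := fun (_ : ℝ) v => R v ω) (by fun_prop) continuous_const
      continuous_id

theorem measurableSet_noVisit (h : IsPlanarBM ρ L R P) {t s T : ℝ} (hts : t ≤ s) (hsT : s ≤ T) :
    MeasurableSet[incrSigma L R (Icc t T) t] (noVisit L R t s T) := by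
  have : noVisit L R t s T = (fun ω => segInf (fun u => cornerSum L R t u ω) s T) ⁻¹' Ioi 0 := by
    ext ω
    obtain ⟨u, hu, he⟩ := exists_segInf_eq (h.continuous_cornerSum t ω) hsT
    simp only [mem_preimage, mem_Ioi]
    exact ⟨fun hω => he ▸ hω u hu, fun hω v hv =>
      hω.trans_le (segInf_le (h.continuous_cornerSum t ω) hv)⟩
  rw [this]
  refine measurable_segInf (fun ω => h.continuous_cornerSum t ω) hsT (fun u hu => ?_)
    measurableSet_Ioi
  exact (measurable_reflected_left h.contL (hts.trans hu.1) (Icc_subset_Icc_right hu.2)).add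
    (measurable_reflected_right h.contR (hts.trans hu.1) (Icc_subset_Icc_right hu.2))

/-- Markov's inequality for the harmonic function at time `T`, whose integral over paths avoiding
the corner is at most its expectation at time `s`. A path avoiding the corner on a compact interval
stays at some distance `1 / (k + 1)` from it. -/
theorem measure_noVisit_inter_le {a t s T x : ℝ}
    (h : IsPlanarBM (-Real.cos (2 * halfAngle a)) L R P) [IsProbabilityMeasure P]
    (ha : 0 < a) (ha1 : a < 1) (hts : t < s) (hsT : s < T) (hx : 0 < x) :
    P (noVisit L R t s T ∩ {ω | x ≤ cornerSum L R t T ω}) ≤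
      ENNReal.ofReal ((1 + 8 * oscConst) * √(s - t) ^ a / (harmonicConst a * x ^ a)) := by
  set E := (1 + 8 * oscConst) * √(s - t) ^ a with hE
  set c := harmonicConst a * x ^ a with hc
  have hc0 : 0 < c := mul_pos (harmonicConst_pos ha ha1) (Real.rpow_pos_of_pos hx _)
  set A : Set Ω := {ω | x ≤ cornerSum L R t T ω} with hA
  let F : ℕ → Set Ω := fun k => {ω | ∀ u ∈ Icc s T, 1 / (k + 1 : ℝ) ≤ cornerSum L R t u ω}
  have hFmono : Monotone fun k => F k ∩ A := by
    intro k l hkl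
    refine inter_subset_inter_left _ fun ω hω u hu => le_trans ?_ (hω u hu)
    exact one_div_le_one_div_of_le (by positivity) (by exact_mod_cast Nat.succ_le_succ hkl)
  have hsub : noVisit L R t s T ∩ A ⊆ ⋃ k, F k ∩ A := by
    rintro ω ⟨hω, hωA⟩
    obtain ⟨u, hu, he⟩ := exists_segInf_eq (h.continuous_cornerSum t ω) hsT.le
    obtain ⟨k, hk⟩ := exists_nat_one_div_lt (hω u hu)
    exact mem_iUnion.2 ⟨k, fun v hv =>
      hk.le.trans (he ▸ segInf_le (h.continuous_cornerSum t ω) hv), hωA⟩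
  refine (measure_mono hsub).trans ?_
  rw [hFmono.measure_iUnion]
  refine iSup_le fun k => ?_
  set δ : ℝ := 1 / (k + 1 : ℝ) with hδ
  have hδ0 : 0 < δ := by positivity
  obtain ⟨K, hK0, hK⟩ := h.exists_setIntegral_awaySet_le ha ha1 hδ0 hts hsT
  have hE' := (h.integrable_harmonicProc ha ha1 hts).2
  have hiT := (h.integrable_harmonicProc ha ha1 (hts.trans hsT)).1
  have hAm : MeasurableSet A :=
    h.incrSigma_le' _ ((h.measurable_cornerSum (hts.trans hsT).le) measurableSet_Ici)
  have hbound : ∀ η, 0 < η → ∀ n : ℕ, 0 < n →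
      P.real (F k ∩ A) * c ≤ E + K * (η + (1 / η + 1) / √n) := by
    intro η hη n hn
    have hn' : (0 : ℝ) < n := by exact_mod_cast hn
    have hd : 0 < (T - s) / n := div_pos (sub_pos.2 hsT) hn'
    set G := awaySet L R t s ((T - s) / n) δ n with hG
    have hGm : MeasurableSet G := h.incrSigma_le' _ (h.measurableSet_awaySet hts.le hd.le n)
    have hFG : F k ∩ A ⊆ G ∩ A := by
      refine inter_subset_inter_left _ fun ω hω j hj => hω _ ⟨?_, ?_⟩
      · have : 0 ≤ j * ((T - s) / n) := by positivity
        linarith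
      · have h1 : (j : ℝ) ≤ n := by exact_mod_cast hj
        have h2 : (n : ℝ) * ((T - s) / n) = T - s := by field_simp
        nlinarith
    have h1 : P.real (F k ∩ A) * c ≤ P.real (G ∩ A) * c :=
      mul_le_mul_of_nonneg_right (measureReal_mono hFG) hc0.le
    have h2 : P.real (G ∩ A) * c ≤ ∫ ω in G, harmonicProc a L R t T ω ∂P := by
      calc P.real (G ∩ A) * c = ∫ _ in G ∩ A, c ∂P := by
            rw [setIntegral_const, smul_eq_mul]
        _ ≤ ∫ ω in G ∩ A, harmonicProc a L R t T ω ∂P := by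
            refine setIntegral_mono_on (integrableOn_const (by finiteness)) hiT.integrableOn
              (hGm.inter hAm) fun ω hω => ?_
            refine le_trans ?_ (le_coneHarmonic ha ha1 (reflected_nonneg (h.contL ω)
              (hts.trans hsT).le) (reflected_nonneg (h.contR ω) (hts.trans hsT).le))
            exact mul_le_mul_of_nonneg_left (Real.rpow_le_rpow hx.le hω.2 ha.le)
              (harmonicConst_pos ha ha1).le
        _ ≤ _ := setIntegral_mono_set hiT.integrableOn (Eventually.of_forall
            (h.harmonicProc_nonneg ha ha1 (hts.trans hsT).le))
            (LE.le.eventuallyLE inter_subset_left)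
    linarith [hK η hη n hn]
  -- The mesh goes to `0` first with `η` fixed, since the error contains `1 / η`; only afterwards
  -- does `η` go to `0`.
  have hlim1 : ∀ η, 0 < η → P.real (F k ∩ A) * c ≤ E + K * η := by
    intro η hη
    have ht : Tendsto (fun n : ℕ => E + K * (η + (1 / η + 1) / √n)) atTop
        (𝓝 (E + K * (η + 0))) := by
      refine tendsto_const_nhds.add (tendsto_const_nhds.mul (tendsto_const_nhds.add ?_))
      exact tendsto_const_nhds.div_atTop (Real.tendsto_sqrt_atTop.comp tendsto_natCast_atTop_atTop)
    rw [add_zero] at ht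
    exact ge_of_tendsto ht ((eventually_gt_atTop 0).mono fun n hn => hbound η hη n hn)
  have hlim2 : P.real (F k ∩ A) * c ≤ E := by
    have ht : Tendsto (fun η : ℝ => E + K * η) (𝓝[>] 0) (𝓝 (E + K * 0)) :=
      ((continuous_const.add (continuous_const.mul continuous_id)).tendsto 0).mono_left
        nhdsWithin_le_nhds
    rw [mul_zero, add_zero] at ht
    exact ge_of_tendsto ht (eventually_mem_nhdsWithin.mono fun η hη => hlim1 η hη)
  rw [← ofReal_measureReal]
  exact ENNReal.ofReal_le_ofReal ((le_div_iff₀ hc0).2 hlim2)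

end IsPlanarBM

end Supermartingale

/-! ### Probability of avoiding the corner over a dyadic time span. -/

noncomputable section Recursion

open Set Filter Topology

/-- Symmetry gives at most `1/2` below `0`, and the density is at most `1`, which adds at most
`1/10`. -/
theorem gaussianReal_Iio_le : gaussianReal 0 1 (Iio (1 / 10 : ℝ)) ≤ ENNReal.ofReal (6 / 10) := by
  have hsym : gaussianReal 0 1 (Iio (0 : ℝ)) = gaussianReal 0 1 (Ioi (0 : ℝ)) := by
    have h1 : (gaussianReal 0 1).map (fun x : ℝ => -x) = gaussianReal 0 1 := by
      rw [gaussianReal_map_neg, neg_zero]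
    conv_lhs => rw [← h1]
    rw [Measure.map_apply measurable_neg measurableSet_Iio]
    congr 1
    ext x
    simp
  have hhalf : (gaussianReal 0 1).real (Iio (0 : ℝ)) ≤ 1 / 2 := by
    have h1 : (gaussianReal 0 1).real (Iio (0 : ℝ) ∪ Ioi 0) ≤ 1 := measureReal_le_one
    rw [measureReal_union (disjoint_left.2 fun x hx hx' => lt_asymm (mem_Iio.1 hx) (mem_Ioi.1 hx'))
      measurableSet_Ioi] at h1
    have h2 : (gaussianReal 0 1).real (Iio (0 : ℝ)) = (gaussianReal 0 1).real (Ioi (0 : ℝ)) := by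
      rw [measureReal_def, measureReal_def, hsym]
    linarith
  have hpdf : ∀ x : ℝ, gaussianPDF 0 1 x ≤ 1 := by
    intro x
    rw [gaussianPDF, ← ENNReal.ofReal_one]
    refine ENNReal.ofReal_le_ofReal ?_
    rw [gaussianPDFReal]
    have h1 : (√(2 * Real.pi * ((1 : NNReal) : ℝ)))⁻¹ ≤ 1 := by
      refine inv_le_one_of_one_le₀ ?_
      rw [Real.one_le_sqrt]
      have := Real.pi_gt_three
      push_cast
      linarith
    have h2 : Real.exp (-(x - 0) ^ 2 / (2 * ((1 : NNReal) : ℝ))) ≤ 1 := by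
      rw [Real.exp_le_one_iff]
      push_cast
      have := sq_nonneg (x - 0)
      linarith
    exact mul_le_one₀ h1 (Real.exp_pos _).le h2
  have hsmall : gaussianReal 0 1 (Ico (0 : ℝ) (1 / 10)) ≤ ENNReal.ofReal (1 / 10) := by
    rw [gaussianReal_apply _ one_ne_zero]
    calc _ ≤ ∫⁻ _ in Ico (0 : ℝ) (1 / 10), 1 := lintegral_mono hpdf
      _ = _ := by simp
  have hunion : Iio (1 / 10 : ℝ) ⊆ Iio 0 ∪ Ico 0 (1 / 10) := by
    intro x hx
    rcases lt_or_ge x 0 with h | h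
    · exact Or.inl h
    · exact Or.inr ⟨h, hx⟩
  calc _ ≤ gaussianReal 0 1 (Iio (0 : ℝ)) + gaussianReal 0 1 (Ico (0 : ℝ) (1 / 10)) :=
        (measure_mono hunion).trans (measure_union_le _ _)
    _ ≤ ENNReal.ofReal (1 / 2) + ENNReal.ofReal (1 / 10) := by
        refine add_le_add ?_ hsmall
        rw [← ofReal_measureReal]
        exact ENNReal.ofReal_le_ofReal hhalf
    _ = _ := by
        rw [← ENNReal.ofReal_add (by norm_num) (by norm_num)]
        norm_num

theorem incrSigma_Icc_le {Ω : Type*} {L R : ℝ → Ω → ℝ} {t s : ℝ} (hts : t ≤ s) :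
    incrSigma L R (Icc t s) t ≤ incrSigma L R (Iic s) s :=
  incrSigma_le (fun _ hu => measurable_incrSigma_left' hu.2 hts)
    fun _ hu => measurable_incrSigma_right' hu.2 hts

namespace IsPlanarBM

variable {Ω : Type*} [MeasurableSpace Ω] {P : Measure Ω} {ρ : ℝ} {L R : ℝ → Ω → ℝ}

theorem measureReal_incr_lt_le (h : IsPlanarBM ρ L R P) {s t : ℝ} (hst : s < t) :
    P.real {ω | L t ω - L s ω < √(t - s) / 10} ≤ 6 / 10 := by
  have hlaw := h.lawL s t hst.le
  have hd : 0 < t - s := sub_pos.2 hst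
  have hs : 0 < √(t - s) := Real.sqrt_pos.2 hd
  have h1 : P {ω | L t ω - L s ω < √(t - s) / 10} =
      gaussianReal 0 (t - s).toNNReal (Iio (√(t - s) / 10)) := by
    rw [← hlaw.map_eq, Measure.map_apply_of_aemeasurable hlaw.aemeasurable measurableSet_Iio]
    rfl
  rw [measureReal_def, h1, gaussianReal_eq_map_sqrt hd.le,
    Measure.map_apply (by fun_prop) measurableSet_Iio]
  have h2 : (√(t - s) * ·) ⁻¹' Iio (√(t - s) / 10) = Iio (1 / 10 : ℝ) := by
    ext x
    simp only [mem_preimage, mem_Iio]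
    rw [div_eq_mul_one_div, mul_lt_mul_iff_right₀ hs]
  rw [h2]
  exact ENNReal.toReal_le_of_le_ofReal (by norm_num) gaussianReal_Iio_le

theorem measureReal_inter_incr_lt_le (h : IsPlanarBM ρ L R P) [IsProbabilityMeasure P] {s t : ℝ}
    (hst : s < t) {A : Set Ω} (hA : MeasurableSet[incrSigma L R (Iic s) s] A) :
    P.real (A ∩ {ω | L t ω - L s ω < √(t - s) / 10}) ≤ 6 / 10 * P.real A := by
  have hB : MeasurableSet[incrSigma L R (Ici s) s] {ω | L t ω - L s ω < √(t - s) / 10} :=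
    (measurable_incrSigma_left (mem_Ici.2 hst.le)) measurableSet_Iio
  have := (Indep_iff _ _ _).1 (h.indep s) A _ hA hB
  rw [measureReal_def, this, ENNReal.toReal_mul, mul_comm]
  exact mul_le_mul_of_nonneg_right (h.measureReal_incr_lt_le hst) measureReal_nonneg

/-- Being close to the corner at `u` therefore forces a small increment since `s`, an event
independent of everything before `s`. -/
theorem sub_le_cornerSum (h : IsPlanarBM ρ L R P) {t s u : ℝ} (hts : t ≤ s) (hsu : s ≤ u) (ω : Ω) :
    L u ω - L s ω ≤ cornerSum L R t u ω := by
  have h1 := reflected_nonneg (h.contR ω) (hts.trans hsu)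
  have h2 := segInf_le (h.contL ω) (s := t) (t := u) ⟨hts, hsu⟩
  simp only [cornerSum]
  rw [reflected]
  linarith

/-- The constant in `measureReal_noVisit_le`. -/
def visitConst (a : ℝ) : ℝ := 1 + 10 * ((1 + 8 * oscConst) * 10 ^ a / harmonicConst a)

theorem one_le_visitConst {a : ℝ} (ha : 0 < a) (ha1 : a < 1) : 1 ≤ visitConst a := by
  have h1 := one_le_oscConst
  have h2 := harmonicConst_pos ha ha1
  rw [visitConst]
  have : 0 ≤ 10 * ((1 + 8 * oscConst) * 10 ^ a / harmonicConst a) := by positivity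
  linarith

theorem sqrt_two_rpow_inv_ge {a : ℝ} (ha1 : a < 1) : 7 / 10 ≤ (√2 ^ a)⁻¹ := by
  have h1 : 1 ≤ √2 := Real.one_le_sqrt.2 one_le_two
  have h2 : √2 ^ a ≤ √2 := by
    simpa using Real.rpow_le_rpow_of_exponent_le h1 ha1.le
  have h3 : √2 ≤ 10 / 7 := Real.sqrt_le_iff.2 ⟨by norm_num, by norm_num⟩
  rw [le_inv_comm₀ (by norm_num) (by positivity)]
  linarith

/-- The probability that the reflected process avoids the corner over a long time span. -/
theorem measureReal_noVisit_le {a t r : ℝ}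
    (h : IsPlanarBM (-Real.cos (2 * halfAngle a)) L R P) [IsProbabilityMeasure P]
    (ha : 0 < a) (ha1 : a < 1) (hr : 0 < r) (n : ℕ) :
    P.real (noVisit L R t (t + r) (t + 2 ^ n * r)) ≤ visitConst a * (√2 ^ a)⁻¹ ^ n := by
  have hoc := one_le_oscConst
  have hhc := harmonicConst_pos ha ha1
  induction n with
  | zero =>
    rw [pow_zero (√2 ^ a)⁻¹, mul_one]
    exact measureReal_le_one.trans (one_le_visitConst ha ha1)
  | succ n ih =>
    set q := (√2 ^ a)⁻¹ with hq
    have hq7 := sqrt_two_rpow_inv_ge ha1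
    rw [← hq] at hq7
    set A := (1 + 8 * oscConst) * 10 ^ a / harmonicConst a with hA
    have hA0 : 0 ≤ A := by positivity
    have h2n : (1 : ℝ) ≤ 2 ^ n := one_le_pow₀ one_le_two
    set s := t + 2 ^ n * r with hs
    set T := t + 2 ^ (n + 1) * r with hT
    have hTs : T - s = 2 ^ n * r := by rw [hT, hs, pow_succ]; ring
    have hpos : 0 < 2 ^ n * r := by positivity
    have hts : t + r ≤ s := by rw [hs]; nlinarith
    have hsT : s < T := by linarith
    set x := √(T - s) / 10 with hx
    have hx0 : 0 < x := by rw [hx, hTs]; positivity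
    -- At the end of the doubled span either the process is far from the corner, which the harmonic
    -- function makes unlikely, or it is close, which costs an independent factor `6/10`.
    have hsub : noVisit L R t (t + r) T ⊆
        (noVisit L R t (t + r) T ∩ {ω | x ≤ cornerSum L R t T ω}) ∪
          (noVisit L R t (t + r) s ∩ {ω | L T ω - L s ω < x}) := by
      intro ω hω
      rcases le_or_gt x (cornerSum L R t T ω) with hle | hlt
      · exact Or.inl ⟨hω, hle⟩
      · exact Or.inr ⟨fun u hu => hω u ⟨hu.1, hu.2.trans hsT.le⟩,
          (h.sub_le_cornerSum (by linarith) hsT.le ω).trans_lt hlt⟩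
    have h1 : P.real (noVisit L R t (t + r) T ∩ {ω | x ≤ cornerSum L R t T ω}) ≤ A * q ^ n := by
      refine (ENNReal.toReal_le_of_le_ofReal (by positivity) (h.measure_noVisit_inter_le ha ha1
        (by linarith : t < t + r) (by linarith) hx0)).trans_eq ?_
      have e1 : √(t + r - t) ^ a = √r ^ a := by rw [add_sub_cancel_left]
      have e2 : x ^ a = (√2 ^ a) ^ n * √r ^ a / 10 ^ a := by
        rw [hx, hTs, Real.sqrt_mul (by positivity), Real.div_rpow (by positivity) (by norm_num),
          Real.mul_rpow (by positivity) (by positivity)]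
        congr 2
        rw [← Real.rpow_natCast (√2 ^ a), ← Real.rpow_mul (by positivity), mul_comm,
          Real.rpow_mul (by positivity), Real.rpow_natCast]
        congr 1
        rw [Real.sqrt_eq_iff_mul_self_eq (by positivity) (by positivity), ← mul_pow,
          Real.mul_self_sqrt (by norm_num)]
      have h3 : 0 < √r ^ a := Real.rpow_pos_of_pos (Real.sqrt_pos.2 hr) _
      have h4 : 0 < √2 ^ a := Real.rpow_pos_of_pos (by positivity) _
      rw [e1, e2, hA, hq, inv_pow]
      field_simp
    have h2 := h.measureReal_inter_incr_lt_le hsT (incrSigma_Icc_le (by linarith) _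
      (h.measurableSet_noVisit (by linarith : t ≤ t + r) hts))
    have h3 := (measureReal_mono (μ := P) hsub).trans (measureReal_union_le _ _)
    have hqn : 0 ≤ q ^ n := by positivity
    have hv : visitConst a = 1 + 10 * A := rfl
    -- The recursion closes because `q ≥ 7/10` exceeds `6/10` and `visitConst a ≥ 10 * A`.
    have h4 : A + 6 / 10 * visitConst a ≤ visitConst a * q := by
      rw [hv]; nlinarith
    calc _ ≤ A * q ^ n + 6 / 10 * (visitConst a * q ^ n) := by linarith
      _ = (A + 6 / 10 * visitConst a) * q ^ n := by ring
      _ ≤ visitConst a * q * q ^ n := mul_le_mul_of_nonneg_right h4 hqn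
      _ = _ := by ring

end IsPlanarBM

end Recursion

/-! ### Probability that one coordinate stays above a level. -/

noncomputable section Persistence

open Set Filter Topology

namespace IsPlanarBM

/-- The first coordinate does not fall by more than `y` at the first `k + 1` points of a grid of
mesh `d` started at `t`. -/
def gridStay {Ω : Type*} (L : ℝ → Ω → ℝ) (t d y : ℝ) (k : ℕ) : Set Ω :=
  {ω | ∀ j ≤ k, -y ≤ L (t + j * d) ω - L t ω}

/-- The first coordinate does not fall by more than `y` during `[t, T]`. -/
def stay {Ω : Type*} (L : ℝ → Ω → ℝ) (t T y : ℝ) : Set Ω := {ω | ∀ u ∈ Icc t T, -y ≤ L u ω - L t ω}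

theorem measurableSet_gridStay {Ω : Type*} (L R : ℝ → Ω → ℝ) {t d y : ℝ} (hd : 0 ≤ d) (k : ℕ) :
    MeasurableSet[incrSigma L R (Iic (t + k * d)) (t + k * d)] (gridStay L t d y k) := by
  have : gridStay L t d y k =
      ⋂ j ∈ Finset.range (k + 1), (fun ω => L (t + j * d) ω - L t ω) ⁻¹' Ici (-y) := by
    ext ω
    simp [gridStay]
  rw [this]
  refine MeasurableSet.biInter (Finset.countable_toSet _) fun j hj => ?_
  have hjk : (j : ℝ) ≤ k := by
    exact_mod_cast Nat.lt_succ_iff.1 (Finset.mem_range.1 (Finset.mem_coe.1 hj))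
  have h0 : (0 : ℝ) ≤ k * d := by positivity
  exact (measurable_incrSigma_left' (mem_Iic.2 (by nlinarith)) (mem_Iic.2 (by linarith)))
    measurableSet_Ici

variable {Ω : Type*} [MeasurableSpace Ω] {P : Measure Ω} {ρ : ℝ} {L R : ℝ → Ω → ℝ}

theorem measurableSet_stay (h : IsPlanarBM ρ L R P) {t T y : ℝ} (htT : t ≤ T) :
    MeasurableSet[incrSigma L R (Icc t T) t] (stay L t T y) := by
  have hc : ∀ ω, Continuous fun u => L u ω - L t ω := fun ω => (h.contL ω).sub continuous_const
  have : stay L t T y = (fun ω => segInf (fun u => L u ω - L t ω) t T) ⁻¹' Ici (-y) := by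
    ext ω
    simp only [stay, mem_preimage, mem_Ici]
    exact (le_segInf_iff (hc ω) htT).symm
  rw [this]
  exact measurable_segInf hc htT (fun u hu => measurable_incrSigma_left hu) measurableSet_Ici

/-- Stopping of the martingale `y + (L - L t)` at its first negative grid value. The undershoot is
at most `η + osc ^ 3 / η ^ 2`; each path pays `η` at most once, when it leaves, so these costs
telescope to `1 - P.real (gridStay L t d y n)`. -/
theorem setIntegral_gridStay_le (h : IsPlanarBM ρ L R P) [IsProbabilityMeasure P] {t d y η : ℝ}
    (hd : 0 < d) (hy : 0 ≤ y) (hη : 0 < η) (n : ℕ) :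
    ∫ ω in gridStay L t d y n, (y + (L (t + n * d) ω - L t ω)) ∂P ≤
      y + η * (1 - P.real (gridStay L t d y n)) + n * (oscConst * √d ^ 3 / η ^ 2) := by
  have hτ : ∀ k : ℕ, t + k * d < t + (k + 1 : ℕ) * d := fun k => by push_cast; linarith
  have hτ' : ∀ k : ℕ, t ≤ t + k * d := fun k => by
    have : 0 ≤ k * d := by positivity
    linarith
  have hGm : ∀ k, MeasurableSet (gridStay L t d y k) := fun k =>
    h.incrSigma_le' _ (measurableSet_gridStay L R hd.le k)
  have hi : ∀ k : ℕ, Integrable (fun ω => y + (L (t + k * d) ω - L t ω)) P := fun k =>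
    (integrable_const _).add (h.integrable_incr (hτ' k))
  induction n with
  | zero =>
    have h0 : gridStay L t d y 0 = univ := by
      ext ω; simp [gridStay, hy]
    simp [h0]
  | succ k ih =>
    set G := gridStay L t d y k with hG
    set G' := gridStay L t d y (k + 1) with hG'
    set s := t + k * d with hs
    set s' := t + (k + 1 : ℕ) * d with hs'
    have hGG : G' ⊆ G := fun ω hω j hj => hω j (by omega)
    have hss : s' - s = d := by rw [hs, hs']; push_cast; ring
    obtain ⟨iO, bO⟩ := h.integrable_osc_pow_three (hτ k)
    rw [← hs', ← hs] at iO bO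
    rw [hss] at bO
    obtain ⟨iD, eD⟩ := h.integral_mul_past_future (s := s)
      (U := G.indicator fun _ => (1 : ℝ)) (V := fun ω => L s' ω - L s ω)
      (measurable_const.indicator (measurableSet_gridStay L R hd.le k))
      (measurable_incrSigma_left (mem_Ici.2 (hτ k).le))
      ((integrable_const _).indicator (hGm k)) (h.integrable_incr (hτ k).le)
    rw [h.integral_incr (hτ k).le, mul_zero] at eD
    have iE : Integrable (fun ω => η * (G.indicator (fun _ => (1 : ℝ)) ω -
        G'.indicator (fun _ => (1 : ℝ)) ω)) P :=
      (((integrable_const _).indicator (hGm k)).sub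
        ((integrable_const _).indicator (hGm (k + 1)))).const_mul η
    have eE : ∫ ω, η * (G.indicator (fun _ => (1 : ℝ)) ω -
        G'.indicator (fun _ => (1 : ℝ)) ω) ∂P = η * (P.real G - P.real G') := by
      rw [integral_const_mul, integral_sub ((integrable_const _).indicator (hGm k))
        ((integrable_const _).indicator (hGm (k + 1))), integral_indicator (hGm k),
        integral_indicator (hGm (k + 1)), setIntegral_const, setIntegral_const, smul_eq_mul,
        smul_eq_mul, mul_one, mul_one]
    have hpt : ∀ ω, G'.indicator (fun ω => y + (L s' ω - L t ω)) ω ≤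
        (G.indicator (fun ω => y + (L s ω - L t ω)) ω +
          G.indicator (fun _ => (1 : ℝ)) ω * (L s' ω - L s ω) +
        η * (G.indicator (fun _ => (1 : ℝ)) ω - G'.indicator (fun _ => (1 : ℝ)) ω)) +
        (η ^ 2)⁻¹ * osc (fun u => L u ω) s s' ^ 3 := by
      intro ω
      have ho := osc_nonneg (h.contL ω) (hτ k).le
      rw [← hs, ← hs'] at ho
      have hD := abs_sub_le_osc (h.contL ω) (right_mem_Icc.2 (hτ k).le)
      rw [← hs, ← hs'] at hD
      have hp : 0 ≤ (η ^ 2)⁻¹ * osc (fun u => L u ω) s s' ^ 3 := by positivity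
      by_cases hω' : ω ∈ G'
      · have hω := hGG hω'
        simp only [indicator_of_mem hω, indicator_of_mem hω']
        linarith
      · rw [indicator_of_notMem hω', indicator_of_notMem hω']
        by_cases hω : ω ∈ G
        · simp only [indicator_of_mem hω]
          have h1 : -y ≤ L s ω - L t ω := hω k le_rfl
          have h2 : osc (fun u => L u ω) s s' ≤ η + (η ^ 2)⁻¹ * osc (fun u => L u ω) s s' ^ 3 := by
            set o := osc (fun u => L u ω) s s'
            rcases le_total o η with hle | hle
            · linarith
            · have : o ≤ (η ^ 2)⁻¹ * o ^ 3 := by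
                rw [inv_mul_eq_div, le_div_iff₀ (by positivity)]
                calc o * η ^ 2 ≤ o * o ^ 2 := by gcongr
                  _ = o ^ 3 := by ring
              linarith
          have h3 := neg_abs_le (L s' ω - L s ω)
          linarith
        · simp only [indicator_of_notMem hω]
          linarith
    have iG : Integrable (G.indicator fun ω => y + (L s ω - L t ω)) P := (hi k).indicator (hGm k)
    obtain ⟨i3, e3⟩ := integral_add_three iG iD iE
    have hfin := integral_mono ((hi (k + 1)).indicator (hGm (k + 1)))
      (i3.add (iO.const_mul (η ^ 2)⁻¹)) hpt
    rw [integral_indicator (hGm (k + 1))] at hfin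
    refine hfin.trans ?_
    have e4 := integral_add i3 (iO.const_mul (η ^ 2)⁻¹)
    rw [e3, eD, eE, integral_indicator (hGm k), integral_const_mul] at e4
    refine e4.le.trans ?_
    have b2 : (η ^ 2)⁻¹ * ∫ ω, osc (fun u => L u ω) s s' ^ 3 ∂P ≤ oscConst * √d ^ 3 / η ^ 2 := by
      rw [div_eq_inv_mul]
      exact mul_le_mul_of_nonneg_left bO (by positivity)
    push_cast
    linarith

theorem measureReal_stay_inter_le (h : IsPlanarBM ρ L R P) [IsProbabilityMeasure P] {t T x y : ℝ}
    (htT : t < T) (hy : 0 ≤ y) (hx : 0 < x) :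
    P.real (stay L t T y ∩ {ω | x ≤ y + (L T ω - L t ω)}) ≤ y / x := by
  set A : Set Ω := {ω | x ≤ y + (L T ω - L t ω)} with hA
  have hAm : MeasurableSet A :=
    measurableSet_le measurable_const (measurable_const.add ((h.measL T).sub (h.measL t)))
  have hi : Integrable (fun ω => y + (L T ω - L t ω)) P :=
    (integrable_const _).add (h.integrable_incr htT.le)
  have hTt : 0 < T - t := sub_pos.2 htT
  have hbound : ∀ η, 0 < η → ∀ n : ℕ, 0 < n → P.real (stay L t T y ∩ A) * x ≤
      y + η + oscConst * √(T - t) ^ 3 / η ^ 2 / √n := by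
    intro η hη n hn
    have hn' : (0 : ℝ) < n := by exact_mod_cast hn
    have hd : 0 < (T - t) / n := div_pos hTt hn'
    have hnd : t + n * ((T - t) / n) = T := by field_simp; ring
    have h1 := h.setIntegral_gridStay_le (t := t) hd hy hη n
    rw [hnd] at h1
    set G := gridStay L t ((T - t) / n) y n with hG
    have hGm : MeasurableSet G := h.incrSigma_le' _ (measurableSet_gridStay L R hd.le n)
    have hFG : stay L t T y ∩ A ⊆ G ∩ A := by
      refine inter_subset_inter_left _ fun ω hω j hj => hω _ ⟨?_, ?_⟩
      · have : 0 ≤ j * ((T - t) / n) := by positivity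
        linarith
      · have h1 : (j : ℝ) ≤ n := by exact_mod_cast hj
        nlinarith
    have h2 : P.real (stay L t T y ∩ A) * x ≤ P.real (G ∩ A) * x :=
      mul_le_mul_of_nonneg_right (measureReal_mono hFG) hx.le
    have h3 : P.real (G ∩ A) * x ≤ ∫ ω in G, (y + (L T ω - L t ω)) ∂P := by
      have hG0 : ∀ ω ∈ G, 0 ≤ y + (L T ω - L t ω) := by
        intro ω hω
        have := hω n le_rfl
        rw [hnd] at this
        linarith
      calc P.real (G ∩ A) * x = ∫ _ in G ∩ A, x ∂P := by
            rw [setIntegral_const, smul_eq_mul]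
        _ ≤ ∫ ω in G ∩ A, (y + (L T ω - L t ω)) ∂P :=
            setIntegral_mono_on (integrableOn_const (by finiteness)) hi.integrableOn
              (hGm.inter hAm) fun ω hω => hω.2
        _ ≤ _ := setIntegral_mono_set hi.integrableOn
            ((ae_restrict_iff' hGm).2 (Eventually.of_forall hG0))
            (LE.le.eventuallyLE inter_subset_left)
    have h4 : n * (oscConst * √((T - t) / n) ^ 3 / η ^ 2) =
        oscConst * √(T - t) ^ 3 / η ^ 2 / √n := by
      have hsn : √(n : ℝ) ^ 2 = n := Real.sq_sqrt hn'.le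
      have hs0 : 0 < √(n : ℝ) := Real.sqrt_pos.2 hn'
      rw [Real.sqrt_div hTt.le, div_pow]
      field_simp
      rw [hsn]
      ring
    have h5 : 0 ≤ η * P.real G := mul_nonneg hη.le measureReal_nonneg
    rw [h4] at h1
    linarith
  have hlim1 : ∀ η, 0 < η → P.real (stay L t T y ∩ A) * x ≤ y + η := by
    intro η hη
    have ht : Tendsto (fun n : ℕ => y + η + oscConst * √(T - t) ^ 3 / η ^ 2 / √n) atTop
        (𝓝 (y + η + 0)) := by
      refine tendsto_const_nhds.add ?_
      exact tendsto_const_nhds.div_atTop (Real.tendsto_sqrt_atTop.comp tendsto_natCast_atTop_atTop)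
    rw [add_zero] at ht
    exact ge_of_tendsto ht ((eventually_gt_atTop 0).mono fun n hn => hbound η hη n hn)
  rw [le_div_iff₀ hx]
  exact le_of_forall_pos_le_add hlim1

/-- The probability that a coordinate does not fall by more than `y` over a time span. -/
theorem measureReal_stay_le (h : IsPlanarBM ρ L R P) [IsProbabilityMeasure P] {t T y : ℝ}
    (htT : t < T) (hy : 0 ≤ y) : P.real (stay L t T y) ≤ 100 * y / √(T - t) := by
  -- The term `(6/10) ^ n` makes the case `n = 0` trivial and disappears as `n` grows; each step of
  -- the induction halves the time span.
  have key : ∀ n : ℕ, ∀ T, t < T →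
      P.real (stay L t T y) ≤ 100 * y / √(T - t) + (6 / 10) ^ n := by
    intro n
    induction n with
    | zero =>
      intro T hT
      have : 0 ≤ 100 * y / √(T - t) := by positivity
      rw [pow_zero]
      linarith [measureReal_le_one (μ := P) (s := stay L t T y)]
    | succ n ih =>
      intro T hT
      set s := (t + T) / 2 with hs
      have hts : t < s := by rw [hs]; linarith
      have hsT : s < T := by rw [hs]; linarith
      have e1 : s - t = (T - t) / 2 := by rw [hs]; ring
      have e2 : T - s = (T - t) / 2 := by rw [hs]; ring
      have hd : 0 < T - t := sub_pos.2 hT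
      set r := √(T - t) with hr
      have hr0 : 0 < r := Real.sqrt_pos.2 hd
      have e3 : √((T - t) / 2) = r / √2 := by rw [Real.sqrt_div hd.le]
      set x := √(T - s) / 10 with hx
      have hx0 : 0 < x := by rw [hx, e2]; positivity
      have hsub : stay L t T y ⊆ (stay L t T y ∩ {ω | x ≤ y + (L T ω - L t ω)}) ∪
          (stay L t s y ∩ {ω | L T ω - L s ω < x}) := by
        intro ω hω
        rcases le_or_gt x (y + (L T ω - L t ω)) with hle | hlt
        · exact Or.inl ⟨hω, hle⟩
        · refine Or.inr ⟨fun u hu => hω u ⟨hu.1, hu.2.trans hsT.le⟩, ?_⟩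
          have := hω s ⟨hts.le, hsT.le⟩
          change L T ω - L s ω < x
          linarith
      have h1 := h.measureReal_stay_inter_le hT hy hx0
      have h2 := h.measureReal_inter_incr_lt_le hsT (incrSigma_Icc_le hts.le _
        (h.measurableSet_stay (y := y) hts.le))
      have h3 := (measureReal_mono (μ := P) hsub).trans (measureReal_union_le _ _)
      have h4 := ih s hts
      rw [e1, e3] at h4
      have hsq : √2 ≤ 1415 / 1000 := Real.sqrt_le_iff.2 ⟨by norm_num, by norm_num⟩
      have e4 : y / x = 10 * √2 * (y / r) := by
        rw [hx, e2, e3]; field_simp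
      have e5 : 100 * y / (r / √2) = 100 * √2 * (y / r) := by field_simp
      have e6 : 100 * y / r = 100 * (y / r) := by ring
      have hyr : 0 ≤ y / r := by positivity
      rw [e4] at h1
      rw [e5] at h4
      rw [e6, pow_succ]
      -- The constant `100` reproduces itself: `10 * √2 + (6/10) * 100 * √2 = 70 * √2 ≤ 100`.
      have h5 : 70 * √2 * (y / r) ≤ 100 * (y / r) :=
        mul_le_mul_of_nonneg_right (by linarith) hyr
      linarith
  have ht : Tendsto (fun n : ℕ => 100 * y / √(T - t) + (6 / 10 : ℝ) ^ n) atTop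
      (𝓝 (100 * y / √(T - t) + 0)) :=
    tendsto_const_nhds.add (tendsto_pow_atTop_nhds_zero_of_lt_one (by norm_num) (by norm_num))
  rw [add_zero] at ht
  exact ge_of_tendsto' ht fun n => key n T htT

end IsPlanarBM

end Persistence

/-! ### Corner visits that undercut the past minimum. -/

noncomputable section BadEvent

open Set Filter Topology

/-- Fubini for the product law: the value of `W` is frozen and the linear bound on the distribution
function of `X` is applied. -/
theorem IndepFun.measure_le_le_lintegral {Ω : Type*} [MeasurableSpace Ω] {P : Measure Ω}
    [IsProbabilityMeasure P] {X W : Ω → ℝ} {c : ℝ} (hXW : IndepFun X W P) (hX : Measurable X)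
    (hW : Measurable W) (hc : ∀ y, P {ω | X ω ≤ y} ≤ ENNReal.ofReal (c * y)) :
    P {ω | X ω ≤ W ω} ≤ ∫⁻ ω, ENNReal.ofReal (c * W ω) ∂P := by
  have hS : MeasurableSet {p : ℝ × ℝ | p.1 ≤ p.2} := measurableSet_le measurable_fst measurable_snd
  have h1 : P {ω | X ω ≤ W ω} = (P.map fun ω => (X ω, W ω)) {p : ℝ × ℝ | p.1 ≤ p.2} := by
    rw [Measure.map_apply (hX.prodMk hW) hS]; rfl
  have : IsProbabilityMeasure (P.map X) := Measure.isProbabilityMeasure_map hX.aemeasurable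
  have : IsProbabilityMeasure (P.map W) := Measure.isProbabilityMeasure_map hW.aemeasurable
  rw [h1, (indepFun_iff_map_prod_eq_prod_map_map hX.aemeasurable hW.aemeasurable).1 hXW,
    Measure.prod_apply_symm hS]
  calc _ ≤ ∫⁻ y, ENNReal.ofReal (c * y) ∂(P.map W) := by
        refine lintegral_mono fun y => ?_
        rw [Measure.map_apply hX (measurable_prodMk_right hS)]
        exact hc y
    _ = _ := lintegral_map (by fun_prop) hW

namespace IsPlanarBM

theorem noVisit_anti {Ω : Type*} (L R : ℝ → Ω → ℝ) {t s T T' : ℝ} (hT : T ≤ T') :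
    noVisit L R t s T' ⊆ noVisit L R t s T :=
  fun _ hω u hu => hω u ⟨hu.1, hu.2.trans hT⟩

variable {Ω : Type*} [MeasurableSpace Ω] {P : Measure Ω} {ρ : ℝ} {L R : ℝ → Ω → ℝ}

/-- The depth of the past minimum of the first coordinate over `[s, t]`, seen from time `t`. -/
def pastDepth (L : ℝ → Ω → ℝ) (s t : ℝ) (ω : Ω) : ℝ := -segInf (fun u => L u ω - L t ω) s t

theorem measurable_pastDepth (h : IsPlanarBM ρ L R P) {s t : ℝ} (hst : s ≤ t) :
    Measurable[incrSigma L R (Iic t) t] (pastDepth L s t) :=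
  Measurable.neg (measurable_segInf (fun ω => (h.contL ω).sub continuous_const) hst
    fun _ hu => measurable_incrSigma_left (mem_Iic.2 hu.2))

theorem pastDepth_le_iff (h : IsPlanarBM ρ L R P) {s t y : ℝ} (hst : s ≤ t) (ω : Ω) :
    pastDepth L s t ω ≤ y ↔ ∀ u ∈ Icc s t, -y ≤ L u ω - L t ω := by
  rw [pastDepth, neg_le,
    le_segInf_iff (f := fun u => L u ω - L t ω) ((h.contL ω).sub continuous_const) hst]

/-- Seen backwards from `t`, a shallow past minimum is the event `stay` for the reversed motion. -/
theorem measure_pastDepth_le (h : IsPlanarBM ρ L R P) [IsProbabilityMeasure P] {s t : ℝ}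
    (hst : s < t) (y : ℝ) :
    P {ω | pastDepth L s t ω ≤ y} ≤ ENNReal.ofReal (100 / √(t - s) * y) := by
  rcases lt_or_ge y 0 with hy | hy
  · have : {ω | pastDepth L s t ω ≤ y} = ∅ := by
      refine eq_empty_of_forall_notMem fun ω hω => ?_
      have := (h.pastDepth_le_iff hst.le ω).1 hω t (right_mem_Icc.2 hst.le)
      simp only [sub_self] at this
      linarith
    rw [this]
    simp
  · have h1 := h.reverse.measureReal_stay_le (t := -t) (T := -s) (by linarith) hy
    have h2 : {ω | pastDepth L s t ω ≤ y} ⊆ stay (fun v => L (-v)) (-t) (-s) y := by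
      intro ω hω u hu
      have := (h.pastDepth_le_iff hst.le ω).1 hω (-u) ⟨by linarith [hu.2], by linarith [hu.1]⟩
      simpa using this
    refine (measure_mono h2).trans ?_
    rw [← ofReal_measureReal]
    refine ENNReal.ofReal_le_ofReal (h1.trans_eq ?_)
    rw [show -s - -t = t - s by ring]
    ring

theorem sqrt_two_mul_inv_rpow {a : ℝ} : √2 * (√2 ^ a)⁻¹ = √2 ^ (1 - a) := by
  rw [Real.rpow_sub (by positivity), Real.rpow_one, div_eq_mul_inv]

theorem one_lt_sqrt_two_rpow {a : ℝ} (ha1 : a < 1) : 1 < √2 ^ (1 - a) :=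
  Real.one_lt_rpow (Real.lt_sqrt_of_sq_lt (by norm_num)) (by linarith)

theorem osc_le_sum {f : ℝ → ℝ} (hf : Continuous f) {t r : ℝ} (hr : 0 < r) (j : ℕ) :
    osc f t (t + 2 ^ j * r) ≤ osc f t (t + r) +
      ∑ i ∈ Finset.range j, osc f (t + 2 ^ i * r) (t + 2 ^ (i + 1) * r) := by
  induction j with
  | zero => simp
  | succ j ih =>
    have h1 : t ≤ t + 2 ^ j * r := by
      have : 0 ≤ 2 ^ j * r := by positivity
      linarith
    have h2 : t + 2 ^ j * r ≤ t + 2 ^ (j + 1) * r := by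
      have : 0 ≤ 2 ^ j * r := by positivity
      rw [pow_succ]; linarith
    have := osc_le_add hf h1 h2
    rw [Finset.sum_range_succ]
    linarith

/-- The constant in `setIntegral_osc_noVisit_le`. -/
def oscVisitConst (a : ℝ) : ℝ :=
  2 * oscConst * (1 + visitConst a / (√2 ^ (1 - a) - 1))

theorem oscVisitConst_nonneg {a : ℝ} (ha : 0 < a) (ha1 : a < 1) : 0 ≤ oscVisitConst a := by
  have h1 := one_le_oscConst
  have h2 := one_le_visitConst ha ha1
  have h3 : 0 < √2 ^ (1 - a) - 1 := sub_pos.2 (one_lt_sqrt_two_rpow ha1)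
  rw [oscVisitConst]
  positivity

/-- The oscillation is split into dyadic blocks. The `i`-th has mean of order `√(2 ^ i * r)` and is
independent of avoiding the corner up to its start, of probability of order `2 ^ (-i * al/2)` with
exponent `al = a`. As `a < 1` the products grow geometrically, and the last block dominates. -/
theorem setIntegral_osc_noVisit_le {a t r : ℝ}
    (h : IsPlanarBM (-Real.cos (2 * halfAngle a)) L R P) [IsProbabilityMeasure P]
    (ha : 0 < a) (ha1 : a < 1) (hr : 0 < r) (j : ℕ) :
    ∫ ω in noVisit L R t (t + r) (t + 2 ^ j * r), osc (fun u => L u ω) t (t + 2 ^ (j + 1) * r) ∂P ≤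
      oscVisitConst a * √r * (√2 ^ (1 - a)) ^ (j + 1) := by
  have hoc := one_le_oscConst
  have hvc := one_le_visitConst ha ha1
  set w := √2 ^ (1 - a) with hw
  have hw1 : 1 < w := one_lt_sqrt_two_rpow ha1
  set NV : ℕ → Set Ω := fun i => noVisit L R t (t + r) (t + 2 ^ i * r) with hNV
  have hpos : ∀ i : ℕ, 0 < 2 ^ i * r := fun i => by positivity
  have hge : ∀ i : ℕ, t + r ≤ t + 2 ^ i * r := fun i => by
    have : (1 : ℝ) ≤ 2 ^ i := one_le_pow₀ one_le_two
    nlinarith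
  have hlt : ∀ i : ℕ, t + 2 ^ i * r < t + 2 ^ (i + 1) * r := fun i => by
    rw [pow_succ]; linarith [hpos i]
  have hNVm : ∀ i, MeasurableSet[incrSigma L R (Iic (t + 2 ^ i * r)) (t + 2 ^ i * r)] (NV i) :=
    fun i => incrSigma_Icc_le (by linarith [hpos i]) _
      (h.measurableSet_noVisit (by linarith) (hge i))
  have hNVm' : ∀ i, MeasurableSet (NV i) := fun i => h.incrSigma_le' _ (hNVm i)
  have hio : ∀ i : ℕ, Integrable (fun ω => osc (fun u => L u ω) (t + 2 ^ i * r)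
      (t + 2 ^ (i + 1) * r)) P := fun i => (h.integrable_osc (hlt i)).1
  have hi0 := h.integrable_osc (by linarith : t < t + r)
  have hi1 := h.integrable_osc (by linarith [hpos (j + 1)] : t < t + 2 ^ (j + 1) * r)
  have hstep : ∀ i ≤ j, ∫ ω in NV j, osc (fun u => L u ω) (t + 2 ^ i * r)
      (t + 2 ^ (i + 1) * r) ∂P ≤ 2 * oscConst * √r * (visitConst a * w ^ i) := by
    intro i hij
    have h1 : ∫ ω in NV j, osc (fun u => L u ω) (t + 2 ^ i * r) (t + 2 ^ (i + 1) * r) ∂P ≤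
        ∫ ω in NV i, osc (fun u => L u ω) (t + 2 ^ i * r) (t + 2 ^ (i + 1) * r) ∂P := by
      refine setIntegral_mono_set (hio i).integrableOn
        (Eventually.of_forall fun ω => osc_nonneg (h.contL ω) (hlt i).le)
        (LE.le.eventuallyLE (noVisit_anti L R ?_))
      have : (2 : ℝ) ^ i ≤ 2 ^ j := pow_le_pow_right₀ one_le_two hij
      nlinarith
    obtain ⟨-, e2⟩ := h.integral_mul_past_future (s := t + 2 ^ i * r)
      (U := (NV i).indicator fun _ => (1 : ℝ))
      (V := fun ω => osc (fun u => L u ω) (t + 2 ^ i * r) (t + 2 ^ (i + 1) * r))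
      (measurable_const.indicator (hNVm i))
      (measurable_osc_left h.contL (hlt i).le Icc_subset_Ici_self)
      ((integrable_const _).indicator (hNVm' i)) (hio i)
    have e3 : ∫ ω in NV i, osc (fun u => L u ω) (t + 2 ^ i * r) (t + 2 ^ (i + 1) * r) ∂P =
        ∫ ω, (NV i).indicator (fun _ => (1 : ℝ)) ω *
          osc (fun u => L u ω) (t + 2 ^ i * r) (t + 2 ^ (i + 1) * r) ∂P := by
      rw [← integral_indicator (hNVm' i)]
      congr 1
      funext ω
      by_cases hω : ω ∈ NV i <;> simp [hω]
    have e4 : ∫ ω, (NV i).indicator (fun _ => (1 : ℝ)) ω ∂P = P.real (NV i) := by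
      rw [integral_indicator (hNVm' i), setIntegral_const, smul_eq_mul, mul_one]
    rw [e3, e2, e4] at h1
    refine h1.trans ?_
    have h5 := (h.integrable_osc (hlt i)).2
    have e5 : √(t + 2 ^ (i + 1) * r - (t + 2 ^ i * r)) = √2 ^ i * √r := by
      rw [show t + 2 ^ (i + 1) * r - (t + 2 ^ i * r) = 2 ^ i * r by rw [pow_succ]; ring,
        Real.sqrt_mul (by positivity)]
      congr 1
      rw [Real.sqrt_eq_iff_mul_self_eq (by positivity) (by positivity), ← mul_pow,
        Real.mul_self_sqrt (by norm_num)]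
    rw [e5] at h5
    have h6 := h.measureReal_noVisit_le (t := t) ha ha1 hr i
    calc _ ≤ visitConst a * (√2 ^ a)⁻¹ ^ i * (2 * oscConst * (√2 ^ i * √r)) :=
          mul_le_mul h6 h5 (integral_nonneg fun ω => osc_nonneg (h.contL ω) (hlt i).le)
            (by positivity)
      _ = _ := by rw [hw, ← sqrt_two_mul_inv_rpow, mul_pow]; ring
  have hbase : ∫ ω in NV j, osc (fun u => L u ω) t (t + r) ∂P ≤ 2 * oscConst * √r := by
    refine (setIntegral_le_integral hi0.1 (Eventually.of_forall fun ω =>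
      osc_nonneg (h.contL ω) (by linarith))).trans ?_
    simpa using hi0.2
  have hsum : ∫ ω in NV j, osc (fun u => L u ω) t (t + 2 ^ (j + 1) * r) ∂P ≤
      ∫ ω in NV j, osc (fun u => L u ω) t (t + r) ∂P + ∑ i ∈ Finset.range (j + 1),
        ∫ ω in NV j, osc (fun u => L u ω) (t + 2 ^ i * r) (t + 2 ^ (i + 1) * r) ∂P := by
    rw [← integral_finsetSum _ fun i _ => (hio i).integrableOn,
      ← integral_add hi0.1.integrableOn (integrable_finsetSum _ fun i _ => (hio i).integrableOn)]
    exact integral_mono hi1.1.integrableOn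
      (hi0.1.integrableOn.add (integrable_finsetSum _ fun i _ => (hio i).integrableOn))
      fun ω => osc_le_sum (h.contL ω) hr (j + 1)
  have hsum' : ∑ i ∈ Finset.range (j + 1),
      ∫ ω in NV j, osc (fun u => L u ω) (t + 2 ^ i * r) (t + 2 ^ (i + 1) * r) ∂P ≤
      2 * oscConst * √r * (visitConst a / (w - 1) * w ^ (j + 1)) := by
    refine (Finset.sum_le_sum fun i hi => hstep i (Nat.lt_succ_iff.1
      (Finset.mem_range.1 hi))).trans ?_
    rw [← Finset.mul_sum, ← Finset.mul_sum, geom_sum_eq hw1.ne']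
    refine mul_le_mul_of_nonneg_left ?_ (by positivity)
    rw [div_mul_eq_mul_div, mul_div_assoc]
    refine mul_le_mul_of_nonneg_left ?_ (by linarith)
    exact div_le_div_of_nonneg_right (sub_le_self _ zero_le_one) (by linarith)
  have hw' : 1 ≤ w ^ (j + 1) := one_le_pow₀ hw1.le
  have hA : 0 ≤ 2 * oscConst * √r := by positivity
  have e : oscVisitConst a * √r * w ^ (j + 1) = 2 * oscConst * √r * w ^ (j + 1) +
      2 * oscConst * √r * (visitConst a / (w - 1) * w ^ (j + 1)) := by
    rw [oscVisitConst]; ring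
  rw [e]
  have := mul_le_mul_of_nonneg_left hw' hA
  linarith

/-- Every visit to the corner in `[t + r, b]` of the process reflected from `t` on happens at a
level of the first coordinate that was not undercut during `[s, t]`. -/
def lowVisits (L R : ℝ → Ω → ℝ) (s t r b : ℝ) : Set Ω :=
  {ω | ∀ S ∈ Icc (t + r) b, cornerSum L R t S ω = 0 → ∀ u ∈ Icc s t, L S ω ≤ L u ω}

/-- At a corner visit `S ≤ T` the first coordinate is below its whole past on `[s, t]`, so it must
have travelled at least the past depth since `t`. -/
theorem pastDepth_le_osc (h : IsPlanarBM ρ L R P) {s t r b S T : ℝ} {ω : Ω} (hst : s ≤ t)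
    (hr : 0 < r) (hω : ω ∈ lowVisits L R s t r b) (hS : S ∈ Icc (t + r) T) (hT : T ≤ b)
    (h0 : cornerSum L R t S ω ≤ 0) : pastDepth L s t ω ≤ osc (fun u => L u ω) t T := by
  have hS1 := hS.1
  have hc := h.cornerSum_nonneg (by linarith : t ≤ S) ω
  rw [h.pastDepth_le_iff hst]
  intro u hu
  have h1 := hω S ⟨hS.1, hS.2.trans hT⟩ (le_antisymm h0 hc) u hu
  have h2 := abs_sub_le_osc (h.contL ω) (s := t) (t := T) (u := S) ⟨by linarith, hS.2⟩
  linarith [neg_abs_le (L S ω - L t ω)]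

/-- Decomposition by the dyadic block of the first corner visit after `t + r`; in block `j` there
was no visit up to `t + 2 ^ j * r`, and the past is undercut by `t + 2 ^ (j + 1) * r`. -/
theorem lowVisits_subset (h : IsPlanarBM ρ L R P) {s t r b : ℝ} (hst : s ≤ t) (hr : 0 < r) (J : ℕ)
    (hJ : t + 2 ^ J * r ≤ b) :
    lowVisits L R s t r b ⊆ noVisit L R t (t + r) (t + 2 ^ J * r) ∪
      ({ω | pastDepth L s t ω ≤ osc (fun u => L u ω) t (t + r)} ∪
      ⋃ j ∈ Finset.range J, noVisit L R t (t + r) (t + 2 ^ j * r) ∩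
        {ω | pastDepth L s t ω ≤ osc (fun u => L u ω) t (t + 2 ^ (j + 1) * r)}) := by
  induction J with
  | zero =>
    intro ω hω
    by_cases hv : ω ∈ noVisit L R t (t + r) (t + 2 ^ 0 * r)
    · exact Or.inl hv
    · right; left
      simp only [noVisit, Set.mem_ofPred_eq] at hv
      push Not at hv
      obtain ⟨S, hS, h0⟩ := hv
      rw [pow_zero, one_mul] at hS hJ
      exact h.pastDepth_le_osc hst hr hω hS hJ h0
  | succ J ih =>
    intro ω hω
    by_cases hv : ω ∈ noVisit L R t (t + r) (t + 2 ^ (J + 1) * r)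
    · exact Or.inl hv
    · right
      have hJ' : t + 2 ^ J * r ≤ b := by
        have : 0 ≤ 2 ^ J * r := by positivity
        rw [pow_succ] at hJ
        linarith
      rcases ih hJ' hω with h1 | h1 | h1
      · right
        refine mem_biUnion (Finset.mem_coe.2 (Finset.self_mem_range_succ J)) ⟨h1, ?_⟩
        simp only [noVisit, Set.mem_ofPred_eq] at hv
        push Not at hv
        obtain ⟨S, hS, h0⟩ := hv
        exact h.pastDepth_le_osc hst hr hω hS hJ h0
      · exact Or.inl h1
      · right
        obtain ⟨j, hj, hj'⟩ := mem_iUnion₂.1 h1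
        exact mem_biUnion (Finset.mem_coe.2 (Finset.range_subset_range.2 J.le_succ hj)) hj'

theorem measureReal_inter_pastDepth_le (h : IsPlanarBM ρ L R P) [IsProbabilityMeasure P]
    {s t T : ℝ} (hst : s < t) (htT : t < T) {A : Set Ω}
    (hA : MeasurableSet[incrSigma L R (Ici t) t] A) :
    P.real (A ∩ {ω | pastDepth L s t ω ≤ osc (fun u => L u ω) t T}) ≤
      100 / √(t - s) * ∫ ω in A, osc (fun u => L u ω) t T ∂P := by
  classical
  have hAm : MeasurableSet A := h.incrSigma_le' _ hA
  have hosc : Measurable[incrSigma L R (Ici t) t] fun ω => osc (fun u => L u ω) t T :=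
    measurable_osc_left h.contL htT.le Icc_subset_Ici_self
  have ho := (h.integrable_osc htT).1
  -- The negative value off `A` contributes nothing after truncation by `ENNReal.ofReal`, and `W`
  -- still depends on the future only.
  set W : Ω → ℝ := A.piecewise (fun ω => osc (fun u => L u ω) t T) fun _ => -1 with hW
  have hWm : Measurable[incrSigma L R (Ici t) t] W := hosc.piecewise hA measurable_const
  have hXm := h.measurable_pastDepth hst.le
  have h1 := IndepFun.measure_le_le_lintegral (h.indepFun t hXm hWm)
    (hXm.mono h.incrSigma_le' le_rfl) (hWm.mono h.incrSigma_le' le_rfl)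
    (h.measure_pastDepth_le hst)
  have hsub : A ∩ {ω | pastDepth L s t ω ≤ osc (fun u => L u ω) t T} ⊆
      {ω | pastDepth L s t ω ≤ W ω} := by
    rintro ω ⟨hω, hω'⟩
    simp only [Set.mem_ofPred_eq, hW, piecewise_eq_of_mem _ _ _ hω]
    exact hω'
  have hc : 0 ≤ 100 / √(t - s) := by positivity
  have hnn : ∀ ω, 0 ≤ A.indicator (fun ω => osc (fun u => L u ω) t T) ω := fun ω =>
    indicator_nonneg (fun ω _ => osc_nonneg (h.contL ω) htT.le) ω
  have h2 : ∫⁻ ω, ENNReal.ofReal (100 / √(t - s) * W ω) ∂P ≤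
      ENNReal.ofReal (100 / √(t - s) * ∫ ω in A, osc (fun u => L u ω) t T ∂P) := by
    rw [← integral_indicator hAm, ← integral_const_mul, ofReal_integral_eq_lintegral_ofReal
      ((ho.indicator hAm).const_mul _)
      (Eventually.of_forall fun ω => mul_nonneg hc (hnn ω))]
    refine lintegral_mono fun ω => ENNReal.ofReal_le_ofReal (mul_le_mul_of_nonneg_left ?_ hc)
    by_cases hω : ω ∈ A
    · rw [hW, piecewise_eq_of_mem _ _ _ hω, indicator_of_mem hω]
    · rw [hW, piecewise_eq_of_notMem _ _ _ hω, indicator_of_notMem hω]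
      norm_num
  refine ENNReal.toReal_le_of_le_ofReal (mul_nonneg hc (setIntegral_nonneg hAm fun ω _ =>
    osc_nonneg (h.contL ω) htT.le)) ((measure_mono hsub).trans (h1.trans h2))

/-- The constant in `measureReal_lowVisits_le`. -/
def lowConst (a : ℝ) : ℝ :=
  100 * (2 * oscConst + oscVisitConst a * (2 / (√2 ^ (1 - a) - 1)))

/-- The first term is the cost of no visit up to scale `J`. The second sums over earlier blocks the
expected oscillation without a visit, divided by `√(t - s)`; the sum is geometric and dominated by
its last term. -/
theorem measureReal_lowVisits_le {a s t r b : ℝ}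
    (h : IsPlanarBM (-Real.cos (2 * halfAngle a)) L R P) [IsProbabilityMeasure P]
    (ha : 0 < a) (ha1 : a < 1) (hst : s < t) (hr : 0 < r) (J : ℕ) (hJ : t + 2 ^ J * r ≤ b) :
    P.real (lowVisits L R s t r b) ≤ visitConst a * (√2 ^ a)⁻¹ ^ J +
      lowConst a / √(t - s) * (√r * (√2 ^ (1 - a)) ^ J) := by
  have hoc := one_le_oscConst
  have hov := oscVisitConst_nonneg ha ha1
  have h1 := (measureReal_mono (μ := P) (h.lowVisits_subset hst.le hr J hJ)).trans
    ((measureReal_union_le _ _).trans (add_le_add_right ((measureReal_union_le _ _).trans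
      (add_le_add_right (measureReal_biUnion_finset_le _ _) _)) _))
  refine h1.trans (add_le_add (h.measureReal_noVisit_le ha ha1 hr J) ?_)
  set w := √2 ^ (1 - a) with hw
  have hw1 : 1 < w := one_lt_sqrt_two_rpow ha1
  have hw2 : w ≤ 2 := by
    have h3 : (1 : ℝ) ≤ √2 := Real.one_le_sqrt.2 one_le_two
    have h4 : w ≤ √2 ^ (1 : ℝ) := Real.rpow_le_rpow_of_exponent_le h3 (by linarith)
    rw [Real.rpow_one] at h4
    exact h4.trans (Real.sqrt_le_iff.2 ⟨by norm_num, by norm_num⟩)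
  set c := 100 / √(t - s) with hc
  have hc0 : 0 ≤ c := by positivity
  have hb0 : P.real {ω | pastDepth L s t ω ≤ osc (fun u => L u ω) t (t + r)} ≤
      c * (2 * oscConst * √r) := by
    have h3 := h.measureReal_inter_pastDepth_le hst (by linarith : t < t + r)
      (A := univ) MeasurableSet.univ
    rw [univ_inter, setIntegral_univ] at h3
    refine h3.trans (mul_le_mul_of_nonneg_left ?_ hc0)
    simpa using (h.integrable_osc (by linarith : t < t + r)).2
  have hbj : ∀ j ∈ Finset.range J, P.real (noVisit L R t (t + r) (t + 2 ^ j * r) ∩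
      {ω | pastDepth L s t ω ≤ osc (fun u => L u ω) t (t + 2 ^ (j + 1) * r)}) ≤
      c * (oscVisitConst a * √r * w) * w ^ j := by
    intro j _
    have hp : ∀ i : ℕ, 0 < 2 ^ i * r := fun i => by positivity
    have hge : t + r ≤ t + 2 ^ j * r := by
      have : (1 : ℝ) ≤ 2 ^ j := one_le_pow₀ one_le_two
      nlinarith
    have hm : incrSigma L R (Icc t (t + 2 ^ j * r)) t ≤ incrSigma L R (Ici t) t :=
      incrSigma_le (fun _ hu => measurable_incrSigma_left (mem_Ici.2 hu.1))
        fun _ hu => measurable_incrSigma_right (mem_Ici.2 hu.1)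
    have h3 := h.measureReal_inter_pastDepth_le hst
      (by linarith [hp (j + 1)] : t < t + 2 ^ (j + 1) * r)
      (hm _ (h.measurableSet_noVisit (by linarith : t ≤ t + r) hge))
    refine h3.trans ((mul_le_mul_of_nonneg_left (h.setIntegral_osc_noVisit_le ha ha1 hr j)
      hc0).trans_eq ?_)
    rw [pow_succ]; ring
  have hsum := Finset.sum_le_sum hbj
  rw [← Finset.mul_sum, geom_sum_eq hw1.ne'] at hsum
  have hwJ : 1 ≤ w ^ J := one_le_pow₀ hw1.le
  have hgeom : c * (oscVisitConst a * √r * w) * ((w ^ J - 1) / (w - 1)) ≤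
      c * (oscVisitConst a * √r * 2) * (w ^ J / (w - 1)) := by
    have h5 : 0 ≤ (w ^ J - 1) / (w - 1) := div_nonneg (by linarith) (by linarith)
    refine mul_le_mul (by gcongr) (div_le_div_of_nonneg_right (by linarith) (by linarith)) h5
      (by positivity)
  have hb0' : c * (2 * oscConst * √r) ≤ c * (2 * oscConst * √r) * w ^ J :=
    le_mul_of_one_le_right (by positivity) hwJ
  refine (add_le_add (hb0.trans hb0') (hsum.trans hgeom)).trans_eq ?_
  rw [lowConst, hc]
  ring

end IsPlanarBM

end BadEvent

/-! ### From bin probabilities to the expected cover number. -/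

noncomputable section Covering

open Set Filter Topology

/-- Cone times depend only on the order of the values of each coordinate, hence not on the
normalisation by `√α`. -/
theorem ancestorFree_congr {z z' : ℝ → EuclideanSpace ℝ (Fin 2)}
    (hz : ∀ i s t, z s i ≤ z t i ↔ z' s i ≤ z' t i) (a b : ℝ) :
    ancestorFree z a b = ancestorFree z' a b := by
  have h : ∀ t, coneStarts z t = coneStarts z' t := by
    intro t
    ext t'
    simp only [coneStarts, Set.mem_ofPred_eq, hz]
  simp only [ancestorFree, IsConeInterval, IsConeTime, h]

/-- At a corner visit `S`, the time `t` is a cone start. A time `u ∈ [a, t]` with `L u < L S` would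
bar cone starts before `u`, so the cone interval ending at `S` would lie in `[a, b]` and contain
`p`. -/
theorem IsPlanarBM.mem_lowVisits {Ω : Type*} [MeasurableSpace Ω] {P : Measure Ω} {ρ : ℝ}
    {L R : ℝ → Ω → ℝ} (h : IsPlanarBM ρ L R P) {a b t r p : ℝ} {ω : Ω} (hr : 0 < r)
    (hp : p ∈ Icc t (t + r)) (hfree : p ∈ ancestorFree (fun u => !₂[L u ω, R u ω]) a b) :
    ω ∈ lowVisits L R a t r b := by
  intro S hS h0 u hu
  by_contra! hlt
  have htS : t < S := by linarith [hS.1]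
  have n1 := reflected_nonneg (h.contL ω) htS.le
  have n2 := reflected_nonneg (h.contR ω) htS.le
  simp only [cornerSum] at h0
  have z1 := (reflected_eq_zero_iff (h.contL ω) htS.le).1 (by linarith)
  have z2 := (reflected_eq_zero_iff (h.contR ω) htS.le).1 (by linarith)
  set z : ℝ → EuclideanSpace ℝ (Fin 2) := fun u => !₂[L u ω, R u ω] with hz
  have ht : t ∈ coneStarts z S := by
    refine ⟨htS, fun s hs i => ?_⟩
    fin_cases i
    · simpa [hz] using z1 s hs
    · simpa [hz] using z2 s hs
  have hlow : u ∈ lowerBounds (coneStarts z S) := by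
    intro t' ht'
    by_contra! hlt'
    have := ht'.2 u ⟨hlt'.le, hu.2.trans htS.le⟩ 0
    simp only [hz, PiLp.toLp_apply, Matrix.cons_val_zero] at this
    linarith
  have hglb := isGLB_csInf ⟨t, ht⟩ ⟨u, hlow⟩
  refine hfree.2 ⟨sInf (coneStarts z S), S, ⟨⟨t, ht⟩, hglb⟩, ?_, ?_⟩
  · exact Icc_subset_Icc (hu.1.trans (hglb.2 hlow)) hS.2
  · exact ⟨(hglb.1 ht).trans hp.1, hp.2.trans hS.1⟩

/-- The power `j ^ (-β)`, with the value `1` at `j = 0`. -/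
def cappedPow (β : ℝ) (j : ℕ) : ℝ := if j = 0 then 1 else (j : ℝ) ^ (-β)

/-- Concavity of the power `1 - β` gives an increment of at least `(1 - β) * x ^ (-β)` at `x = n +
1`, and `2 * (1 - β) ≥ 1`. -/
theorem sum_rpow_neg_le {β : ℝ} (hβ : 0 ≤ β) (hβ' : β ≤ 1 / 2) (n : ℕ) :
    ∑ j ∈ Finset.range n, ((j + 1 : ℕ) : ℝ) ^ (-β) ≤ 2 * (n : ℝ) ^ (1 - β) := by
  induction n with
  | zero => simp [Real.zero_rpow (by linarith : 1 - β ≠ 0)]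
  | succ n ih =>
    rw [Finset.sum_range_succ]
    set x : ℝ := ((n + 1 : ℕ) : ℝ) with hx
    have hx1 : 1 ≤ x := by rw [hx]; push_cast; linarith [(Nat.cast_nonneg n : (0 : ℝ) ≤ n)]
    have hx0 : 0 < x := by linarith
    have hn : (n : ℝ) = x * (1 + -x⁻¹) := by
      rw [hx]; push_cast; field_simp; ring
    have hinv : x⁻¹ ≤ 1 := inv_le_one_of_one_le₀ hx1
    have h1 := rpow_one_add_le_one_add_mul_self (s := -x⁻¹) (by linarith) (p := 1 - β)
      (by linarith) (by linarith)
    have h2 : (n : ℝ) ^ (1 - β) ≤ x ^ (1 - β) * (1 + (1 - β) * -x⁻¹) := by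
      rw [hn, Real.mul_rpow hx0.le (by linarith)]
      exact mul_le_mul_of_nonneg_left h1 (by positivity)
    have h3 : x ^ (1 - β) * x⁻¹ = x ^ (-β) := by
      rw [← Real.rpow_neg_one x, ← Real.rpow_add hx0]
      congr 1; ring
    have h4 : 0 ≤ x ^ (-β) := by positivity
    have h5 : x ^ (1 - β) * (1 + (1 - β) * -x⁻¹) = x ^ (1 - β) - (1 - β) * x ^ (-β) := by
      rw [← h3]; ring
    nlinarith

theorem sum_cappedPow_le {β : ℝ} (hβ : 0 ≤ β) (hβ' : β ≤ 1 / 2) {n : ℕ} (hn : 0 < n) :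
    ∑ j ∈ Finset.range n, cappedPow β j ≤ 3 * (n : ℝ) ^ (1 - β) := by
  obtain ⟨m, rfl⟩ := Nat.exists_eq_succ_of_ne_zero hn.ne'
  rw [Nat.succ_eq_add_one, Finset.sum_range_succ']
  have h1 := sum_rpow_neg_le hβ hβ' m
  have h2 : ∑ j ∈ Finset.range m, cappedPow β (j + 1) ≤ 2 * (m : ℝ) ^ (1 - β) := by
    simpa [cappedPow] using h1
  have h3 : (m : ℝ) ^ (1 - β) ≤ ((m + 1 : ℕ) : ℝ) ^ (1 - β) :=
    Real.rpow_le_rpow (by positivity) (by push_cast; linarith) (by linarith)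
  have h4 : 1 ≤ ((m + 1 : ℕ) : ℝ) ^ (1 - β) :=
    Real.one_le_rpow (by push_cast; linarith [(Nat.cast_nonneg m : (0 : ℝ) ≤ m)]) (by linarith)
  have h5 : cappedPow β 0 = 1 := by simp [cappedPow]
  linarith

namespace IsPlanarBM

variable {Ω : Type*} [MeasurableSpace Ω] {P : Measure Ω} {L R : ℝ → Ω → ℝ}

theorem one_le_lowConst {a : ℝ} (ha : 0 < a) (ha1 : a < 1) : 1 ≤ lowConst a := by
  have h1 := one_le_oscConst
  have h2 := oscVisitConst_nonneg ha ha1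
  have h3 : 0 < √2 ^ (1 - a) - 1 := sub_pos.2 (one_lt_sqrt_two_rpow ha1)
  have h4 : 0 ≤ oscVisitConst a * (2 / (√2 ^ (1 - a) - 1)) := by positivity
  rw [lowConst]
  linarith

theorem sqrt_two_rpow_pow (p : ℝ) (J : ℕ) : (√2 ^ p) ^ J = ((2 : ℝ) ^ J) ^ (p / 2) := by
  rw [Real.sqrt_eq_rpow, ← Real.rpow_mul (by norm_num), ← Real.rpow_natCast, ← Real.rpow_mul
    (by norm_num), ← Real.rpow_natCast, ← Real.rpow_mul (by norm_num)]
  congr 1; ring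

/-- The probability that the `k`-th of `M` bins of length `ε` meets the ancestor free times. -/
theorem measureReal_lowVisits_bin_le {al a b ε : ℝ}
    (h : IsPlanarBM (-Real.cos (2 * halfAngle al)) L R P) [IsProbabilityMeasure P]
    (ha : 0 < al) (ha1 : al < 1) (hε : 0 < ε) {M k : ℕ} (hM : a + ((M : ℝ) - 1) * ε ≤ b)
    (hk : k < M) :
    P.real (lowVisits L R a (a + k * ε) ε b) ≤ 2 * visitConst al * cappedPow (al / 2) (M - 1 - k) +
      lowConst al * (M : ℝ) ^ ((1 - al) / 2) * cappedPow (1 / 2) k := by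
  have hV := one_le_visitConst ha ha1
  have hLc := one_le_lowConst ha ha1
  have hM1 : (1 : ℝ) ≤ M := by exact_mod_cast (by omega : 1 ≤ M)
  have hMp : 1 ≤ (M : ℝ) ^ ((1 - al) / 2) := Real.one_le_rpow hM1 (by linarith)
  have hcap : ∀ β j, 0 ≤ cappedPow β j := fun β j => by
    rw [cappedPow]; split_ifs <;> positivity
  have n1 : 0 ≤ 2 * visitConst al * cappedPow (al / 2) (M - 1 - k) :=
    mul_nonneg (by linarith) (hcap _ _)
  have n2 : 0 ≤ lowConst al * (M : ℝ) ^ ((1 - al) / 2) * cappedPow (1 / 2) k :=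
    mul_nonneg (by positivity) (hcap _ _)
  have hle1 := measureReal_le_one (μ := P) (s := lowVisits L R a (a + k * ε) ε b)
  -- In the first and the last bin the capped power is `1`, and the trivial bound on a probability
  -- suffices.
  rcases Nat.eq_zero_or_pos k with hk0 | hk0
  · have e : cappedPow (1 / 2) k = 1 := by simp [cappedPow, hk0]
    rw [e] at n2 ⊢
    nlinarith
  rcases Nat.eq_zero_or_pos (M - 1 - k) with hm0 | hm0
  · have e : cappedPow (al / 2) (M - 1 - k) = 1 := by simp [cappedPow, hm0]
    rw [e] at n1 ⊢
    linarith
  set m := M - 1 - k with hm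
  have hkr : (0 : ℝ) < k := by exact_mod_cast hk0
  have hmr : (0 : ℝ) < m := by exact_mod_cast hm0
  have hmM : (m : ℝ) = M - 1 - k := by
    have : m + k + 1 = M := by omega
    have : (m : ℝ) + k + 1 = M := by exact_mod_cast this
    linarith
  -- The scale `2 ^ J` is comparable to the number `m` of later bins, and `2 ^ J ≤ m` keeps `a + k *
  -- ε + 2 ^ J * ε` at most `b`.
  set J := Nat.log 2 m with hJ
  have hJ1 : (2 : ℝ) ^ J ≤ m := by exact_mod_cast Nat.pow_log_le_self 2 hm0.ne'
  have hJ2 : (m : ℝ) < 2 * 2 ^ J := by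
    have := Nat.lt_pow_succ_log_self (b := 2) (by norm_num) m
    rw [pow_succ, mul_comm] at this
    exact_mod_cast this
  have h1 := h.measureReal_lowVisits_le (s := a) (t := a + k * ε) (b := b) ha ha1
    (by have : 0 < k * ε := by positivity
        linarith) hε J (by
      have : (2 : ℝ) ^ J * ε ≤ m * ε := mul_le_mul_of_nonneg_right hJ1 hε.le
      rw [hmM] at this
      linarith)
  refine h1.trans (add_le_add ?_ ?_)
  · rw [cappedPow, if_neg hm0.ne', inv_pow, sqrt_two_rpow_pow, mul_assoc 2, mul_left_comm]
    refine mul_le_mul_of_nonneg_left ?_ (by linarith)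
    rw [← Real.rpow_neg (by positivity)]
    have e1 : ((2 : ℝ) ^ J) ^ (-(al / 2)) ≤ ((m : ℝ) / 2) ^ (-(al / 2)) :=
      Real.rpow_le_rpow_of_nonpos (by positivity) (by linarith) (by linarith)
    refine e1.trans ?_
    rw [Real.div_rpow hmr.le (by norm_num), div_eq_mul_inv, mul_comm,
      ← Real.rpow_neg (by norm_num), neg_neg]
    refine mul_le_mul_of_nonneg_right ?_ (by positivity)
    simpa using Real.rpow_le_rpow_of_exponent_le (one_le_two : (1 : ℝ) ≤ 2)
      (by linarith : al / 2 ≤ 1)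
  · rw [cappedPow, if_neg hk0.ne', sqrt_two_rpow_pow, add_sub_cancel_left]
    have e1 : ((2 : ℝ) ^ J) ^ ((1 - al) / 2) ≤ (M : ℝ) ^ ((1 - al) / 2) :=
      Real.rpow_le_rpow (by positivity) (by linarith) (by linarith)
    have e2 : (k : ℝ) ^ (-(1 / 2) : ℝ) = (√k)⁻¹ := by
      rw [Real.rpow_neg hkr.le, Real.sqrt_eq_rpow]
    have e3 : 0 < √ε := Real.sqrt_pos.2 hε
    have e4 : 0 < √(k : ℝ) := Real.sqrt_pos.2 hkr
    rw [e2, Real.sqrt_mul hkr.le]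
    calc lowConst al / (√k * √ε) * (√ε * ((2 : ℝ) ^ J) ^ ((1 - al) / 2))
        = lowConst al * ((2 : ℝ) ^ J) ^ ((1 - al) / 2) * (√k)⁻¹ := by field_simp
      _ ≤ _ := by gcongr

theorem lintegral_intervalCoverNumber_le {al a b ε : ℝ}
    (h : IsPlanarBM (-Real.cos (2 * halfAngle al)) L R P) [IsProbabilityMeasure P]
    (ha : 0 < al) (ha1 : al < 1) (hab : a < b) (hε : 0 < ε) (hε1 : ε < 1) :
    ∫⁻ ω, (intervalCoverNumber ε (ancestorFree (fun u => !₂[L u ω, R u ω]) a b) : ENNReal) ∂P ≤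
      ENNReal.ofReal ((6 * visitConst al + 3 * lowConst al) * (b - a + 1) ^ (1 - al / 2) *
        ε ^ (-(1 - al / 2))) := by
  classical
  have hV := one_le_visitConst ha ha1
  have hLc := one_le_lowConst ha ha1
  set M := ⌈(b - a) / ε⌉₊ with hM
  have hba : 0 < (b - a) / ε := div_pos (sub_pos.2 hab) hε
  have hM0 : 0 < M := Nat.ceil_pos.2 hba
  have hMr : (0 : ℝ) < M := by exact_mod_cast hM0
  have hM1 : (M : ℝ) < (b - a) / ε + 1 := Nat.ceil_lt_add_one hba.le
  have hM2 : (b - a) / ε ≤ M := Nat.le_ceil _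
  have hMb : a + ((M : ℝ) - 1) * ε ≤ b := by
    have : ((M : ℝ) - 1) * ε ≤ (b - a) / ε * ε := mul_le_mul_of_nonneg_right (by linarith) hε.le
    rw [div_mul_cancel₀ _ hε.ne'] at this
    linarith
  have hMa : b ≤ a + M * ε := by
    have := (div_le_iff₀ hε).1 hM2
    linarith
  -- Measurable hulls have the same measure, so measurability of `lowVisits` need not be checked.
  set B : ℕ → Set Ω := fun k => toMeasurable P (lowVisits L R a (a + k * ε) ε b) with hB
  have hpt : ∀ ω, (intervalCoverNumber ε (ancestorFree (fun u => !₂[L u ω, R u ω]) a b) :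
      ENNReal) ≤ ∑ k ∈ Finset.range M, (B k).indicator (fun _ => (1 : ENNReal)) ω := by
    intro ω
    refine (intervalCoverNumber_le_sum M (fun k => a + k * ε) ?_).trans
      (Finset.sum_le_sum fun k _ => ?_)
    · intro p hp
      -- Rounding up and subtracting one keeps `p = b` in the last of the `M` closed bins even when
      -- `ε` divides `b - a`; the point `p = a` is treated apart.
      set k := ⌈(p - a) / ε⌉₊ - 1 with hk
      have hpa : 0 ≤ (p - a) / ε := div_nonneg (by linarith [hp.1.1]) hε.le
      rcases hpa.eq_or_lt with h0 | h0
      · refine mem_biUnion (Finset.mem_coe.2 (Finset.mem_range.2 hM0)) ?_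
        have : p - a = 0 := by
          rcases div_eq_zero_iff.1 h0.symm with h' | h'
          · exact h'
          · exact absurd h' hε.ne'
        simp only [Nat.cast_zero, zero_mul, add_zero]
        constructor <;> linarith
      · have hc0 : 0 < ⌈(p - a) / ε⌉₊ := Nat.ceil_pos.2 h0
        have hkc : (k : ℝ) + 1 = ⌈(p - a) / ε⌉₊ := by
          have : k + 1 = ⌈(p - a) / ε⌉₊ := by omega
          exact_mod_cast this
        have hcM : ⌈(p - a) / ε⌉₊ ≤ M :=
          Nat.ceil_le_ceil (div_le_div_of_nonneg_right (by linarith [hp.1.2]) hε.le)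
        have l1 := Nat.ceil_lt_add_one hpa
        have l2 := Nat.le_ceil ((p - a) / ε)
        rw [← hkc] at l1 l2
        refine mem_biUnion (Finset.mem_coe.2 (Finset.mem_range.2 (by omega : k < M))) ⟨?_, ?_⟩
        · have := (le_div_iff₀ hε).1 (by linarith : (k : ℝ) ≤ (p - a) / ε)
          linarith
        · have := (div_le_iff₀ hε).1 l2
          linarith
    · split_ifs with hne
      · obtain ⟨p, hp, hp'⟩ := hne
        have : ω ∈ B k := subset_toMeasurable _ _ (h.mem_lowVisits hε hp' hp)
        rw [indicator_of_mem this]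
      · exact zero_le
  have hmeas : ∀ k ∈ Finset.range M, P (B k) ≤ ENNReal.ofReal
      (2 * visitConst al * cappedPow (al / 2) (M - 1 - k) +
        lowConst al * (M : ℝ) ^ ((1 - al) / 2) * cappedPow (1 / 2) k) := by
    intro k hk
    rw [hB, measure_toMeasurable, ← ofReal_measureReal]
    exact ENNReal.ofReal_le_ofReal
      (h.measureReal_lowVisits_bin_le ha ha1 hε hMb (Finset.mem_range.1 hk))
  have hcap : ∀ β j, 0 ≤ cappedPow β j := fun β j => by
    rw [cappedPow]; split_ifs <;> positivity
  have hreal : ∑ k ∈ Finset.range M, (2 * visitConst al * cappedPow (al / 2) (M - 1 - k) +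
      lowConst al * (M : ℝ) ^ ((1 - al) / 2) * cappedPow (1 / 2) k) ≤
      (6 * visitConst al + 3 * lowConst al) * (b - a + 1) ^ (1 - al / 2) *
        ε ^ (-(1 - al / 2)) := by
    rw [Finset.sum_add_distrib, ← Finset.mul_sum, ← Finset.mul_sum,
      Finset.sum_range_reflect (fun j => cappedPow (al / 2) j) M]
    have s1 := sum_cappedPow_le (β := al / 2) (by linarith) (by linarith) hM0
    have s2 := sum_cappedPow_le (β := 1 / 2) (by norm_num) le_rfl hM0
    -- Thus the two contributions, from avoiding the corner and from undercutting the past, have the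
    -- same order.
    have e : (M : ℝ) ^ ((1 - al) / 2) * (M : ℝ) ^ (1 - 1 / 2 : ℝ) = (M : ℝ) ^ (1 - al / 2) := by
      rw [← Real.rpow_add hMr]; congr 1; ring
    have t1 : 2 * visitConst al * ∑ j ∈ Finset.range M, cappedPow (al / 2) j ≤
        2 * visitConst al * (3 * (M : ℝ) ^ (1 - al / 2)) :=
      mul_le_mul_of_nonneg_left s1 (by linarith)
    have t2 : lowConst al * (M : ℝ) ^ ((1 - al) / 2) * ∑ j ∈ Finset.range M, cappedPow (1 / 2) j ≤
        lowConst al * (M : ℝ) ^ ((1 - al) / 2) * (3 * (M : ℝ) ^ (1 - 1 / 2 : ℝ)) :=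
      mul_le_mul_of_nonneg_left s2 (by positivity)
    have t3 : (M : ℝ) ^ (1 - al / 2) ≤ (b - a + 1) ^ (1 - al / 2) * ε ^ (-(1 - al / 2)) := by
      rw [Real.rpow_neg hε.le, ← div_eq_mul_inv, ← Real.div_rpow (by linarith) hε.le]
      refine Real.rpow_le_rpow hMr.le (hM1.le.trans ?_) (by linarith)
      rw [add_div]
      have : 1 ≤ 1 / ε := by rw [le_div_iff₀ hε]; linarith
      linarith
    calc _ ≤ 2 * visitConst al * (3 * (M : ℝ) ^ (1 - al / 2)) +
          lowConst al * (M : ℝ) ^ ((1 - al) / 2) * (3 * (M : ℝ) ^ (1 - 1 / 2 : ℝ)) :=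
          add_le_add t1 t2
      _ = (6 * visitConst al + 3 * lowConst al) * (M : ℝ) ^ (1 - al / 2) := by rw [← e]; ring
      _ ≤ _ := by
        rw [mul_assoc]
        exact mul_le_mul_of_nonneg_left t3 (by linarith)
  calc _ ≤ ∫⁻ ω, ∑ k ∈ Finset.range M, (B k).indicator (fun _ => (1 : ENNReal)) ω ∂P :=
        lintegral_mono hpt
    _ = ∑ k ∈ Finset.range M, P (B k) := by
        rw [lintegral_finsetSum _ fun k _ =>
          measurable_const.indicator (measurableSet_toMeasurable _ _)]
        refine Finset.sum_congr rfl fun k _ => ?_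
        rw [lintegral_indicator (measurableSet_toMeasurable _ _), setLIntegral_const, one_mul]
    _ ≤ _ := Finset.sum_le_sum hmeas
    _ = _ := (ENNReal.ofReal_sum_of_nonneg fun k _ => add_nonneg
        (mul_nonneg (by linarith) (hcap _ _)) (mul_nonneg (by positivity) (hcap _ _))).symm
    _ ≤ _ := ENNReal.ofReal_le_ofReal hreal

end IsPlanarBM

end Covering

/-! ### The theorem. -/

theorem proposition4p5 (κ' : ℝ) (hκ : 4 < κ') (hκ' : κ' < 8) (a b : ℝ) (hab : a < b) :
    ∃ C : ℝ, 0 < C ∧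
      ∀ (α : ℝ), 0 < α →
      ∀ (Ω : Type*) [MeasurableSpace Ω] (P : Measure Ω) [IsProbabilityMeasure P]
        (Z : ℝ → Ω → EuclideanSpace ℝ (Fin 2)),
        IsCorrelatedBM (covMat α (4 / Real.sqrt κ')) Z P →
        ∀ ε : ℝ, 0 < ε → ε < 1 →
          AEMeasurable
            (fun ω ↦ (intervalCoverNumber ε (ancestorFree (fun t ↦ Z t ω) a b) : ENNReal)) P ∧
          ∫⁻ ω, (intervalCoverNumber ε (ancestorFree (fun t ↦ Z t ω) a b) : ENNReal) ∂P
            ≤ ENNReal.ofReal (C * ε ^ (-(κ' / 8))) := by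
  -- The condition `4 < κ' < 8` says exactly `0 < al < 1`, and `1 - al / 2 = κ' / 8`.
  set al : ℝ := 2 - κ' / 4 with hal
  have ha : 0 < al := by linarith
  have ha1 : al < 1 := by linarith
  have hV := IsPlanarBM.one_le_visitConst ha ha1
  have hLc := IsPlanarBM.one_le_lowConst ha ha1
  have hba : 0 < b - a + 1 := by linarith
  refine ⟨(6 * IsPlanarBM.visitConst al + 3 * IsPlanarBM.lowConst al) *
    (b - a + 1) ^ (1 - al / 2), by positivity, ?_⟩
  intro α hα Ω _ P _ Z hZ ε hε hε1
  obtain ⟨L, R, h, hLR⟩ := hZ.exists_isPlanarBM hα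
  -- Both sides equal `4π/κ'`: the angle in the covariance is the full opening of the cone on which
  -- the exponent is `al`.
  have hang : Real.pi * (4 / √κ') ^ 2 / 4 = 2 * halfAngle al := by
    have h0 : 0 < κ' := by linarith
    have h2 : 2 - al = κ' / 4 := by rw [hal]; ring
    rw [div_pow, Real.sq_sqrt h0.le, halfAngle, h2]
    field_simp
  rw [hang] at h
  have hsq : 0 < √α := Real.sqrt_pos.2 hα
  have hae : (fun ω => (intervalCoverNumber ε (ancestorFree (fun u => !₂[L u ω, R u ω]) a b) :
      ENNReal)) =ᵐ[P]
      fun ω => (intervalCoverNumber ε (ancestorFree (fun t => Z t ω) a b) : ENNReal) := by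
    filter_upwards [hLR] with ω hω
    rw [ancestorFree_congr (z := fun t => Z t ω) (z' := fun u => !₂[L u ω, R u ω])]
    intro i s t
    fin_cases i
    · simp [(hω s).1, (hω t).1, hsq]
    · simp [(hω s).2, (hω t).2, hsq]
  refine ⟨?_, ?_⟩
  · refine AEMeasurable.congr ?_ hae
    refine aemeasurable_intervalCoverNumber (Z := fun u ω => !₂[L u ω, R u ω]) P (fun t => ?_)
      (fun ω => ?_) a b hε.le
    · have h1 := h.measL t
      have h2 := h.measR t
      refine (WithLp.measurable_toLp 2 _).comp (measurable_pi_lambda _ fun i => ?_)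
      fin_cases i
      · exact h1
      · exact h2
    · refine (PiLp.continuous_toLp 2 _).comp (continuous_pi fun i => ?_)
      fin_cases i
      · exact h.contL ω
      · exact h.contR ω
  · rw [← lintegral_congr_ae hae]
    have := h.lintegral_intervalCoverNumber_le ha ha1 hab hε hε1
    rwa [show 1 - al / 2 = κ' / 8 by rw [hal]; ring] at this ⊢
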